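/- Conventions. Let $M$ be a compact smooth manifold with a smooth Riemannian metric and $f$ a Morse function on $M$. For critical points $p,q$ let $\mathcal D(p)$ (resp. $\mathcal A(q)$) be the set of points whose flow line of $-\nabla f$ tends to $p$ as $t\to-\infty$ (resp. to $q$ as $t\to+\infty$); $-\nabla f$ satisfies transversality if all $\mathcal D(p)$ and $\mathcal A(q)$ are transversal. Let $\mathcal M(p,q)$ be the set of flow lines of $-\nabla f$ from $p$ to $q$, modulo time shift. Write $p\succ q$ if $p\ne q$ and there is a flow line from $p$ to $q$. A critical sequence from $p$ to $q$ is a sequence of critical points $p=r_0\succ r_1\succ\cdots\succ r_{k+1}=q$ with $k\ge 0$, and $\overline{\mathcal M(p,q)}$ is the disjoint union, over all critical sequences from $p$ to $q$, of the products $\prod_{i=0}^{k}\mathcal M(r_i,r_{i+1})$. Statement. On $\mathbb{CP}^2$ there are a smooth Riemannian metric and a Morse function $f$ with exactly three critical points $p,r,q$, of index $4$, $2$ and $0$ respectively, with $f(q)<f(r)<f(p)$, such that $-\nabla f$ satisfies transversality, the critical sequences from $p$ to $q$ are exactly $(p,q)$ and $(p,r,q)$, so that $$\overline{\mathcal M(p,q)}=\mathcal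 M(p,q)\sqcup\bigl(\mathcal M(p,r)\times\mathcal M(r,q)\bigr),$$ and the following holds for all $a_0\in(f(r),f(p))$ and $a_1\in(f(q),f(r))$. For every $\alpha\in\overline{\mathcal M(p,q)}$ the union of the components of $\alpha$ meets $f^{-1}(a_i)$ in exactly one point $x_i(\alpha)$ ($i=0,1$), and the image of the evaluation map $$E:\overline{\mathcal M(p,q)}\to f^{-1}(a_0)\times f^{-1}(a_1),\qquad E(\alpha)=(x_0(\alpha),x_1(\alpha)),$$ is not a $C^1$ embedded submanifold with boundary of $f^{-1}(a_0)\times f^{-1}(a_1)$, whatever subset of the image is taken as the boundary; in particular not with boundary $E(\mathcal M(p,r)\times\mathcal M(r,q))$. -/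

import Mathlib

open scoped Manifold ContDiff Topology

noncomputable section

/-! ## The complex projective plane as a smooth real 4-manifold -/

/-- The complex projective plane: lines through the origin of `ℂ³`. -/
def CP2 : Type := Projectivization ℂ (Fin 3 → ℂ)

namespace CP2

/-- The class `[v]` of a nonzero vector `v` of `ℂ³`. -/
def mk (v : {v : Fin 3 → ℂ // v ≠ 0}) : CP2 := Projectivization.mk' ℂ v

/-- The quotient topology. -/
instance : TopologicalSpace CP2 := TopologicalSpace.coinduced mk inferInstance

theorem isQuotientMap_mk : Topology.IsQuotientMap mk :=
  ⟨⟨rfl⟩, fun x => ⟨⟨x.rep, x.rep_nonzero⟩, x.mk_rep⟩⟩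

theorem mk_eq_mk_iff (v w : {v : Fin 3 → ℂ // v ≠ 0}) :
    mk v = mk w ↔ ∃ a : ℂ, a • w.1 = v.1 :=
  Projectivization.mk_eq_mk_iff' ℂ v.1 w.1 v.2 w.2

/-- The `i`-th affine coordinates `[v] ↦ (v j / v i)`, where `j` runs through the indices other
than `i` in increasing order. -/
def affine (i : Fin 3) (x : CP2) : Fin 2 → ℂ :=
  Projectivization.lift (fun v : {v : Fin 3 → ℂ // v ≠ 0} =>
    (fun j : Fin 2 => v.1 (i.succAbove j) / v.1 i)) (by
      intro a b t h
      have ht : t ≠ 0 := by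
        rintro rfl
        exact a.2 (by simpa using h)
      funext j
      simp only [h, Pi.smul_apply, smul_eq_mul]
      exact mul_div_mul_left _ _ ht) x

theorem affine_mk (i : Fin 3) (v : {v : Fin 3 → ℂ // v ≠ 0}) :
    affine i (mk v) = fun j => v.1 (i.succAbove j) / v.1 i := rfl

/-- The vector with `i`-th entry `1` and the other entries given by `w`. -/
def homog (i : Fin 3) (w : Fin 2 → ℂ) : {v : Fin 3 → ℂ // v ≠ 0} :=
  ⟨i.insertNth (α := fun _ => ℂ) 1 w, fun h => by
    have := congrFun h i
    simp at this⟩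

/-- The open set of those `[v]` with `v i ≠ 0`. -/
def affineSet (i : Fin 3) : Set CP2 := mk '' {v | v.1 i ≠ 0}

theorem mk_mem_affineSet (i : Fin 3) (v : {v : Fin 3 → ℂ // v ≠ 0}) :
    mk v ∈ affineSet i ↔ v.1 i ≠ 0 := by
  constructor
  · rintro ⟨w, hw, h⟩
    obtain ⟨a, ha⟩ := (mk_eq_mk_iff w v).1 h
    intro h0
    apply hw
    rw [← ha]
    simp [h0]
  · exact fun h => ⟨v, h, rfl⟩

theorem isOpen_affineSet (i : Fin 3) : IsOpen (affineSet i) := by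
  rw [← isQuotientMap_mk.isOpen_preimage]
  have : mk ⁻¹' affineSet i = {v | v.1 i ≠ 0} := by
    ext v
    exact mk_mem_affineSet i v
  rw [this]
  exact isOpen_ne_fun ((continuous_apply i).comp continuous_subtype_val) continuous_const

theorem continuous_homog (i : Fin 3) : Continuous (homog i) := by
  refine Continuous.subtype_mk ?_ _
  refine continuous_pi fun j => ?_
  refine Fin.succAboveCases i ?_ (fun k => ?_) j
  · simpa using continuous_const
  · simpa using continuous_apply k

theorem mk_homog_affine (i : Fin 3) (x : CP2) (hx : x ∈ affineSet i) :
    mk (homog i (affine i x)) = x := by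
  obtain ⟨v, hv, rfl⟩ := hx
  rw [mk_eq_mk_iff]
  refine ⟨(v.1 i)⁻¹, ?_⟩
  funext j
  refine Fin.succAboveCases i ?_ (fun k => ?_) j
  · simpa [homog] using inv_mul_cancel₀ hv
  · simp [homog, affine_mk, div_eq_inv_mul]

theorem affine_mk_homog (i : Fin 3) (w : Fin 2 → ℂ) : affine i (mk (homog i w)) = w := by
  funext j
  simp [affine_mk, homog]

theorem mk_homog_mem (i : Fin 3) (w : Fin 2 → ℂ) : mk (homog i w) ∈ affineSet i :=
  (mk_mem_affineSet i _).2 (by simp [homog])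

theorem continuousOn_affine (i : Fin 3) : ContinuousOn (affine i) (affineSet i) := by
  have hq := isQuotientMap_mk.continuousOn_isOpen_iff (g := affine i) (isOpen_affineSet i)
  rw [hq]
  have h : ContinuousOn (fun v : {v : Fin 3 → ℂ // v ≠ 0} =>
      (fun j : Fin 2 => v.1 (i.succAbove j) / v.1 i)) (mk ⁻¹' affineSet i) := by
    refine continuousOn_pi.2 fun j => ?_
    refine ContinuousOn.div ?_ ?_ fun v hv => (mk_mem_affineSet i v).1 hv
    · exact ((continuous_apply _).comp continuous_subtype_val).continuousOn
    · exact ((continuous_apply _).comp continuous_subtype_val).continuousOn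
  exact h

/-- The `i`-th affine chart. -/
def affineChart (i : Fin 3) : OpenPartialHomeomorph CP2 (Fin 2 → ℂ) where
  toFun := affine i
  invFun w := mk (homog i w)
  source := affineSet i
  target := Set.univ
  map_source' _ _ := Set.mem_univ _
  map_target' w _ := mk_homog_mem i w
  left_inv' x hx := mk_homog_affine i x hx
  right_inv' w _ := affine_mk_homog i w
  open_source := isOpen_affineSet i
  open_target := isOpen_univ
  continuousOn_toFun := continuousOn_affine i
  continuousOn_invFun :=
    (isQuotientMap_mk.continuous.comp (continuous_homog i)).continuousOn

theorem exists_mem_affineSet (x : CP2) : ∃ i, x ∈ affineSet i := by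
  obtain ⟨v, rfl⟩ := isQuotientMap_mk.surjective x
  obtain ⟨i, hi⟩ := Function.ne_iff.1 v.2
  exact ⟨i, (mk_mem_affineSet i v).2 hi⟩

/-- The atlas of the three affine charts. -/
instance : ChartedSpace (Fin 2 → ℂ) CP2 where
  atlas := Set.range affineChart
  chartAt x := affineChart (exists_mem_affineSet x).choose
  mem_chart_source x := (exists_mem_affineSet x).choose_spec
  chart_mem_atlas _ := Set.mem_range_self _

/-- The affine charts make `CP2` a smooth real manifold. -/
instance : IsManifold 𝓘(ℝ, Fin 2 → ℂ) ∞ CP2 := by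
  refine isManifold_of_contDiffOn _ _ _ ?_
  rintro _ _ ⟨i, rfl⟩ ⟨k, rfl⟩
  have hs : ∀ w : Fin 2 → ℂ, w ∈ ((affineChart i).symm ≫ₕ affineChart k).source →
      (homog i w).1 k ≠ 0 := by
    intro w hw
    rw [OpenPartialHomeomorph.trans_source] at hw
    exact (mk_mem_affineSet k _).1 hw.2
  have hc : ∀ j : Fin 3, ContDiff ℝ ∞ (fun w : Fin 2 → ℂ => (homog i w).1 j) := by
    intro j
    refine Fin.succAboveCases i ?_ (fun l => ?_) j
    · simpa [homog] using contDiff_const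
    · simpa [homog] using contDiff_apply ℝ ℂ l
  have : ContDiffOn ℝ ∞ (fun w : Fin 2 → ℂ => fun j : Fin 2 =>
      (homog i w).1 (k.succAbove j) / (homog i w).1 k)
      ((affineChart i).symm ≫ₕ affineChart k).source := by
    refine contDiffOn_pi.2 fun j => ?_
    simp only [div_eq_mul_inv]
    exact (hc _).contDiffOn.mul ((hc k).contDiffOn.inv hs)
  refine (this.mono fun w hw => hw.1).congr fun w _ => rfl

instance : IsManifold 𝓘(ℝ, Fin 2 → ℂ) 1 CP2 :=
  IsManifold.of_le (n := ∞) (by exact_mod_cast le_top)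

end CP2

/-! ## Morse functions and negative gradient dynamics

`M` is a smooth manifold without boundary, modelled on the finite dimensional space `E`. On the
compact manifold considered below every maximal flow line is defined on all of `ℝ`. -/

namespace MorseFlow

variable {E : Type*} [NormedAddCommGroup E] [NormedSpace ℝ E]
  {M : Type*} [TopologicalSpace M] [ChartedSpace E M]

variable (E) in
/-- `p` is a critical point of `f`. -/
def IsCritical (f : M → ℝ) (p : M) : Prop := mfderiv 𝓘(ℝ, E) 𝓘(ℝ, ℝ) f p = 0

variable (E) in
/-- The second derivative of `f` at `p` in the preferred chart at `p`. At a critical point this is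
the Hessian of `f`. -/
def hessian (f : M → ℝ) (p : M) : LinearMap.BilinForm ℝ E :=
  (fderiv ℝ (fderiv ℝ (f ∘ (extChartAt 𝓘(ℝ, E) p).symm))
    (extChartAt 𝓘(ℝ, E) p p)).toBilinForm

variable (E) in
/-- A Morse function: smooth, with nondegenerate Hessian at each critical point. -/
def IsMorse (f : M → ℝ) : Prop :=
  ContMDiff 𝓘(ℝ, E) 𝓘(ℝ, ℝ) ∞ f ∧ ∀ p, IsCritical E f p → (hessian E f p).Nondegenerate

variable (E) in
/-- The index of a critical point: the largest dimension of a subspace on which the Hessian is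
negative definite. -/
def index (f : M → ℝ) (p : M) : ℕ :=
  _root_.sigNeg (LinearMap.BilinMap.toQuadraticMap (hessian E f p))

section Flow

variable [IsManifold 𝓘(ℝ, E) 1 M]

variable (E M) in
/-- Smooth Riemannian metrics on `M`. -/
abbrev Metric := Bundle.ContMDiffRiemannianMetric (B := M) 𝓘(ℝ, E) ∞ E
  (TangentSpace 𝓘(ℝ, E) : M → Type _)

/-- The scalar product at `x`, as a bilinear form on the tangent space. -/
def metricForm (g : Metric E M) (x : M) : LinearMap.BilinForm ℝ (TangentSpace 𝓘(ℝ, E) x) :=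
  LinearMap.mk₂ ℝ (fun v w => g.inner x v w)
    (fun v v' w => by simp) (fun c v w => by simp) (fun v w w' => by simp)
    (fun c v w => by simp)

theorem metricForm_nondegenerate (g : Metric E M) (x : M) : (metricForm g x).Nondegenerate := by
  constructor
  · intro v hv
    by_contra h
    exact (g.pos x v h).ne' (hv v)
  · intro v hv
    by_contra h
    exact (g.pos x v h).ne' (hv v)

variable [FiniteDimensional ℝ E]

instance (x : M) : FiniteDimensional ℝ (TangentSpace 𝓘(ℝ, E) x) :=
  inferInstanceAs (FiniteDimensional ℝ E)

/-- The gradient of `f` with respect to `g`: the tangent vector dual to `df`. -/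
def gradient (g : Metric E M) (f : M → ℝ) (x : M) : TangentSpace 𝓘(ℝ, E) x :=
  ((metricForm g x).toDual (metricForm_nondegenerate g x)).symm
    (mfderiv 𝓘(ℝ, E) 𝓘(ℝ, ℝ) f x : TangentSpace 𝓘(ℝ, E) x →L[ℝ] ℝ).toLinearMap

theorem inner_gradient (g : Metric E M) (f : M → ℝ) (x : M) (w : TangentSpace 𝓘(ℝ, E) x) :
    g.inner x (gradient g f x) w = mfderiv 𝓘(ℝ, E) 𝓘(ℝ, ℝ) f x w :=
  LinearMap.BilinForm.apply_toDual_symm_apply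
    (B := metricForm g x) (hB := metricForm_nondegenerate g x)
    (mfderiv 𝓘(ℝ, E) 𝓘(ℝ, ℝ) f x : TangentSpace 𝓘(ℝ, E) x →L[ℝ] ℝ).toLinearMap w

/-- `γ` is a flow line of `-∇f`. -/
def IsFlowLine (g : Metric E M) (f : M → ℝ) (γ : ℝ → M) : Prop :=
  IsMIntegralCurve (I := 𝓘(ℝ, E)) γ (fun x => -gradient g f x)

/-- The descending manifold of `p`. -/
def descending (g : Metric E M) (f : M → ℝ) (p : M) : Set M :=
  {x | ∃ γ : ℝ → M, IsFlowLine g f γ ∧ γ 0 = x ∧ Filter.Tendsto γ Filter.atBot (𝓝 p)}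

/-- The ascending manifold of `p`. -/
def ascending (g : Metric E M) (f : M → ℝ) (p : M) : Set M :=
  {x | ∃ γ : ℝ → M, IsFlowLine g f γ ∧ γ 0 = x ∧ Filter.Tendsto γ Filter.atTop (𝓝 p)}

variable (E) in
/-- `v` is tangent to `S` at `x`: it is the velocity of a smooth curve in `S` through `x`. For an
embedded submanifold `S` these vectors form its tangent space at `x`. -/
def IsTangentTo (S : Set M) (x : M) (v : TangentSpace 𝓘(ℝ, E) x) : Prop :=
  ∃ γ : ℝ → M, ContMDiffAt 𝓘(ℝ, ℝ) 𝓘(ℝ, E) ∞ γ 0 ∧ (∀ᶠ t in 𝓝 0, γ t ∈ S) ∧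
    (⟨γ 0, mfderiv 𝓘(ℝ, ℝ) 𝓘(ℝ, E) γ 0 (1 : ℝ)⟩ : TangentBundle 𝓘(ℝ, E) M) = ⟨x, v⟩

/-- Transversality of `-∇f`: all descending manifolds are transversal to all ascending manifolds,
that is, at each common point their tangent spaces span that of `M`. -/
def SatisfiesTransversality (g : Metric E M) (f : M → ℝ) : Prop :=
  ∀ p q, IsCritical E f p → IsCritical E f q →
    ∀ x ∈ descending g f p ∩ ascending g f q, ∀ v : TangentSpace 𝓘(ℝ, E) x,
      ∃ u w, IsTangentTo E (descending g f p) x u ∧ IsTangentTo E (ascending g f q) x w ∧ v = u + w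

/-- A flow line of `-∇f` from `p` to `q`. -/
structure FlowLine (g : Metric E M) (f : M → ℝ) (p q : M) where
  toFun : ℝ → M
  isFlowLine : IsFlowLine g f toFun
  tendsto_atBot : Filter.Tendsto toFun Filter.atBot (𝓝 p)
  tendsto_atTop : Filter.Tendsto toFun Filter.atTop (𝓝 q)

/-- Two flow lines are identified if they differ by a time shift. -/
def shiftSetoid (g : Metric E M) (f : M → ℝ) (p q : M) : Setoid (FlowLine g f p q) where
  r γ δ := ∃ s : ℝ, ∀ t, γ.toFun t = δ.toFun (t + s)
  iseqv :=
    { refl := fun γ => ⟨0, fun t => by rw [add_zero]⟩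
      symm := by
        rintro γ δ ⟨s, h⟩
        exact ⟨-s, fun t => by rw [h (t + -s), neg_add_cancel_right]⟩
      trans := by
        rintro γ δ ε ⟨s, h⟩ ⟨s', h'⟩
        exact ⟨s + s', fun t => by rw [h, h', add_assoc]⟩ }

/-- The moduli space `𝓜(p, q)` of flow lines from `p` to `q`. -/
def Moduli (g : Metric E M) (f : M → ℝ) (p q : M) : Type _ := Quotient (shiftSetoid g f p q)

/-- The set of points on a flow line. -/
def Moduli.points {g : Metric E M} {f : M → ℝ} {p q : M} (α : Moduli g f p q) : Set M :=
  Quotient.lift (s := shiftSetoid g f p q) (fun γ => Set.range γ.toFun) (by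
    rintro γ δ ⟨s, h⟩
    ext x
    constructor
    · rintro ⟨t, rfl⟩
      exact ⟨t + s, (h t).symm⟩
    · rintro ⟨t, rfl⟩
      exact ⟨t - s, by simp [h]⟩) α

/-- `p ≻ q`: the points are distinct and there is a flow line from `p` to `q`. -/
def Above (g : Metric E M) (f : M → ℝ) (p q : M) : Prop := p ≠ q ∧ Nonempty (FlowLine g f p q)

/-- A critical sequence `r₀ ≻ r₁ ≻ ⋯ ≻ r_{k+1}` with head `r₀ = p` and tail `r_{k+1} = q`, where
`k` is the length. -/
structure CriticalSequence (g : Metric E M) (f : M → ℝ) (p q : M) where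
  length : ℕ
  point : Fin (length + 2) → M
  isCritical : ∀ i, IsCritical E f (point i)
  above : ∀ i : Fin (length + 1), Above g f (point i.castSucc) (point i.succ)
  head : point 0 = p
  tail : point (Fin.last _) = q

/-- The compactified moduli space `𝓜(p, q)⁻`: the disjoint union, over all critical sequences
`(r₀, …, r_{k+1})` from `p` to `q`, of the products `𝓜(r₀, r₁) × ⋯ × 𝓜(r_k, r_{k+1})`. -/
def CompactifiedModuli (g : Metric E M) (f : M → ℝ) (p q : M) : Type _ :=
  Σ I : CriticalSequence g f p q,
    ∀ i : Fin (I.length + 1), Moduli g f (I.point i.castSucc) (I.point i.succ)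

/-- The union of the components of an element of the compactified moduli space. -/
def CompactifiedModuli.points {g : Metric E M} {f : M → ℝ} {p q : M}
    (α : CompactifiedModuli g f p q) : Set M :=
  ⋃ i, (α.2 i).points

/-- `ev` is the evaluation map at the levels `a₀` and `a₁`: the union of the components of `α`
meets `f⁻¹(a₀)` in exactly one point and `f⁻¹(a₁)` in exactly one point, and `ev α` is the pair
of these two points. -/
def IsEvaluationMap (g : Metric E M) (f : M → ℝ) (p q : M) (a₀ a₁ : ℝ)
    (ev : CompactifiedModuli g f p q → (f ⁻¹' {a₀}) × (f ⁻¹' {a₁})) : Prop :=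
  ∀ α, α.points ∩ f ⁻¹' {a₀} = {((ev α).1 : M)} ∧ α.points ∩ f ⁻¹' {a₁} = {((ev α).2 : M)}

end Flow

end MorseFlow

/-! ## `C¹` embedded submanifolds with boundary -/

section Submanifold

variable {V : Type*} [NormedAddCommGroup V] [NormedSpace ℝ V]
  {F : Type*} [NormedAddCommGroup F] [NormedSpace ℝ F]
  {H : Type*} [TopologicalSpace H] (J : ModelWithCorners ℝ F H)
  {X : Type*} [TopologicalSpace X] [ChartedSpace H X]

/-- `φ` is a `C¹` immersion on `D` and a homeomorphism from `D` onto a relatively open subset of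
`S`. -/
def IsC1Patch (S : Set X) (D : Set V) (φ : V → X) : Prop :=
  ContMDiffOn 𝓘(ℝ, V) J 1 φ D ∧
  (∀ u ∈ D, Function.Injective (mfderivWithin 𝓘(ℝ, V) J φ D u)) ∧
  Topology.IsEmbedding (fun u : D => φ u) ∧
  ∃ U : Set X, IsOpen U ∧ φ '' D = S ∩ U

/-- Let `N` be an embedded smooth submanifold of the manifold `X` without boundary, with the
induced smooth structure, so that a map into `N` is a `C¹` immersion exactly when it is one as a
map into `X`. Then this says that `S` is a `C¹` embedded submanifold of `N` with boundary `B`: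
around each point of `S \ B` there is a `C¹` parametrization of `S` by an open subset of some
`ℝᵏ`, and around each point of `B` there is one by an open subset of a half space `[0, ∞) × ℝᵏ`,
whose points on `{0} × ℝᵏ` are those that go to `B`. -/
def IsC1SubmanifoldWithBoundary (N S B : Set X) : Prop :=
  S ⊆ N ∧ B ⊆ S ∧
  (∀ x ∈ S \ B, ∃ (k : ℕ) (D : Set (Fin k → ℝ)) (φ : (Fin k → ℝ) → X),
    IsOpen D ∧ IsC1Patch J S D φ ∧ x ∈ φ '' D ∧ φ '' D ⊆ S \ B) ∧
  (∀ x ∈ B, ∃ (k : ℕ) (W : Set (ℝ × (Fin k → ℝ))) (φ : ℝ × (Fin k → ℝ) → X),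
    IsOpen W ∧ IsC1Patch J S (W ∩ {u | 0 ≤ u.1}) φ ∧ x ∈ φ '' (W ∩ {u | 0 ≤ u.1}) ∧
    ∀ u ∈ W ∩ {u | 0 ≤ u.1}, φ u ∈ B ↔ u.1 = 0)

end Submanifold

end

/-!
# An evaluation map whose image is not a submanifold with boundary

The Morse function is `f [z] = (|z₀|² - |z₂|²) / |z|²`. Its critical points are the three coordinate
points `vertex 0`, `vertex 1`, `vertex 2`, with values `1`, `0`, `-1` and indices `4`, `2`, `0`. For
the Fubini-Study metric its gradient is the linear field `diag (1, 0, -1)`. The metric used here is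
the Fubini-Study metric stretched in the direction of the field that translates the affine
coordinate `z₂ / z₁` in the real direction. In the chart `w = (z₀ / z₁, z₂ / z₁)` at the saddle
point the negative gradient flow becomes
`w₀' = -w₀`, `(Im w₁)' = Im w₁`, `(Re w₁)' = (1 - rate w) Re w₁`,
where `0 < rate w ≤ 1 / 2` (`fubiniStudy_rate`, `exists_eq_flowCoord`). Hence the flow preserves the
coordinate lines, and through every point there is a flow line with the limits that the linear flow
would give it (`exists_flowLine`). Transversality and the list of critical sequences follow.

Let `P` be the image of a once broken flow line whose two halves lie on `w₁ = 0` and on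
`w₀ = 0`, `Re w₁ = 0`. Near `P` an unbroken flow line spends a long time `T` between the levels `a₀`
and `a₁`. Let `x` be its value of `Re w₁` at the exit level `a₁`, and `Y` that at the entry
level `a₀`.

* Since `rate ≤ 1 / 2`, we have `|Y| ≤ exp (-T / 2) |x|`, while `Y = 0` for broken flow lines. So
  `Y` vanishes to higher than first order at `P` on the image of the evaluation map
  (`evalImage_tangent`).
* Since `rate ≥ κ > 0` between the two levels, `|Y| ≥ exp (-(1 - κ) T) |x|`. All other coordinates
  of the unbroken flow line differ by `O (exp (-T) + |Y|)` from those of a broken flow line with the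
  same `x`. If `T` is large compared to `x`, then the difference of the two image points is
  therefore at most a constant times its `Y`-component (`evalImage_transverse`).

A `C¹` immersion of a convex domain with interior, open or in a half space, is strictly
differentiable at every point. By the first item the `Y`-component of its derivative at `P` would
vanish, and by the second it would not (`IsHorn.not_isC1SubmanifoldWithBoundary`). The choice of the
boundary plays no role.
-/

namespace CP2

open Filter

noncomputable section

/-! ### The metric and the vector field in homogeneous coordinates -/

/-- The real scalar product `Re ∑ aⱼ b̄ⱼ` on `ℂ³`. -/
def reInner : (Fin 3 → ℂ) →L[ℝ] (Fin 3 → ℂ) →L[ℝ] ℝ :=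
  ∑ j : Fin 3,
    ((Complex.reCLM.comp (ContinuousLinearMap.proj j)).smulRight
        (Complex.reCLM.comp (ContinuousLinearMap.proj j : (Fin 3 → ℂ) →L[ℝ] ℂ)) +
      (Complex.imCLM.comp (ContinuousLinearMap.proj j)).smulRight
        (Complex.imCLM.comp (ContinuousLinearMap.proj j : (Fin 3 → ℂ) →L[ℝ] ℂ)))

theorem reInner_apply (a b : Fin 3 → ℂ) :
    reInner a b = ∑ j, ((a j).re * (b j).re + (a j).im * (b j).im) := by
  simp [reInner]

theorem reInner_comm (a b : Fin 3 → ℂ) : reInner a b = reInner b a := by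
  simp only [reInner_apply, mul_comm]

theorem reInner_I_smul_self (a : Fin 3 → ℂ) : reInner a (Complex.I • a) = 0 := by
  simp only [reInner_apply, Fin.sum_univ_three, Pi.smul_apply, smul_eq_mul, Complex.mul_re,
    Complex.mul_im, Complex.I_re, Complex.I_im]
  ring

theorem reInner_self (a : Fin 3 → ℂ) :
    reInner a a = Complex.normSq (a 0) + Complex.normSq (a 1) + Complex.normSq (a 2) := by
  simp [reInner_apply, Fin.sum_univ_three, Complex.normSq_apply]

theorem reInner_self_pos {a : Fin 3 → ℂ} (h : a ≠ 0) : 0 < reInner a a := by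
  obtain ⟨j, hj⟩ := Function.ne_iff.1 h
  rw [reInner_self]
  have h0 := Complex.normSq_pos.2 hj
  have h1 := Complex.normSq_nonneg (a 0)
  have h2 := Complex.normSq_nonneg (a 1)
  have h3 := Complex.normSq_nonneg (a 2)
  fin_cases j
  · linarith [show 0 < Complex.normSq (a 0) from h0]
  · linarith [show 0 < Complex.normSq (a 1) from h0]
  · linarith [show 0 < Complex.normSq (a 2) from h0]

/-- The square `a b ↦ η a * η b` of a linear form. -/
def tensorSq (η : (Fin 3 → ℂ) →L[ℝ] ℝ) : (Fin 3 → ℂ) →L[ℝ] (Fin 3 → ℂ) →L[ℝ] ℝ := η.smulRight η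

@[simp] theorem tensorSq_apply (η : (Fin 3 → ℂ) →L[ℝ] ℝ) (a b : Fin 3 → ℂ) :
    tensorSq η a b = η a * η b := by
  simp [tensorSq]

/-- The Fubini-Study metric, pulled back to `ℂ³ \ {0}`. -/
def fubiniStudy (z : Fin 3 → ℂ) : (Fin 3 → ℂ) →L[ℝ] (Fin 3 → ℂ) →L[ℝ] ℝ :=
  (2 / reInner z z) • reInner -
    (2 / reInner z z ^ 2) • (tensorSq (reInner z) + tensorSq (reInner (Complex.I • z)))

theorem fubiniStudy_apply (z a b : Fin 3 → ℂ) :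
    fubiniStudy z a b = 2 / reInner z z * reInner a b - 2 / reInner z z ^ 2 *
      (reInner z a * reInner z b + reInner (Complex.I • z) a * reInner (Complex.I • z) b) := by
  simp [fubiniStudy]
  ring

theorem fubiniStudy_comm (z a b : Fin 3 → ℂ) : fubiniStudy z a b = fubiniStudy z b a := by
  simp only [fubiniStudy_apply, reInner_comm a b]
  ring

/-- Lagrange's identity for the Fubini-Study metric. -/
theorem fubiniStudy_self (z a : Fin 3 → ℂ) (hz : z ≠ 0) :
    fubiniStudy z a a = 2 / reInner z z ^ 2 * (Complex.normSq (a 0 * z 1 - a 1 * z 0) +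
      Complex.normSq (a 0 * z 2 - a 2 * z 0) + Complex.normSq (a 1 * z 2 - a 2 * z 1)) := by
  have h := (reInner_self_pos hz).ne'
  have key : reInner z z * reInner a a -
      (reInner z a * reInner z a + reInner (Complex.I • z) a * reInner (Complex.I • z) a) =
      (Complex.normSq (a 0 * z 1 - a 1 * z 0) +
      Complex.normSq (a 0 * z 2 - a 2 * z 0) + Complex.normSq (a 1 * z 2 - a 2 * z 1)) := by
    simp only [reInner_apply, Fin.sum_univ_three, Pi.smul_apply, smul_eq_mul, Complex.mul_re,
      Complex.mul_im, Complex.I_re, Complex.I_im, Complex.normSq_apply, Complex.sub_re,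
      Complex.sub_im]
    ring
  rw [← key, fubiniStudy_apply]
  field_simp

theorem smul_eq_re_add_im (c : ℂ) (a : Fin 3 → ℂ) :
    c • a = c.re • a + c.im • (Complex.I • a) := by
  ext j
  simp only [Pi.smul_apply, Pi.add_apply, smul_eq_mul, Complex.real_smul]
  nth_rewrite 1 [← Complex.re_add_im c]
  ring

theorem fubiniStudy_smul_right (z a : Fin 3 → ℂ) (hz : z ≠ 0) (s : ℂ) :
    fubiniStudy z a (s • z) = 0 := by
  have h := (reInner_self_pos hz).ne'
  have h1 : fubiniStudy z a z = 0 := by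
    rw [fubiniStudy_apply, reInner_comm a z, reInner_comm (Complex.I • z) z, reInner_I_smul_self]
    field_simp
    ring
  have h2 : fubiniStudy z a (Complex.I • z) = 0 := by
    have e : reInner (Complex.I • z) (Complex.I • z) = reInner z z := by
      simp only [reInner_self, Pi.smul_apply, smul_eq_mul, Complex.normSq_mul, Complex.normSq_I,
        one_mul]
    rw [fubiniStudy_apply, reInner_comm a, reInner_I_smul_self, e]
    field_simp
    ring
  rw [smul_eq_re_add_im, map_add, map_smul, map_smul, h1, h2]
  simp

theorem reInner_smul_smul (c : ℂ) (a b : Fin 3 → ℂ) :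
    reInner (c • a) (c • b) = Complex.normSq c * reInner a b := by
  simp only [reInner_apply, Fin.sum_univ_three, Pi.smul_apply, smul_eq_mul, Complex.mul_re,
      Complex.mul_im, Complex.normSq_apply]
  ring

theorem fubiniStudy_smul_smul (z a b : Fin 3 → ℂ) (c : ℂ) (hc : c ≠ 0) :
    fubiniStudy (c • z) (c • a) (c • b) = fubiniStudy z a b := by
  have h := (Complex.normSq_pos.2 hc).ne'
  rw [fubiniStudy_apply, fubiniStudy_apply, smul_comm Complex.I c z]
  simp only [reInner_smul_smul]
  by_cases hz : reInner z z = 0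
  · simp [hz]
  field_simp

theorem fubiniStudy_invariant (z a b : Fin 3 → ℂ) (hz : z ≠ 0) (c s t : ℂ) (hc : c ≠ 0) :
    fubiniStudy (c • z) (c • a + s • z) (c • b + t • z) = fubiniStudy z a b := by
  have e : ∀ t : ℂ, t • z = (t / c) • (c • z) := fun t => by
    rw [smul_smul, div_mul_cancel₀ _ hc]
  have hcz : c • z ≠ 0 := smul_ne_zero hc hz
  rw [e s, e t, map_add, fubiniStudy_smul_right _ _ hcz, add_zero, fubiniStudy_comm, map_add,
    fubiniStudy_smul_right _ _ hcz, add_zero, fubiniStudy_comm, fubiniStudy_smul_smul _ _ _ _ hc]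

/-- The nilpotent matrix whose linear flow moves the affine coordinate `z₂ / z₁` by
translations. -/
def shear (z : Fin 3 → ℂ) : Fin 3 → ℂ := ![0, 0, z 1]

/-- The matrix `diag (1, 0, -1)`, whose Hermitian form gives the Morse function. -/
def weight (z : Fin 3 → ℂ) : Fin 3 → ℂ := ![z 0, 0, -z 2]

theorem shear_smul (c : ℂ) (z : Fin 3 → ℂ) : shear (c • z) = c • shear z := by
  ext j
  fin_cases j <;> simp [shear]

theorem weight_smul (c : ℂ) (z : Fin 3 → ℂ) : weight (c • z) = c • weight z := by
  ext j
  fin_cases j <;> simp [weight]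

/-- The linear form dual to the shear field with respect to the Fubini-Study metric. -/
def shearForm (z : Fin 3 → ℂ) : (Fin 3 → ℂ) →L[ℝ] ℝ := fubiniStudy z (shear z)

theorem shearForm_shear (z : Fin 3 → ℂ) (hz : z ≠ 0) :
    shearForm z (shear z) = 2 * Complex.normSq (z 1) *
      (Complex.normSq (z 0) + Complex.normSq (z 1)) / reInner z z ^ 2 := by
  rw [shearForm, fubiniStudy_self _ _ hz]
  simp [shear]
  ring

theorem shearForm_shear_le (z : Fin 3 → ℂ) (hz : z ≠ 0) : shearForm z (shear z) ≤ 2 := by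
  rw [shearForm_shear z hz, div_le_iff₀ (pow_pos (reInner_self_pos hz) 2), reInner_self]
  have h0 := Complex.normSq_nonneg (z 0)
  have h1 := Complex.normSq_nonneg (z 1)
  have h2 := Complex.normSq_nonneg (z 2)
  nlinarith [mul_nonneg h0 h1, mul_nonneg h0 h2, mul_nonneg h1 h2, mul_nonneg h0 h0,
    mul_nonneg h2 h2]

/-- The Riemannian metric, pulled back to `ℂ³ \ {0}`: the Fubini-Study metric is stretched in the
direction of the shear field. Since `shearForm z (shear z) ≤ 2`, the constant `4` keeps the added
term nonnegative; with this coefficient the negative gradient of `height` is `field`. -/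
def stretched (z : Fin 3 → ℂ) : (Fin 3 → ℂ) →L[ℝ] (Fin 3 → ℂ) →L[ℝ] ℝ :=
  fubiniStudy z + (4 - shearForm z (shear z))⁻¹ • tensorSq (shearForm z)

theorem stretched_apply (z a b : Fin 3 → ℂ) :
    stretched z a b = fubiniStudy z a b +
      (4 - shearForm z (shear z))⁻¹ * (shearForm z a * shearForm z b) := by
  simp [stretched]

theorem stretched_comm (z a b : Fin 3 → ℂ) : stretched z a b = stretched z b a := by
  rw [stretched_apply, stretched_apply, fubiniStudy_comm]
  ring

theorem shearForm_invariant (z a : Fin 3 → ℂ) (hz : z ≠ 0) (c s : ℂ) (hc : c ≠ 0) :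
    shearForm (c • z) (c • a + s • z) = shearForm z a := by
  have := fubiniStudy_invariant z (shear z) a hz c 0 s hc
  rwa [zero_smul, add_zero, ← shear_smul] at this

theorem stretched_invariant (z a b : Fin 3 → ℂ) (hz : z ≠ 0) (c s t : ℂ) (hc : c ≠ 0) :
    stretched (c • z) (c • a + s • z) (c • b + t • z) = stretched z a b := by
  have h := shearForm_invariant z (shear z) hz c 0 hc
  rw [zero_smul, add_zero, ← shear_smul] at h
  rw [stretched_apply, stretched_apply, fubiniStudy_invariant _ _ _ hz _ _ _ hc, h,
    shearForm_invariant _ _ hz _ _ hc, shearForm_invariant _ _ hz _ _ hc]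

theorem fubiniStudy_le_stretched (z a : Fin 3 → ℂ) (hz : z ≠ 0) :
    fubiniStudy z a a ≤ stretched z a a := by
  rw [stretched_apply]
  have : 0 < 4 - shearForm z (shear z) := by linarith [shearForm_shear_le z hz]
  have := mul_nonneg (inv_pos.2 this).le (mul_self_nonneg (shearForm z a))
  linarith

theorem ContDiffAt.smul_real {E F : Type*} [NormedAddCommGroup E] [NormedSpace ℝ E]
    [NormedAddCommGroup F] [NormedSpace ℝ F] {f : E → ℝ} {g : E → F} {x : E}
    (hf : ContDiffAt ℝ ∞ f x) (hg : ContDiffAt ℝ ∞ g x) :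
    ContDiffAt ℝ ∞ (fun y => f y • g y) x :=
  hf.smul hg

theorem contDiffAt_fubiniStudy {z : Fin 3 → ℂ} (hz : z ≠ 0) : ContDiffAt ℝ ∞ fubiniStudy z := by
  have h := (reInner_self_pos hz).ne'
  have hN : ContDiff ℝ ∞ (fun z : Fin 3 → ℂ => reInner z z) :=
    reInner.contDiff.clm_apply contDiff_id
  have h1 : ContDiff ℝ ∞ (fun z : Fin 3 → ℂ => reInner (Complex.I • z)) :=
    reInner.contDiff.comp (contDiff_const_smul _)
  unfold fubiniStudy tensorSq
  refine ContDiffAt.sub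
    (ContDiffAt.smul_real (contDiffAt_const.div hN.contDiffAt h) contDiffAt_const)
    (ContDiffAt.smul_real (contDiffAt_const.div (hN.contDiffAt.pow 2) (pow_ne_zero 2 h)) ?_)
  exact ((reInner.contDiff.smulRight reInner.contDiff).add (h1.smulRight h1)).contDiffAt

theorem contDiff_shear : ContDiff ℝ ∞ shear := by
  refine contDiff_pi.2 fun j => ?_
  fin_cases j
  · exact contDiff_const
  · exact contDiff_const
  · exact contDiff_apply ℝ ℂ (1 : Fin 3)

theorem contDiff_weight : ContDiff ℝ ∞ weight := by
  refine contDiff_pi.2 fun j => ?_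
  fin_cases j
  · exact contDiff_apply ℝ ℂ (0 : Fin 3)
  · exact contDiff_const
  · exact (contDiff_apply ℝ ℂ (2 : Fin 3)).neg

theorem contDiffAt_stretched {z : Fin 3 → ℂ} (hz : z ≠ 0) : ContDiffAt ℝ ∞ stretched z := by
  have h1 : ContDiffAt ℝ ∞ shearForm z :=
    (contDiffAt_fubiniStudy hz).clm_apply contDiff_shear.contDiffAt
  have h2 : ContDiffAt ℝ ∞ (fun z => shearForm z (shear z)) z :=
    h1.clm_apply contDiff_shear.contDiffAt
  unfold stretched tensorSq
  refine (contDiffAt_fubiniStudy hz).add (ContDiffAt.smul_real ?_ (h1.smulRight h1))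
  refine (contDiffAt_const.sub h2).inv ?_
  linarith [shearForm_shear_le z hz]

/-- The Morse function in homogeneous coordinates. -/
def height (z : Fin 3 → ℂ) : ℝ := reInner (weight z) z / reInner z z

theorem height_eq (z : Fin 3 → ℂ) : height z = (Complex.normSq (z 0) - Complex.normSq (z 2)) /
    (Complex.normSq (z 0) + Complex.normSq (z 1) + Complex.normSq (z 2)) := by
  rw [height, reInner_self, reInner_apply, Fin.sum_univ_three]
  simp [weight, Complex.normSq_apply]
  ring

theorem contDiffAt_height {z : Fin 3 → ℂ} (hz : z ≠ 0) : ContDiffAt ℝ ∞ height z := by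
  have h := (reInner_self_pos hz).ne'
  exact ((reInner.contDiff.comp contDiff_weight).clm_apply contDiff_id).contDiffAt.div
    (reInner.contDiff.clm_apply contDiff_id).contDiffAt h

/-- `weight` as a continuous linear map. -/
def weightL : (Fin 3 → ℂ) →L[ℝ] (Fin 3 → ℂ) :=
  LinearMap.toContinuousLinearMap
    { toFun := weight
      map_add' := fun a b => by
        ext j
        fin_cases j <;> simp [weight]
        ring
      map_smul' := fun c a => by
        ext j
        fin_cases j <;> simp [weight] }

/-- The Fubini-Study gradient of the Morse function is the linear vector field `weight`. -/
theorem hasFDerivAt_height {z : Fin 3 → ℂ} (hz : z ≠ 0) :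
    HasFDerivAt height (fubiniStudy z (weight z)) z := by
  have h := (reInner_self_pos hz).ne'
  have h1 : HasFDerivAt (fun z => reInner (weight z) z) _ z :=
    (reInner.hasFDerivAt.comp z weightL.hasFDerivAt).clm_apply (hasFDerivAt_id z)
  have h2 : HasFDerivAt (fun z : Fin 3 → ℂ => reInner z z) _ z :=
    reInner.hasFDerivAt.clm_apply (hasFDerivAt_id z)
  have e1 : ∀ b, reInner (weight b) z = reInner (weight z) b := fun b => by
    simp [reInner_apply, Fin.sum_univ_three, weight]
    ring
  have e2 : reInner (Complex.I • z) (weight z) = 0 := by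
    simp [reInner_apply, Fin.sum_univ_three, weight]
    ring
  have h3 := h1.mul (HasDerivAt.comp_hasFDerivAt (h₂ := fun y : ℝ => y⁻¹)
    (f := fun z : Fin 3 → ℂ => reInner z z) z (hasDerivAt_inv h) h2)
  refine h3.congr_fderiv ?_
  ext1 b
  have e3 : reInner b z = reInner z b := reInner_comm _ _
  have e4 : ∀ b, weightL b = weight b := fun _ => rfl
  have e5 : reInner z (weight z) = reInner (weight z) z := reInner_comm _ _
  simp [fubiniStudy_apply, e1, e2, e3, e4, e5]
  field_simp
  ring

/-- The negative gradient of the Morse function with respect to the metric `stretched`, in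
homogeneous coordinates. -/
def field (z : Fin 3 → ℂ) : Fin 3 → ℂ :=
  (fubiniStudy z (weight z) (shear z) / 4) • shear z - weight z

theorem stretched_field (z a : Fin 3 → ℂ) (hz : z ≠ 0) :
    stretched z (field z) a = -fubiniStudy z (weight z) a := by
  have h : 4 - shearForm z (shear z) ≠ 0 := by linarith [shearForm_shear_le z hz]
  have e1 : fubiniStudy z (field z) a =
      fubiniStudy z (weight z) (shear z) / 4 * shearForm z a - fubiniStudy z (weight z) a := by
    simp [field, shearForm]
  have e2 : shearForm z (field z) = fubiniStudy z (weight z) (shear z) / 4 *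
      shearForm z (shear z) - fubiniStudy z (weight z) (shear z) := by
    rw [field, map_sub, map_smul, shearForm, fubiniStudy_comm z (shear z) (weight z), smul_eq_mul]
  rw [stretched_apply, e1, e2]
  field_simp
  ring

theorem fubiniStudy_weight_shear (z : Fin 3 → ℂ) :
    fubiniStudy z (weight z) (shear z) = -2 * ((z 2).re * (z 1).re + (z 2).im * (z 1).im) *
      (2 * Complex.normSq (z 0) + Complex.normSq (z 1)) / reInner z z ^ 2 := by
  by_cases hz : z = 0
  · simp [hz, fubiniStudy]
  have h := (reInner_self_pos hz).ne'
  rw [fubiniStudy_apply]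
  have e2 : reInner (Complex.I • z) (weight z) = 0 := by
    simp [reInner_apply, Fin.sum_univ_three, weight]
    ring
  rw [e2]
  have e : reInner (weight z) (shear z) * reInner z z - reInner z (weight z) * reInner z (shear z) =
      - ((z 2).re * (z 1).re + (z 2).im * (z 1).im) *
      (2 * Complex.normSq (z 0) + Complex.normSq (z 1)) := by
    simp [reInner_apply, Fin.sum_univ_three, weight, shear, Complex.normSq_apply]
    ring
  field_simp
  linarith

theorem field_smul (c : ℂ) (z : Fin 3 → ℂ) (hc : c ≠ 0) : field (c • z) = c • field z := by
  rw [field, field, weight_smul, shear_smul, fubiniStudy_smul_smul _ _ _ _ hc, smul_sub,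
    smul_comm c]

/-! ### Affine charts and homogeneous lifts of tangent vectors -/

/-- The index of the preferred affine chart at `x`. -/
def idx (x : CP2) : Fin 3 := (exists_mem_affineSet x).choose

theorem mem_affineSet_idx (x : CP2) : x ∈ affineSet (idx x) := (exists_mem_affineSet x).choose_spec

/-- The representative of `x` whose entry at `idx x` is `1`. -/
def rep (x : CP2) : {v : Fin 3 → ℂ // v ≠ 0} := homog (idx x) (affine (idx x) x)

theorem mk_rep (x : CP2) : mk (rep x) = x := mk_homog_affine _ x (mem_affineSet_idx x)

/-- The linear part of `homog i`: a zero is inserted at `i`. -/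
def lift (i : Fin 3) : (Fin 2 → ℂ) →L[ℝ] (Fin 3 → ℂ) :=
  LinearMap.toContinuousLinearMap
    { toFun := fun w => i.insertNth (α := fun _ => ℂ) 0 w
      map_add' := fun v w => by
        ext j
        refine Fin.succAboveCases i ?_ (fun k => ?_) j <;> simp
      map_smul' := fun c w => by
        ext j
        refine Fin.succAboveCases i ?_ (fun k => ?_) j <;> simp }

@[simp] theorem lift_apply_same (i : Fin 3) (w : Fin 2 → ℂ) : lift i w i = 0 := by
  simp [lift]

@[simp] theorem lift_apply_succAbove (i : Fin 3) (w : Fin 2 → ℂ) (j : Fin 2) :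
    lift i w (i.succAbove j) = w j := by
  simp [lift]

@[simp] theorem homog_apply_same (i : Fin 3) (w : Fin 2 → ℂ) : (homog i w).1 i = 1 := by
  simp [homog]

@[simp] theorem homog_apply_succAbove (i : Fin 3) (w : Fin 2 → ℂ) (j : Fin 2) :
    (homog i w).1 (i.succAbove j) = w j := by
  simp [homog]

theorem hasFDerivAt_homog (i : Fin 3) (w : Fin 2 → ℂ) :
    HasFDerivAt (fun w => (homog i w).1) (lift i) w := by
  have e : (fun w => (homog i w).1) = fun w => lift i w + Pi.single i 1 := by
    funext w j
    refine Fin.succAboveCases i ?_ (fun k => ?_) j <;> simp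
  rw [e]
  exact (lift i).hasFDerivAt.add_const _

theorem contDiff_homog (i : Fin 3) : ContDiff ℝ ∞ (fun w => (homog i w).1) := by
  have e : (fun w => (homog i w).1) = fun w => lift i w + Pi.single i 1 := by
    funext w j
    refine Fin.succAboveCases i ?_ (fun k => ?_) j <;> simp
  rw [e]
  exact (lift i).contDiff.add contDiff_const

/-- The quotient map `z ↦ (z j / z i)` in homogeneous coordinates. -/
def ratio (i : Fin 3) (z : Fin 3 → ℂ) : Fin 2 → ℂ := fun j => z (i.succAbove j) / z i

theorem affine_mk' (i : Fin 3) (v : {v : Fin 3 → ℂ // v ≠ 0}) : affine i (mk v) = ratio i v.1 := rfl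

/-- The derivative of `ratio`. -/
def dRatio (i : Fin 3) (z : Fin 3 → ℂ) : (Fin 3 → ℂ) →L[ℝ] (Fin 2 → ℂ) :=
  LinearMap.toContinuousLinearMap
    { toFun := fun a j => (a (i.succAbove j) * z i - z (i.succAbove j) * a i) / z i ^ 2
      map_add' := fun a b => by
        ext j
        simp only [Pi.add_apply]
        ring
      map_smul' := fun c a => by
        ext j
        simp only [Pi.smul_apply, Complex.real_smul, RingHom.id_apply]
        ring }

theorem dRatio_apply (i : Fin 3) (z a : Fin 3 → ℂ) (j : Fin 2) :
    dRatio i z a j = (a (i.succAbove j) * z i - z (i.succAbove j) * a i) / z i ^ 2 := rfl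

theorem hasFDerivAt_ratio {i : Fin 3} {z : Fin 3 → ℂ} (h : z i ≠ 0) :
    HasFDerivAt (ratio i) (dRatio i z) z := by
  refine hasFDerivAt_pi'.2 fun j => ?_
  have h1 : ∀ k, HasFDerivAt (fun z : Fin 3 → ℂ => z k)
      (ContinuousLinearMap.proj k : (Fin 3 → ℂ) →L[ℝ] ℂ) z := fun k =>
    (ContinuousLinearMap.proj k : (Fin 3 → ℂ) →L[ℝ] ℂ).hasFDerivAt
  have h2 : HasFDerivAt (fun z : Fin 3 → ℂ => (z i)⁻¹) _ z :=
    HasFDerivAt.comp (g := fun y : ℂ => y⁻¹) z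
      ((hasDerivAt_inv h).hasFDerivAt.restrictScalars ℝ) (h1 i)
  have h3 := (h1 (i.succAbove j)).mul h2
  refine h3.congr_fderiv ?_
  ext1 a
  simp [dRatio_apply]
  field_simp
  ring

theorem lift_dRatio {i : Fin 3} {z : Fin 3 → ℂ} (h : z i ≠ 0) (a : Fin 3 → ℂ) :
    lift i (dRatio i z a) = (z i)⁻¹ • a + (-(a i / z i ^ 2)) • z := by
  ext j
  refine Fin.succAboveCases i ?_ (fun k => ?_) j
  · simp
    field_simp
    ring
  · simp [dRatio_apply]
    field_simp
    ring

theorem dRatio_invariant {i : Fin 3} {z : Fin 3 → ℂ} {c s : ℂ} (hc : c ≠ 0) (a : Fin 3 → ℂ) :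
    dRatio i (c • z) (c • a + s • z) = dRatio i z a := by
  ext j
  simp only [dRatio_apply, Pi.add_apply, Pi.smul_apply, smul_eq_mul]
  by_cases h : z i = 0
  · simp [h]
  field_simp
  ring

theorem dRatio_homog_lift (i : Fin 3) (w v : Fin 2 → ℂ) :
    dRatio i (homog i w).1 (lift i v) = v := by
  ext j
  simp [dRatio_apply]

theorem extChartAt_apply (x y : CP2) :
    extChartAt 𝓘(ℝ, Fin 2 → ℂ) x y = affine (idx x) y := rfl

theorem extChartAt_symm_apply (x : CP2) (w : Fin 2 → ℂ) :
    (extChartAt 𝓘(ℝ, Fin 2 → ℂ) x).symm w = mk (homog (idx x) w) := rfl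

theorem continuousAt_affine {i : Fin 3} {x : CP2} (h : x ∈ affineSet i) :
    ContinuousAt (affine i) x :=
  (continuousOn_affine i).continuousAt ((isOpen_affineSet i).mem_nhds h)

theorem continuous_mk : Continuous mk := isQuotientMap_mk.continuous

section Descent

variable {F : Type*} [NormedAddCommGroup F] [NormedSpace ℝ F] {φ : CP2 → F} {ψ : (Fin 3 → ℂ) → F}

theorem eventuallyEq_homog_affine {F : Type*} {φ : CP2 → F} {ψ : (Fin 3 → ℂ) → F}
    (h : ∀ v, φ (mk v) = ψ v.1) {i : Fin 3} {x : CP2}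
    (hx : x ∈ affineSet i) : φ =ᶠ[𝓝 x] fun y => ψ (homog i (affine i y)).1 := by
  filter_upwards [(isOpen_affineSet i).mem_nhds hx] with y hy
  rw [← h, mk_homog_affine i y hy]

/-- The derivative of a function on the projective plane, computed in homogeneous coordinates. -/
theorem hasMFDerivAt_of_homogeneous (h : ∀ v, φ (mk v) = ψ v.1) {x : CP2}
    {ψ' : (Fin 3 → ℂ) →L[ℝ] F} (hψ : HasFDerivAt ψ ψ' (rep x).1) :
    HasMFDerivAt 𝓘(ℝ, Fin 2 → ℂ) 𝓘(ℝ, F) φ x (ψ'.comp (lift (idx x))) := by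
  have hd : HasFDerivAt (fun w => ψ (homog (idx x) w).1) (ψ'.comp (lift (idx x)))
      (affine (idx x) x) := HasFDerivAt.comp _ hψ (hasFDerivAt_homog (idx x) _)
  refine ⟨?_, ?_⟩
  · refine ContinuousAt.congr ?_ (eventuallyEq_homog_affine h (mem_affineSet_idx x)).symm
    exact hd.continuousAt.comp (f := affine (idx x)) (continuousAt_affine (mem_affineSet_idx x))
  · refine (hd.congr_of_eventuallyEq ?_).hasFDerivWithinAt
    exact Eventually.of_forall fun w => h _

theorem contMDiffOn_affine (i : Fin 3) {n : WithTop ℕ∞} (hn : n ≤ ∞) :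
    ContMDiffOn 𝓘(ℝ, Fin 2 → ℂ) 𝓘(ℝ, Fin 2 → ℂ) n (affine i) (affineSet i) :=
  (contMDiffOn_of_mem_maximalAtlas (I := 𝓘(ℝ, Fin 2 → ℂ)) (n := ∞) (e := affineChart i)
    (IsManifold.subset_maximalAtlas (Set.mem_range_self i))).of_le hn

theorem contMDiff_mk_homog (i : Fin 3) {n : WithTop ℕ∞} (hn : n ≤ ∞) :
    ContMDiff 𝓘(ℝ, Fin 2 → ℂ) 𝓘(ℝ, Fin 2 → ℂ) n (fun w => mk (homog i w)) :=
  contMDiffOn_univ.1 ((contMDiffOn_symm_of_mem_maximalAtlas (I := 𝓘(ℝ, Fin 2 → ℂ)) (n := ∞)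
    (e := affineChart i) (IsManifold.subset_maximalAtlas (Set.mem_range_self i))).of_le hn)

theorem contMDiff_of_homogeneous (h : ∀ v, φ (mk v) = ψ v.1)
    (hψ : ∀ z, z ≠ 0 → ContDiffAt ℝ ∞ ψ z) : ContMDiff 𝓘(ℝ, Fin 2 → ℂ) 𝓘(ℝ, F) ∞ φ := by
  intro x
  have hx := mem_affineSet_idx x
  refine ContMDiffAt.congr_of_eventuallyEq ?_ (eventuallyEq_homog_affine h hx)
  have h1 : ContDiffAt ℝ ∞ (fun w => ψ (homog (idx x) w).1) (affine (idx x) x) :=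
    ContDiffAt.comp (f := fun w => (homog (idx x) w).1) (g := ψ) _ (hψ _ (homog (idx x) _).2)
      (contDiff_homog _).contDiffAt
  exact h1.contMDiffAt.comp (f := affine (idx x)) x
    ((contMDiffOn_affine (idx x) le_rfl).contMDiffAt ((isOpen_affineSet _).mem_nhds hx))

end Descent

/-- The velocity of a curve given in homogeneous coordinates. -/
theorem hasMFDerivAt_mk {Z : ℝ → {v : Fin 3 → ℂ // v ≠ 0}} {a : Fin 3 → ℂ} {t : ℝ}
    (h : HasDerivAt (fun t => (Z t).1) a t) :
    HasMFDerivAt 𝓘(ℝ, ℝ) 𝓘(ℝ, Fin 2 → ℂ) (fun t => mk (Z t)) t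
      ((1 : ℝ →L[ℝ] ℝ).smulRight (dRatio (idx (mk (Z t))) (Z t).1 a)) := by
  have hi : (Z t).1 (idx (mk (Z t))) ≠ 0 := (mk_mem_affineSet _ _).1 (mem_affineSet_idx _)
  have hZ : ContinuousAt Z t := Topology.IsInducing.subtypeVal.continuousAt_iff.2 h.continuousAt
  refine ⟨continuous_mk.continuousAt.comp hZ, ?_⟩
  have hd := (hasFDerivAt_ratio hi).comp_hasDerivAt t h
  exact hd.hasFDerivAt.hasFDerivWithinAt

/-! ### The Riemannian metric on the projective plane -/

/-- The scalar product of tangent vectors, read in the preferred chart. -/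
def inner (x : CP2) : (Fin 2 → ℂ) →L[ℝ] (Fin 2 → ℂ) →L[ℝ] ℝ :=
  (stretched (rep x).1).bilinearComp (lift (idx x)) (lift (idx x))

theorem inner_apply (x : CP2) (v w : Fin 2 → ℂ) :
    inner x v w = stretched (rep x).1 (lift (idx x) v) (lift (idx x) w) := rfl

theorem rep_apply_idx (x : CP2) : (rep x).1 (idx x) = 1 := homog_apply_same _ _

theorem normSq_mul_le_fubiniStudy {i : Fin 3} {z : Fin 3 → ℂ} (hz : z i = 1) (v : Fin 2 → ℂ)
    (j : Fin 2) :
    2 / reInner z z ^ 2 * Complex.normSq (v j) ≤ fubiniStudy z (lift i v) (lift i v) := by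
  have h0 : z ≠ 0 := by
    rintro rfl
    simp at hz
  have hj : v j = lift i v (i.succAbove j) := by simp
  have hi : lift i v i = 0 := by simp
  rw [fubiniStudy_self _ _ h0, hj]
  generalize lift i v = a at *
  have := reInner_self_pos h0
  refine mul_le_mul_of_nonneg_left ?_ (by positivity)
  have h1 := Complex.normSq_nonneg (a 0 * z 1 - a 1 * z 0)
  have h2 := Complex.normSq_nonneg (a 0 * z 2 - a 2 * z 0)
  have h3 := Complex.normSq_nonneg (a 1 * z 2 - a 2 * z 1)
  have h4 := Complex.normSq_nonneg (a 0)
  have h5 := Complex.normSq_nonneg (a 1)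
  have h6 := Complex.normSq_nonneg (a 2)
  fin_cases i <;> fin_cases j <;> simp [Fin.succAbove] at * <;> rw [hz, hi] at * <;>
    simp at * <;> linarith

/-- The metric on each tangent space bounds the coordinate norm from above. -/
theorem norm_sq_le_inner (x : CP2) (v : Fin 2 → ℂ) :
    2 / reInner (rep x).1 (rep x).1 ^ 2 * ‖v‖ ^ 2 ≤ inner x v v := by
  obtain ⟨j, hj⟩ : ∃ j, ‖v‖ = ‖v j‖ := by
    obtain ⟨j, -, hj⟩ := Finset.exists_max_image Finset.univ (fun j => ‖v j‖) Finset.univ_nonempty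
    refine ⟨j, le_antisymm ?_ (norm_le_pi_norm v j)⟩
    exact (pi_norm_le_iff_of_nonneg (norm_nonneg _)).2 fun k => hj k (Finset.mem_univ _)
  rw [hj, ← Complex.normSq_eq_norm_sq]
  exact (normSq_mul_le_fubiniStudy (rep_apply_idx x) v j).trans
    (fubiniStudy_le_stretched _ _ (rep x).2)

theorem inner_pos (x : CP2) (v : Fin 2 → ℂ) (hv : v ≠ 0) : 0 < inner x v v := by
  refine lt_of_lt_of_le ?_ (norm_sq_le_inner x v)
  have := reInner_self_pos (rep x).2
  have := norm_pos_iff.2 hv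
  positivity

theorem isVonNBounded_inner (x : CP2) : Bornology.IsVonNBounded ℝ {v | inner x v v < 1} := by
  have hN := reInner_self_pos (rep x).2
  refine (NormedSpace.isVonNBounded_closedBall ℝ (Fin 2 → ℂ)
    (reInner (rep x).1 (rep x).1)).subset fun v hv => ?_
  rw [mem_closedBall_zero_iff]
  have h := (norm_sq_le_inner x v).trans (le_of_lt hv)
  rw [div_mul_eq_mul_div, div_le_one (by positivity)] at h
  refine abs_le_of_sq_le_sq' ?_ hN.le |>.2
  linarith [sq_nonneg ‖v‖]

theorem contDiff_coordinates_inner (i : Fin 3) : ContDiff ℝ ∞ (fun w =>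
    (stretched (homog i w).1).bilinearComp (lift i) (lift i)) := by
  have h : ContDiff ℝ ∞ (fun w => stretched (homog i w).1) :=
    contDiff_iff_contDiffAt.2 fun w => ContDiffAt.comp (f := fun w => (homog i w).1)
      (g := stretched) _ (contDiffAt_stretched (homog i w).2) (contDiff_homog i).contDiffAt
  have e : ∀ T : (Fin 3 → ℂ) →L[ℝ] (Fin 3 → ℂ) →L[ℝ] ℝ, T.bilinearComp (lift i) (lift i) =
      (((ContinuousLinearMap.compL ℝ (Fin 2 → ℂ) (Fin 3 → ℂ) ℝ).flip (lift i)).comp T).comp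
        (lift i) := fun T => rfl
  simp only [e]
  exact (contDiff_const.clm_comp h).clm_comp contDiff_const

theorem tangentCoordChange_eq {x y : CP2} (hy : y ∈ affineSet (idx x)) :
    tangentCoordChange 𝓘(ℝ, Fin 2 → ℂ) x y y =
      (dRatio (idx y) (homog (idx x) (affine (idx x) y)).1).comp (lift (idx x)) := by
  have h1 := hasFDerivWithinAt_tangentCoordChange (I := 𝓘(ℝ, Fin 2 → ℂ)) (x := x) (y := y) (z := y)
    ⟨by rw [extChartAt_source]; exact hy, mem_extChartAt_source y⟩
  rw [modelWithCornersSelf_coe, Set.range_id, hasFDerivWithinAt_univ] at h1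
  have hi : (homog (idx x) (affine (idx x) y)).1 (idx y) ≠ 0 := by
    rw [← mk_mem_affineSet, mk_homog_affine _ _ hy]
    exact mem_affineSet_idx y
  have h2 : HasFDerivAt (fun w => ratio (idx y) (homog (idx x) w).1) _ (affine (idx x) y) :=
    HasFDerivAt.comp (f := fun w => (homog (idx x) w).1) _ (hasFDerivAt_ratio hi)
      (hasFDerivAt_homog (idx x) _)
  exact h1.unique h2

theorem inner_tangentCoordChange {x y : CP2} (hy : y ∈ affineSet (idx x)) (v w : Fin 2 → ℂ) :
    inner y (tangentCoordChange 𝓘(ℝ, Fin 2 → ℂ) x y y v)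
      (tangentCoordChange 𝓘(ℝ, Fin 2 → ℂ) x y y w) =
    stretched (homog (idx x) (affine (idx x) y)).1 (lift (idx x) v) (lift (idx x) w) := by
  set z := homog (idx x) (affine (idx x) y) with hz
  have hzy : mk z = y := mk_homog_affine _ _ hy
  have hi : z.1 (idx y) ≠ 0 := by
    rw [← mk_mem_affineSet, hzy]
    exact mem_affineSet_idx y
  obtain ⟨c, hc⟩ := (mk_eq_mk_iff (rep y) z).1 ((mk_rep y).trans hzy.symm)
  have hc' : c = (z.1 (idx y))⁻¹ := by
    have := congrFun hc (idx y)
    rw [rep_apply_idx] at this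
    exact eq_inv_of_mul_eq_one_left this
  have hc0 : c ≠ 0 := hc' ▸ inv_ne_zero hi
  rw [tangentCoordChange_eq hy, ← hz, inner_apply]
  simp only [ContinuousLinearMap.comp_apply]
  rw [lift_dRatio hi, lift_dRatio hi, ← hc', ← hc, stretched_invariant _ _ _ z.2 _ _ _ hc0]

theorem symm_trivializationAt_eq {x y : CP2} (hy : y ∈ affineSet (idx x)) (v : Fin 2 → ℂ) :
    (trivializationAt (Fin 2 → ℂ) (TangentSpace 𝓘(ℝ, Fin 2 → ℂ)) x).symm y v =
      tangentCoordChange 𝓘(ℝ, Fin 2 → ℂ) x y y v := by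
  have hy' : y ∈ (trivializationAt (Fin 2 → ℂ) (TangentSpace 𝓘(ℝ, Fin 2 → ℂ)) x).baseSet := hy
  exact (Bundle.Trivialization.symmL_apply _ hy' v).symm.trans <|
    congrArg (fun T : (Fin 2 → ℂ) →L[ℝ] (Fin 2 → ℂ) => T v)
      (TangentBundle.symmL_trivializationAt_eq_core (I := 𝓘(ℝ, Fin 2 → ℂ)) hy)

/-- The metric in the coordinates of the tangent bundle given by the preferred chart at `x`. -/
theorem inCoordinates_eq_stretched {x y : CP2} (hy : y ∈ affineSet (idx x))
    (T : TangentSpace 𝓘(ℝ, Fin 2 → ℂ) y →L[ℝ] TangentSpace 𝓘(ℝ, Fin 2 → ℂ) y →L[ℝ] ℝ)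
    (hT : ∀ v w : Fin 2 → ℂ, T v w = inner y v w) (v w : Fin 2 → ℂ) :
    ContinuousLinearMap.inCoordinates (Fin 2 → ℂ) (TangentSpace 𝓘(ℝ, Fin 2 → ℂ))
      ((Fin 2 → ℂ) →L[ℝ] ℝ) (fun b => TangentSpace 𝓘(ℝ, Fin 2 → ℂ) b →L[ℝ] ℝ) x y x y T v w =
    stretched (homog (idx x) (affine (idx x) y)).1 (lift (idx x) v) (lift (idx x) w) := by
  have hy' : y ∈ (trivializationAt (Fin 2 → ℂ) (TangentSpace 𝓘(ℝ, Fin 2 → ℂ)) x).baseSet := hy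
  have h := inCoordinates_apply_eq₂ (F₁ := Fin 2 → ℂ) (F₂ := Fin 2 → ℂ) (F₃ := ℝ)
    (E₁ := TangentSpace 𝓘(ℝ, Fin 2 → ℂ)) (E₂ := TangentSpace 𝓘(ℝ, Fin 2 → ℂ))
    (E₃ := Bundle.Trivial CP2 ℝ) (ϕ := T) (v := v) (w := w) hy' hy' (Set.mem_univ y)
  refine h.trans ?_
  refine (congrArg (fun L : ℝ →ₗ[ℝ] ℝ => L _)
    (Bundle.Trivial.linearMapAt_trivialization ℝ CP2 ℝ y)).trans ?_
  rw [← inner_tangentCoordChange hy, ← symm_trivializationAt_eq hy, ← symm_trivializationAt_eq hy]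
  exact hT _ _

/-- The Riemannian metric. -/
def metric : MorseFlow.Metric (Fin 2 → ℂ) CP2 where
  inner := inner
  symm x v w := stretched_comm _ _ _
  pos x v hv := inner_pos x v hv
  isVonNBounded := isVonNBounded_inner
  contMDiff := by
    intro x
    rw [contMDiffAt_hom_bundle]
    refine ⟨contMDiffAt_id, ?_⟩
    have hx := mem_affineSet_idx x
    have h : ContMDiffAt 𝓘(ℝ, Fin 2 → ℂ) 𝓘(ℝ, (Fin 2 → ℂ) →L[ℝ] (Fin 2 → ℂ) →L[ℝ] ℝ) ∞
        (fun y => (stretched (homog (idx x) (affine (idx x) y)).1).bilinearComp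
          (lift (idx x)) (lift (idx x))) x :=
      (contDiff_coordinates_inner (idx x)).contDiffAt.contMDiffAt.comp (f := affine (idx x)) x
        ((contMDiffOn_affine (idx x) le_rfl).contMDiffAt ((isOpen_affineSet _).mem_nhds hx))
    refine h.congr_of_eventuallyEq ?_
    filter_upwards [(isOpen_affineSet (idx x)).mem_nhds hx] with y hy
    ext v w
    exact inCoordinates_eq_stretched hy (inner y) (fun _ _ => rfl) v w

/-! ### The Morse function and its gradient flow -/

/-- The Morse function `[z] ↦ (|z₀|² - |z₂|²) / |z|²`. -/
def morse (x : CP2) : ℝ := height (rep x).1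

theorem height_smul {c : ℂ} (hc : c ≠ 0) (z : Fin 3 → ℂ) : height (c • z) = height z := by
  have := (Complex.normSq_pos.2 hc).ne'
  rw [height, height, weight_smul, reInner_smul_smul, reInner_smul_smul, mul_div_mul_left _ _ this]

theorem exists_smul_eq_rep (v : {v : Fin 3 → ℂ // v ≠ 0}) :
    ∃ c : ℂ, c ≠ 0 ∧ (rep (mk v)).1 = c • v.1 := by
  obtain ⟨c, hc⟩ := (mk_eq_mk_iff (rep (mk v)) v).1 (mk_rep (mk v))
  refine ⟨c, ?_, hc.symm⟩
  rintro rfl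
  exact (rep (mk v)).2 (by rw [← hc, zero_smul])

theorem morse_mk (v : {v : Fin 3 → ℂ // v ≠ 0}) : morse (mk v) = height v.1 := by
  obtain ⟨c, hc, h⟩ := exists_smul_eq_rep v
  rw [morse, h, height_smul hc]

theorem contMDiff_morse : ContMDiff 𝓘(ℝ, Fin 2 → ℂ) 𝓘(ℝ, ℝ) ∞ morse :=
  contMDiff_of_homogeneous morse_mk fun _ => contDiffAt_height

theorem hasMFDerivAt_morse (x : CP2) : HasMFDerivAt 𝓘(ℝ, Fin 2 → ℂ) 𝓘(ℝ, ℝ) morse x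
    ((fubiniStudy (rep x).1 (weight (rep x).1)).comp (lift (idx x))) :=
  hasMFDerivAt_of_homogeneous morse_mk (hasFDerivAt_height (rep x).2)

/-- The vector field on the projective plane given by `field`. -/
def vectorField (x : CP2) : Fin 2 → ℂ := dRatio (idx x) (rep x).1 (field (rep x).1)

theorem dRatio_field {i : Fin 3} {c : ℂ} (hc : c ≠ 0) (z : Fin 3 → ℂ) :
    dRatio i (c • z) (field (c • z)) = dRatio i z (field z) := by
  have := dRatio_invariant (i := i) (z := z) (s := 0) hc (field z)
  rwa [zero_smul, add_zero, ← field_smul _ _ hc] at this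

theorem vectorField_mk (v : {v : Fin 3 → ℂ // v ≠ 0}) :
    vectorField (mk v) = dRatio (idx (mk v)) v.1 (field v.1) := by
  obtain ⟨c, hc, h⟩ := exists_smul_eq_rep v
  rw [vectorField, h, dRatio_field hc]

theorem lift_vectorField (x : CP2) : lift (idx x) (vectorField x) =
    field (rep x).1 + (-(field (rep x).1 (idx x))) • (rep x).1 := by
  have h1 : (rep x).1 (idx x) ≠ 0 := by simp [rep_apply_idx]
  rw [vectorField, lift_dRatio h1, rep_apply_idx]
  simp

theorem inner_vectorField (x : CP2) (w : Fin 2 → ℂ) :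
    inner x (vectorField x) w = -(fubiniStudy (rep x).1 (weight (rep x).1)) (lift (idx x) w) := by
  have h := stretched_invariant (rep x).1 (field (rep x).1) (lift (idx x) w) (rep x).2 1
    (-(field (rep x).1 (idx x))) 0 one_ne_zero
  rw [one_smul, one_smul, one_smul, zero_smul, add_zero] at h
  rw [inner_apply, lift_vectorField, h, stretched_field _ _ (rep x).2]

theorem gradient_eq (x : CP2) : MorseFlow.gradient metric morse x = -vectorField x := by
  have h : ∀ w : Fin 2 → ℂ,
      inner x (MorseFlow.gradient metric morse x) w = inner x (-vectorField x) w := fun w => by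
    rw [map_neg, neg_apply, inner_vectorField, neg_neg]
    refine (MorseFlow.inner_gradient metric morse x w).trans ?_
    rw [(hasMFDerivAt_morse x).mfderiv]
    rfl
  obtain ⟨G, hG⟩ : ∃ G : Fin 2 → ℂ, G = MorseFlow.gradient metric morse x := ⟨_, rfl⟩
  rw [← hG] at h ⊢
  by_contra hne
  have hpos := inner_pos x (G - -vectorField x) (sub_ne_zero.2 hne)
  rw [map_sub (inner x), sub_apply, h, sub_self] at hpos
  exact hpos.false

theorem isFlowLine_iff (γ : ℝ → CP2) : MorseFlow.IsFlowLine metric morse γ ↔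
    ∀ t, HasMFDerivAt 𝓘(ℝ, ℝ) 𝓘(ℝ, Fin 2 → ℂ) γ t
      ((1 : ℝ →L[ℝ] ℝ).smulRight (vectorField (γ t))) := by
  have : ∀ x, -MorseFlow.gradient metric morse x = vectorField x := fun x => by
    rw [gradient_eq]
    exact neg_neg (vectorField x)
  rw [MorseFlow.IsFlowLine, IsMIntegralCurve]
  simp only [this]

/-- Solutions of the homogeneous equation project to flow lines. -/
theorem isFlowLine_mk {Z : ℝ → {v : Fin 3 → ℂ // v ≠ 0}}
    (h : ∀ t, HasDerivAt (fun t => (Z t).1) (field (Z t).1) t) :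
    MorseFlow.IsFlowLine metric morse fun t => mk (Z t) := by
  rw [isFlowLine_iff]
  intro t
  rw [vectorField_mk]
  exact hasMFDerivAt_mk (h t)

section Homogeneous

variable {F : Type*} [NormedAddCommGroup F] [NormedSpace ℝ F] {φ : CP2 → F} {ψ : (Fin 3 → ℂ) → F}

/-- The derivative of a function along a flow line, computed in homogeneous coordinates. -/
theorem hasDerivAt_comp_flowLine {γ : ℝ → CP2} (hγ : MorseFlow.IsFlowLine metric morse γ)
    (h : ∀ v, φ (mk v) = ψ v.1) {ψ' : (Fin 3 → ℂ) →L[ℝ] F} {t : ℝ}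
    (hψ : HasFDerivAt ψ ψ' (rep (γ t)).1) :
    HasDerivAt (fun t => φ (γ t)) (ψ' (field (rep (γ t)).1)) t := by
  have h1 := (hasMFDerivAt_of_homogeneous h hψ).comp t ((isFlowLine_iff γ).1 hγ t)
  have h2 : HasFDerivAt (fun t => φ (γ t)) ((ψ'.comp (lift (idx (γ t)))).comp
      ((1 : ℝ →L[ℝ] ℝ).smulRight (vectorField (γ t)))) t := hasMFDerivAt_iff_hasFDerivAt.1 h1
  -- `ψ` is constant on complex lines, so its derivative kills the multiples of the base point.
  have h0 : ψ' ((-(field (rep (γ t)).1 (idx (γ t)))) • (rep (γ t)).1) = 0 := by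
    generalize -(field (rep (γ t)).1 (idx (γ t))) = s
    have e1 : HasDerivAt (fun τ : ℝ => ((1 : ℂ) + (τ : ℂ) * s) • (rep (γ t)).1)
        (s • (rep (γ t)).1) 0 := by
      have := ((Complex.ofRealCLM.hasDerivAt (x := 0)).mul_const s).const_add 1
      simpa using this.smul_const (rep (γ t)).1
    have e2 : HasFDerivAt ψ ψ' (((1 : ℂ) + ((0 : ℝ) : ℂ) * s) • (rep (γ t)).1) := by
      simpa using hψ
    have e3 := e2.comp_hasDerivAt 0 e1
    refine e3.unique ((hasDerivAt_const (0 : ℝ) (ψ (rep (γ t)).1)).congr_of_eventuallyEq ?_)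
    have e4 : ∀ᶠ τ : ℝ in 𝓝 0, (1 : ℂ) + (τ : ℂ) * s ≠ 0 := by
      have : ContinuousAt (fun τ : ℝ => (1 : ℂ) + (τ : ℂ) * s) 0 := by fun_prop
      exact this.eventually_ne (by simp)
    filter_upwards [e4] with τ hτ
    have h3 := h ⟨_, smul_ne_zero hτ (rep (γ t)).2⟩
    rw [Function.comp_apply, ← h3, ← h]
    exact congrArg φ ((mk_eq_mk_iff _ _).2 ⟨_, rfl⟩)
  have h3 : HasDerivAt (fun t => φ (γ t)) (ψ' (lift (idx (γ t)) ((1 : ℝ) • vectorField (γ t)))) t :=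
    h2.hasDerivAt
  rwa [one_smul, lift_vectorField, map_add, h0, add_zero] at h3

end Homogeneous

/-! ### Critical points and monotonicity along flow lines -/

/-- The vertex `[eᵢ]` of the coordinate triangle. -/
def vertex (i : Fin 3) : CP2 := mk ⟨Pi.single i 1, by simp⟩

theorem eq_vertex {v : {v : Fin 3 → ℂ // v ≠ 0}} {i : Fin 3} (h : ∀ j, j ≠ i → v.1 j = 0) :
    mk v = vertex i := by
  refine (mk_eq_mk_iff _ _).2 ⟨v.1 i, ?_⟩
  ext j
  by_cases hj : j = i
  · simp [hj]
  · simp [hj, h j hj]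

theorem morse_vertex (i : Fin 3) : morse (vertex i) = ![1, 0, -1] i := by
  rw [vertex, morse_mk, height_eq]
  fin_cases i <;> simp

theorem morse_vertex_injective : Function.Injective fun i => morse (vertex i) := by
  intro i j h
  simp only [morse_vertex] at h
  fin_cases i <;> fin_cases j <;> simp at h <;> first | rfl | (exfalso; linarith)

theorem vertex_injective : Function.Injective vertex := fun _ _ h =>
  morse_vertex_injective (congrArg morse h)

theorem fubiniStudy_weight_self (z : Fin 3 → ℂ) (hz : z ≠ 0) :
    fubiniStudy z (weight z) (weight z) = 2 / reInner z z ^ 2 * (Complex.normSq (z 0 * z 1) +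
      4 * Complex.normSq (z 0 * z 2) + Complex.normSq (z 1 * z 2)) := by
  rw [fubiniStudy_self z _ hz]
  have e : z 0 * z 2 + z 2 * z 0 = 2 * (z 0 * z 2) := by ring
  simp [weight, e, Complex.normSq_ofNat]
  ring_nf
  simp

theorem isCritical_iff (x : CP2) :
    MorseFlow.IsCritical (Fin 2 → ℂ) morse x ↔ ∃ i, x = vertex i := by
  rw [MorseFlow.IsCritical, (hasMFDerivAt_morse x).mfderiv]
  constructor
  · intro h
    have hz := (rep x).2
    have h1 : (rep x).1 (idx x) ≠ 0 := by simp [rep_apply_idx]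
    have h2 := lift_dRatio h1 (weight (rep x).1)
    rw [rep_apply_idx, inv_one, one_smul] at h2
    have h3 : fubiniStudy (rep x).1 (weight (rep x).1)
        (lift (idx x) (dRatio (idx x) (rep x).1 (weight (rep x).1))) = 0 :=
      congrArg (fun T : (Fin 2 → ℂ) →L[ℝ] ℝ => T (dRatio (idx x) (rep x).1 (weight (rep x).1))) h
    rw [h2, map_add, fubiniStudy_smul_right _ _ hz, add_zero, fubiniStudy_weight_self _ hz] at h3
    have hN := reInner_self_pos hz
    have n1 := Complex.normSq_nonneg ((rep x).1 0 * (rep x).1 1)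
    have n2 := Complex.normSq_nonneg ((rep x).1 0 * (rep x).1 2)
    have n3 := Complex.normSq_nonneg ((rep x).1 1 * (rep x).1 2)
    have h4 := (mul_eq_zero.1 h3).resolve_left (by positivity)
    have m1 := Complex.normSq_eq_zero.1 (le_antisymm (by linarith) n1)
    have m2 := Complex.normSq_eq_zero.1 (le_antisymm (by linarith) n2)
    have m3 := Complex.normSq_eq_zero.1 (le_antisymm (by linarith) n3)
    obtain ⟨i, hi⟩ := Function.ne_iff.1 hz
    refine ⟨i, ?_⟩
    rw [← mk_rep x]
    refine eq_vertex fun j hj => ?_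
    have hi' : (rep x).1 i ≠ 0 := hi
    fin_cases i <;> fin_cases j <;> simp_all
  · rintro ⟨i, rfl⟩
    obtain ⟨c, hc, h⟩ := exists_smul_eq_rep ⟨Pi.single i 1, by simp⟩
    have hw : ∃ s : ℂ, weight (rep (vertex i)).1 = s • (rep (vertex i)).1 := by
      refine ⟨![1, 0, -1] i, ?_⟩
      rw [vertex, h]
      ext j
      fin_cases i <;> fin_cases j <;> simp [weight]
    obtain ⟨s, hs⟩ := hw
    have : fubiniStudy (rep (vertex i)).1 (weight (rep (vertex i)).1) = 0 := by
      ext1 a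
      rw [hs, fubiniStudy_comm, fubiniStudy_smul_right _ _ (rep _).2]
      rfl
    rw [this]
    rfl

/-- Grönwall's inequality, in both time directions: a nonnegative solution of `|h'| ≤ C h` that
vanishes at one time vanishes at all times. -/
theorem eq_zero_of_abs_deriv_le {h : ℝ → ℝ} {C : ℝ} (h0 : ∀ t, 0 ≤ h t)
    (hd : ∀ t, ∃ d, HasDerivAt h d t ∧ |d| ≤ C * h t) {t₀ : ℝ} (ht : h t₀ = 0) (t : ℝ) :
    h t = 0 := by
  choose d hd hdC using hd
  have hexp : ∀ c t : ℝ, HasDerivAt (fun t => h t * Real.exp (c * t))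
      (d t * Real.exp (c * t) + h t * (Real.exp (c * t) * c)) t := fun c t => by
    have := ((hasDerivAt_id t).const_mul c).exp
    simp only [id, mul_one] at this
    exact (hd t).mul this
  refine le_antisymm ?_ (h0 t)
  rcases le_total t₀ t with hle | hle
  · have hanti : Antitone fun t => h t * Real.exp (-C * t) := by
      refine antitone_of_hasDerivAt_nonpos (hexp (-C)) fun t => ?_
      have := (abs_le.1 (hdC t)).2
      have e := Real.exp_pos (-C * t)
      simp only [Pi.zero_apply]
      nlinarith
    have := hanti hle
    simp only [ht, zero_mul] at this
    exact nonpos_of_mul_nonpos_left this (Real.exp_pos _)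
  · have hmono : Monotone fun t => h t * Real.exp (C * t) := by
      refine monotone_of_hasDerivAt_nonneg (hexp C) fun t => ?_
      have := (abs_le.1 (hdC t)).1
      have e := Real.exp_pos (C * t)
      simp only [Pi.zero_apply]
      nlinarith
    have := hmono hle
    simp only [ht, zero_mul] at this
    exact nonpos_of_mul_nonpos_left this (Real.exp_pos _)

/-- The normalized coordinate `|zᵢ|² / |z|²`. -/
def mass (i : Fin 3) (x : CP2) : ℝ :=
  Complex.normSq ((rep x).1 i) / reInner (rep x).1 (rep x).1

theorem mass_mk (i : Fin 3) (v : {v : Fin 3 → ℂ // v ≠ 0}) :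
    mass i (mk v) = Complex.normSq (v.1 i) / reInner v.1 v.1 := by
  obtain ⟨c, hc, h⟩ := exists_smul_eq_rep v
  have := (Complex.normSq_pos.2 hc).ne'
  rw [mass, h, reInner_smul_smul, Pi.smul_apply, smul_eq_mul, Complex.normSq_mul,
    mul_div_mul_left _ _ this]

theorem mass_nonneg (i : Fin 3) (x : CP2) : 0 ≤ mass i x :=
  div_nonneg (Complex.normSq_nonneg _) (reInner_self_pos (rep x).2).le

theorem mass_eq_zero_iff (i : Fin 3) (x : CP2) : mass i x = 0 ↔ x ∉ affineSet i := by
  rw [mass, div_eq_zero_iff, or_iff_left (reInner_self_pos (rep x).2).ne', Complex.normSq_eq_zero,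
    ← not_iff_not, not_not]
  conv_rhs => rw [← mk_rep x]
  exact (mk_mem_affineSet i (rep x)).symm

theorem field_eq (z : Fin 3 → ℂ) :
    field z = ![-z 0, 0, z 2 + ((fubiniStudy z (weight z) (shear z) / 4 : ℝ) : ℂ) * z 1] := by
  ext j
  fin_cases j <;> simp [field, shear, weight]
  ring

theorem hasFDerivAt_mass (i : Fin 3) {z : Fin 3 → ℂ} (hz : z ≠ 0) :
    ∃ ψ' : (Fin 3 → ℂ) →L[ℝ] ℝ,
      HasFDerivAt (fun z : Fin 3 → ℂ => Complex.normSq (z i) / reInner z z) ψ' z ∧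
      ∀ a, ψ' a = (2 * ((z i).re * (a i).re + (z i).im * (a i).im) * reInner z z -
        Complex.normSq (z i) * (2 * reInner z a)) / reInner z z ^ 2 := by
  have h := (reInner_self_pos hz).ne'
  have hre : HasFDerivAt (fun z : Fin 3 → ℂ => (z i).re)
      (Complex.reCLM.comp (ContinuousLinearMap.proj i)) z :=
    (Complex.reCLM.comp (ContinuousLinearMap.proj i : (Fin 3 → ℂ) →L[ℝ] ℂ)).hasFDerivAt
  have him : HasFDerivAt (fun z : Fin 3 → ℂ => (z i).im)
      (Complex.imCLM.comp (ContinuousLinearMap.proj i)) z :=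
    (Complex.imCLM.comp (ContinuousLinearMap.proj i : (Fin 3 → ℂ) →L[ℝ] ℂ)).hasFDerivAt
  have h2 : HasFDerivAt (fun z : Fin 3 → ℂ => reInner z z) _ z :=
    reInner.hasFDerivAt.clm_apply (hasFDerivAt_id z)
  have h3 := ((hre.mul hre).add (him.mul him)).mul (HasDerivAt.comp_hasFDerivAt
    (h₂ := fun y : ℝ => y⁻¹) (f := fun z : Fin 3 → ℂ => reInner z z) z (hasDerivAt_inv h) h2)
  refine ⟨_, h3, fun a => ?_⟩
  simp [reInner_comm a z, Complex.normSq_apply]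
  field_simp
  ring

/-- The normalized coordinates satisfy a linear differential inequality along flow lines. -/
theorem hasDerivAt_mass {γ : ℝ → CP2} (hγ : MorseFlow.IsFlowLine metric morse γ) (i : Fin 3)
    (t : ℝ) : ∃ d, HasDerivAt (fun t => mass i (γ t)) d t ∧ |d| ≤ 8 * mass i (γ t) := by
  obtain ⟨ψ', h1, h2⟩ := hasFDerivAt_mass i (rep (γ t)).2
  refine ⟨_, hasDerivAt_comp_flowLine hγ (mass_mk i) h1, ?_⟩
  rw [h2, mass]
  have hN := reInner_self_pos (rep (γ t)).2
  generalize (rep (γ t)).1 = z at *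
  have hB : reInner z (field z) = -Complex.normSq (z 0) + Complex.normSq (z 2) +
      fubiniStudy z (weight z) (shear z) / 4 * ((z 2).re * (z 1).re + (z 2).im * (z 1).im) := by
    rw [field_eq, reInner_apply, Fin.sum_univ_three]
    simp [Complex.normSq_apply]
    ring
  have hC : (z 2).re * (field z 2).re + (z 2).im * (field z 2).im = Complex.normSq (z 2) +
      fubiniStudy z (weight z) (shear z) / 4 * ((z 2).re * (z 1).re + (z 2).im * (z 1).im) := by
    rw [field_eq]
    simp [Complex.normSq_apply]
    ring
  have hp := Complex.normSq_nonneg (z 0)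
  have hq := Complex.normSq_nonneg (z 1)
  have hs := Complex.normSq_nonneg (z 2)
  have hNe := reInner_self z
  have hR : ((z 2).re * (z 1).re + (z 2).im * (z 1).im) ^ 2 ≤
      Complex.normSq (z 1) * Complex.normSq (z 2) := by
    rw [Complex.normSq_apply, Complex.normSq_apply]
    nlinarith [sq_nonneg ((z 2).re * (z 1).im - (z 2).im * (z 1).re)]
  obtain ⟨e, he, he0, hes⟩ : ∃ e, fubiniStudy z (weight z) (shear z) / 4 *
      ((z 2).re * (z 1).re + (z 2).im * (z 1).im) = -e ∧ 0 ≤ e ∧ e ≤ Complex.normSq (z 2) := by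
    refine ⟨((z 2).re * (z 1).re + (z 2).im * (z 1).im) ^ 2 *
      (2 * Complex.normSq (z 0) + Complex.normSq (z 1)) / (2 * reInner z z ^ 2), ?_, ?_, ?_⟩
    · rw [fubiniStudy_weight_shear]
      field_simp
      ring
    · positivity
    · rw [div_le_iff₀ (by positivity), hNe]
      refine (mul_le_mul_of_nonneg_right hR (by positivity)).trans ?_
      rw [mul_comm (Complex.normSq (z 1)), mul_assoc]
      refine mul_le_mul_of_nonneg_left ?_ hs
      nlinarith [mul_nonneg hp hq, mul_nonneg hp hs, mul_nonneg hq hs, mul_nonneg hp hp,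
        mul_nonneg hq hq, mul_nonneg hs hs]
  rw [he] at hB hC
  rw [abs_div, abs_of_pos (pow_pos hN 2), div_le_iff₀ (pow_pos hN 2)]
  have hrhs : 8 * (Complex.normSq (z i) / reInner z z) * reInner z z ^ 2 =
      8 * Complex.normSq (z i) * reInner z z := by
    field_simp
  rw [hrhs, hB]
  have hi := Complex.normSq_nonneg (z i)
  have key : ∀ m : ℝ, |m| ≤ 2 * Complex.normSq (z i) →
      |2 * m * reInner z z - Complex.normSq (z i) *
        (2 * (-Complex.normSq (z 0) + Complex.normSq (z 2) + -e))| ≤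
      8 * Complex.normSq (z i) * reInner z z := fun m hm => by
    have h3 : |-Complex.normSq (z 0) + Complex.normSq (z 2) + -e| ≤ 2 * reInner z z := by
      rw [abs_le, hNe]
      constructor <;> linarith
    refine (abs_sub _ _).trans ?_
    rw [abs_mul, abs_mul, abs_mul, abs_mul, abs_of_nonneg hi, abs_of_pos hN, abs_two]
    nlinarith [mul_le_mul_of_nonneg_right hm hN.le, mul_le_mul_of_nonneg_left h3 hi]
  apply key
  fin_cases i
  · rw [field_eq]
    simp [Complex.normSq_apply] at hp ⊢
    rw [abs_le]
    constructor <;> nlinarith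
  · rw [field_eq]
    simpa [Complex.normSq_apply] using hq
  · simp only [Fin.reduceFinMk]
    rw [hC, abs_le]
    constructor <;> linarith

/-- The coordinate lines are invariant under the flow. -/
theorem mem_affineSet_of_flowLine {γ : ℝ → CP2} (hγ : MorseFlow.IsFlowLine metric morse γ)
    {i : Fin 3} {t₀ : ℝ} (h : γ t₀ ∈ affineSet i) (t : ℝ) : γ t ∈ affineSet i := by
  by_contra ht
  rw [← mass_eq_zero_iff] at ht
  have := eq_zero_of_abs_deriv_le (fun t => mass_nonneg i (γ t)) (hasDerivAt_mass hγ i) ht t₀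
  exact (mass_eq_zero_iff i _).1 this h

theorem vertex_mem_affineSet_iff (i j : Fin 3) : vertex i ∈ affineSet j ↔ j = i := by
  rw [vertex, mk_mem_affineSet]
  by_cases h : j = i <;> simp [h]

theorem eq_vertex_of_forall_notMem {x : CP2} {i : Fin 3} (h : ∀ j, j ≠ i → x ∉ affineSet j) :
    x = vertex i := by
  rw [← mk_rep x] at h ⊢
  exact eq_vertex fun j hj => by simpa [mk_mem_affineSet] using h j hj

theorem flowLine_eq_vertex {γ : ℝ → CP2} (hγ : MorseFlow.IsFlowLine metric morse γ)
    {i : Fin 3} {t₀ : ℝ} (h : γ t₀ = vertex i) (t : ℝ) : γ t = vertex i := by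
  refine eq_vertex_of_forall_notMem fun j hj ht => hj ?_
  have := mem_affineSet_of_flowLine hγ ht t₀
  rwa [h, vertex_mem_affineSet_iff] at this

theorem hasDerivAt_morse {γ : ℝ → CP2} (hγ : MorseFlow.IsFlowLine metric morse γ) (t : ℝ) :
    HasDerivAt (fun t => morse (γ t)) (-inner (γ t) (vectorField (γ t)) (vectorField (γ t))) t := by
  have h := hasDerivAt_comp_flowLine hγ morse_mk (hasFDerivAt_height (rep (γ t)).2)
  rw [inner_vectorField, lift_vectorField, map_add, fubiniStudy_smul_right _ _ (rep _).2, add_zero,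
    neg_neg]
  exact h

theorem isCritical_of_vectorField_eq_zero {x : CP2} (h : vectorField x = 0) :
    ∃ i, x = vertex i := by
  rw [← isCritical_iff, MorseFlow.IsCritical, (hasMFDerivAt_morse x).mfderiv]
  have : ∀ w, fubiniStudy (rep x).1 (weight (rep x).1) (lift (idx x) w) = 0 := fun w => by
    have := inner_vectorField x w
    rw [h] at this
    simpa using this.symm
  exact ContinuousLinearMap.ext this

/-- The Morse function decreases strictly along nonconstant flow lines. -/
theorem flowLine_const_or_strictAnti {γ : ℝ → CP2} (hγ : MorseFlow.IsFlowLine metric morse γ) :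
    (∃ i, ∀ t, γ t = vertex i) ∨ StrictAnti fun t => morse (γ t) := by
  by_cases h : ∃ t i, γ t = vertex i
  · obtain ⟨t, i, h⟩ := h
    exact Or.inl ⟨i, flowLine_eq_vertex hγ h⟩
  · refine Or.inr (strictAnti_of_hasDerivAt_neg (hasDerivAt_morse hγ) fun t => ?_)
    refine neg_neg_of_pos (inner_pos _ _ fun h0 => h ?_)
    exact ⟨t, isCritical_of_vectorField_eq_zero h0⟩

theorem antitone_morse {γ : ℝ → CP2} (hγ : MorseFlow.IsFlowLine metric morse γ) :
    Antitone fun t => morse (γ t) := by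
  rcases flowLine_const_or_strictAnti hγ with ⟨i, h⟩ | h
  · simp only [h]
    exact antitone_const
  · exact h.antitone

theorem continuous_morse : Continuous morse := contMDiff_morse.continuous

theorem morse_le_of_tendsto_atBot {γ : ℝ → CP2} (hγ : MorseFlow.IsFlowLine metric morse γ)
    {p : CP2} (h : Tendsto γ atBot (𝓝 p)) (t : ℝ) : morse (γ t) ≤ morse p :=
  (antitone_morse hγ).ge_of_tendsto ((continuous_morse.tendsto p).comp h) t

theorem le_morse_of_tendsto_atTop {γ : ℝ → CP2} (hγ : MorseFlow.IsFlowLine metric morse γ)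
    {q : CP2} (h : Tendsto γ atTop (𝓝 q)) (t : ℝ) : morse q ≤ morse (γ t) :=
  (antitone_morse hγ).le_of_tendsto ((continuous_morse.tendsto q).comp h) t

theorem strictAnti_morse {p q : CP2} (γ : MorseFlow.FlowLine metric morse p q)
    (h : morse p ≠ morse q) : StrictAnti fun t => morse (γ.toFun t) := by
  refine (flowLine_const_or_strictAnti γ.isFlowLine).resolve_left ?_
  rintro ⟨i, hi⟩
  have h1 := (continuous_morse.tendsto p).comp γ.tendsto_atBot
  have h2 := (continuous_morse.tendsto q).comp γ.tendsto_atTop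
  simp only [Function.comp_def, hi] at h1 h2
  exact h ((tendsto_nhds_unique h1 tendsto_const_nhds).trans
    (tendsto_nhds_unique tendsto_const_nhds h2))

/-! ### Existence of flow lines -/

open scoped NNReal in
/-- A time dependent scalar differential equation whose right hand side is uniformly Lipschitz, and
bounded on bounded time intervals, has global solutions. -/
theorem exists_global_solution {F : ℝ → ℝ → ℝ} {K : ℝ≥0} (hK : ∀ t, LipschitzWith K (F t))
    (hc : ∀ x, Continuous fun t => F t x)
    (hb : ∀ T : ℝ, ∃ L : ℝ≥0, ∀ t ∈ Set.Icc (-T) T, ∀ x, ‖F t x‖ ≤ L) (x₀ : ℝ) :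
    ∃ α : ℝ → ℝ, α 0 = x₀ ∧ ∀ t, HasDerivAt α (F t (α t)) t := by
  have hloc : ∀ n : ℕ, ∃ α : ℝ → ℝ, α 0 = x₀ ∧
      ∀ t ∈ Set.Ioo (-(n + 1 : ℝ)) (n + 1), HasDerivAt α (F t (α t)) t := fun n => by
    obtain ⟨L, hL⟩ := hb (n + 1)
    have h0 : (0 : ℝ) ∈ Set.Icc (-(n + 1 : ℝ)) (n + 1) := by
      constructor <;> linarith [n.cast_nonneg (α := ℝ)]
    have hp : IsPicardLindelof F (⟨0, h0⟩ : Set.Icc (-(n + 1 : ℝ)) (n + 1)) x₀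
        (L * (n + 1)) 0 L K :=
      { lipschitzOnWith := fun t _ => (hK t).lipschitzOnWith
        continuousOn := fun x _ => (hc x).continuousOn
        norm_le := fun t ht x _ => hL t ht x
        mul_max_le := by simp }
    obtain ⟨α, h1, h2⟩ := hp.exists_eq_forall_mem_Icc_hasDerivWithinAt₀
    exact ⟨α, h1, fun t ht =>
      (h2 t (Set.Ioo_subset_Icc_self ht)).hasDerivAt (Icc_mem_nhds ht.1 ht.2)⟩
  choose α h0 hα using hloc
  have huniq : ∀ m n : ℕ, m ≤ n → Set.EqOn (α m) (α n) (Set.Ioo (-(m + 1 : ℝ)) (m + 1)) := by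
    intro m n hmn
    have hmn' : (m : ℝ) ≤ n := Nat.cast_le.2 hmn
    have hm := m.cast_nonneg (α := ℝ)
    refine ODE_solution_unique_of_mem_Ioo (v := F) (s := fun _ => Set.univ) (K := K) (t₀ := 0)
      (fun t _ => (hK t).lipschitzOnWith) (by constructor <;> linarith)
      (fun t ht => ⟨hα m t ht, Set.mem_univ _⟩)
      (fun t ht => ⟨hα n t ⟨by linarith [ht.1], by linarith [ht.2]⟩, Set.mem_univ _⟩)
      ((h0 m).trans (h0 n).symm)
  have hceil : ∀ t : ℝ, t ∈ Set.Ioo (-((⌈|t|⌉₊ : ℝ) + 1)) ((⌈|t|⌉₊ : ℝ) + 1) := fun t => by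
    rw [Set.mem_Ioo, ← abs_lt]
    linarith [Nat.le_ceil |t|]
  have heq : ∀ (n : ℕ), ∀ t ∈ Set.Ioo (-(n + 1 : ℝ)) (n + 1), α ⌈|t|⌉₊ t = α n t := by
    intro n t ht
    rcases le_total ⌈|t|⌉₊ n with h | h
    · exact huniq _ _ h (hceil t)
    · exact (huniq _ _ h ht).symm
  refine ⟨fun t => α ⌈|t|⌉₊ t, h0 _, fun t => ?_⟩
  refine (hα _ t (hceil t)).congr_of_eventuallyEq ?_
  filter_upwards [Ioo_mem_nhds (hceil t).1 (hceil t).2] with s hs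
  exact heq _ s hs

/-- The relative rate at which the flow slows down the real part of the second affine coordinate
`z₂ / z₁`. -/
def rate (w : Fin 2 → ℂ) : ℝ :=
  (1 + 2 * Complex.normSq (w 0)) / (2 * (1 + Complex.normSq (w 0) + Complex.normSq (w 1)) ^ 2)

theorem rate_nonneg (w : Fin 2 → ℂ) : 0 ≤ rate w := by
  have := Complex.normSq_nonneg (w 0)
  exact div_nonneg (by linarith) (by positivity)

theorem rate_le (w : Fin 2 → ℂ) : rate w ≤ 1 / 2 := by
  have h0 := Complex.normSq_nonneg (w 0)
  have h1 := Complex.normSq_nonneg (w 1)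
  rw [rate, div_le_iff₀ (by positivity)]
  nlinarith [mul_nonneg h0 h1]

theorem le_rate {w : Fin 2 → ℂ} {C : ℝ} (h : Complex.normSq (w 0) + Complex.normSq (w 1) ≤ C) :
    1 / (2 * (1 + C) ^ 2) ≤ rate w := by
  have h0 := Complex.normSq_nonneg (w 0)
  have h1 := Complex.normSq_nonneg (w 1)
  rw [rate]
  refine div_le_div₀ (by linarith) (by linarith) (by positivity) ?_
  exact mul_le_mul_of_nonneg_left (pow_le_pow_left₀ (by positivity) (by linarith) 2) zero_le_two

/-- The affine coordinates in the chart `z₁ ≠ 0` at time `t` of the flow line whose slowed down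
coordinate is `exp t * ψ`. -/
def flowCoord (u : ℂ) (b t ψ : ℝ) : Fin 2 → ℂ :=
  ![Real.exp (-t) * u, ⟨Real.exp t * ψ, Real.exp t * b⟩]

theorem rate_flowCoord (u : ℂ) (b t ψ : ℝ) : rate (flowCoord u b t ψ) =
    (1 + 2 * (Real.exp (-t) ^ 2 * Complex.normSq u)) / (2 * (1 + Real.exp (-t) ^ 2 *
      Complex.normSq u + Real.exp t ^ 2 * b ^ 2 + Real.exp t ^ 2 * ψ ^ 2) ^ 2) := by
  simp only [rate, flowCoord, Matrix.cons_val_zero, Matrix.cons_val_one, Complex.normSq_mul,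
    Complex.normSq_ofReal, Complex.normSq_mk]
  ring_nf

/-- The right hand side is uniformly Lipschitz in `x`: its derivative is a product of factors
bounded by `1` and by `5 / 2`. -/
theorem exists_rate_solution (u : ℂ) (b x₀ : ℝ) : ∃ ψ : ℝ → ℝ, ψ 0 = x₀ ∧
    ∀ t, HasDerivAt ψ (-rate (flowCoord u b t (ψ t)) * ψ t) t := by
  have hu := Complex.normSq_nonneg u
  refine exists_global_solution (F := fun t x => -rate (flowCoord u b t x) * x) (K := 5 / 2)
    (fun t => ?_) (fun x => ?_) (fun T => ?_) x₀
  · have hd : ∀ x : ℝ, ∃ d,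
        HasDerivAt (fun x => -rate (flowCoord u b t x) * x) d x ∧ ‖d‖ ≤ 5 / 2 := by
      intro x
      simp only [rate_flowCoord]
      obtain ⟨a, ha⟩ : ∃ a, a = Real.exp (-t) ^ 2 * Complex.normSq u := ⟨_, rfl⟩
      obtain ⟨c, hc⟩ : ∃ c, c = Real.exp t ^ 2 * b ^ 2 := ⟨_, rfl⟩
      obtain ⟨e, he⟩ : ∃ e, e = Real.exp t ^ 2 := ⟨_, rfl⟩
      have ha0 : 0 ≤ a := by rw [ha]; positivity
      have hc0 : 0 ≤ c := by rw [hc]; positivity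
      have he0 : 0 ≤ e := by rw [he]; positivity
      rw [← ha, ← hc, ← he]
      obtain ⟨D, hD⟩ : ∃ D, D = 1 + a + c + e * x ^ 2 := ⟨_, rfl⟩
      have hex : 0 ≤ e * x ^ 2 := by positivity
      have hD1 : 1 ≤ D := by linarith
      have h1 : HasDerivAt (fun x : ℝ => 2 * (1 + a + c + e * x ^ 2) ^ 2)
          (2 * (2 * D * (e * (2 * x)))) x := by
        have := ((((hasDerivAt_pow 2 x).const_mul e).const_add (1 + a + c)).pow 2).const_mul 2
        simpa [hD] using this
      have h2 := (((hasDerivAt_const x (1 + 2 * a)).div h1 (by rw [← hD]; positivity)).neg).mul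
        (hasDerivAt_id x)
      refine ⟨_, h2, ?_⟩
      simp only [Pi.neg_apply, Pi.div_apply, id, ← hD, Real.norm_eq_abs]
      have h3 : -((0 * (2 * D ^ 2) - (1 + 2 * a) * (2 * (2 * D * (e * (2 * x))))) /
          (2 * D ^ 2) ^ 2) * x + -((1 + 2 * a) / (2 * D ^ 2)) * 1 =
          (1 + 2 * a) / D ^ 2 * (2 * (e * x ^ 2 / D) - 1 / 2) := by
        field_simp
        ring
      rw [h3, abs_mul]
      have h4 : |(1 + 2 * a) / D ^ 2| ≤ 1 := by
        rw [abs_of_nonneg (by positivity), div_le_one (by positivity)]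
        nlinarith
      have h5 : 0 ≤ e * x ^ 2 / D := by positivity
      have h6 : e * x ^ 2 / D ≤ 1 := by
        rw [div_le_one (by positivity)]
        linarith
      have h7 : |2 * (e * x ^ 2 / D) - 1 / 2| ≤ 5 / 2 := by
        rw [abs_le]
        constructor <;> linarith
      calc _ ≤ 1 * (5 / 2 : ℝ) := mul_le_mul h4 h7 (abs_nonneg _) zero_le_one
        _ = _ := one_mul _
    choose d hd hd' using hd
    refine lipschitzWith_of_nnnorm_deriv_le (fun x => (hd x).differentiableAt) fun x => ?_
    rw [(hd x).deriv]
    exact hd' x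
  · simp only [rate_flowCoord]
    refine Continuous.mul (Continuous.neg (Continuous.div (by fun_prop) (by fun_prop) fun t => ?_))
      continuous_const
    positivity
  · refine ⟨⟨(1 + Real.exp T ^ 2 * Complex.normSq u) * Real.exp T, by positivity⟩,
      fun t ht x => ?_⟩
    simp only [rate_flowCoord]
    have h1 : Real.exp (-t) ≤ Real.exp T := Real.exp_le_exp.2 (by linarith [ht.1])
    have h2 : Real.exp (-t) ^ 2 * Complex.normSq u ≤ Real.exp T ^ 2 * Complex.normSq u := by
      gcongr
    obtain ⟨a, ha⟩ : ∃ a, a = Real.exp (-t) ^ 2 * Complex.normSq u := ⟨_, rfl⟩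
    have ha0 : 0 ≤ a := by rw [ha]; positivity
    rw [← ha] at h2 ⊢
    set D := 1 + a + Real.exp t ^ 2 * b ^ 2 + Real.exp t ^ 2 * x ^ 2 with hD
    have hb : 0 ≤ Real.exp t ^ 2 * b ^ 2 := by positivity
    have hx : 0 ≤ Real.exp t ^ 2 * x ^ 2 := by positivity
    have hDx : Real.exp t * |x| ≤ D := by
      have : (Real.exp t * |x|) ^ 2 = Real.exp t ^ 2 * x ^ 2 := by rw [mul_pow, sq_abs]
      nlinarith [sq_nonneg (Real.exp t * |x| - 1)]
    have hDp : 0 < D := by positivity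
    have h4 : (1 + 2 * a) / (2 * D ^ 2) * |x| ≤ (1 + a) * Real.exp (-t) := by
      rw [Real.exp_neg, div_mul_eq_mul_div, div_le_iff₀ (by positivity), ← div_eq_mul_inv,
        div_mul_eq_mul_div, le_div_iff₀ (Real.exp_pos t)]
      have : (1 + 2 * a) * |x| * Real.exp t = (1 + 2 * a) * (Real.exp t * |x|) := by ring
      rw [this]
      calc (1 + 2 * a) * (Real.exp t * |x|) ≤ (1 + a) * (2 * D) * D := by
            refine mul_le_mul ?_ hDx (by positivity) (by positivity)
            nlinarith
        _ = _ := by ring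
    rw [Real.norm_eq_abs, abs_mul, abs_neg, abs_of_nonneg (by positivity)]
    refine h4.trans (mul_le_mul ?_ h1 (Real.exp_pos _).le (by positivity))
    linarith

section RateSolution

variable {k ψ : ℝ → ℝ}

theorem hasDerivAt_sq_mul_exp (h : ∀ t, HasDerivAt ψ (-k t * ψ t) t) (c t : ℝ) :
    HasDerivAt (fun t => ψ t ^ 2 * Real.exp (c * t))
      ((c - 2 * k t) * (ψ t ^ 2 * Real.exp (c * t))) t := by
  have h1 := ((hasDerivAt_id t).const_mul c).exp
  simp only [id, mul_one] at h1
  refine (((h t).pow 2).mul h1).congr_deriv ?_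
  simp only [Pi.pow_apply]
  push_cast
  ring

/-- If the relative rate of decay is at least `κ` on an interval, then the solution decays at least
like `exp (-κ t)`. -/
theorem sq_mul_exp_le (h : ∀ t, HasDerivAt ψ (-k t * ψ t) t) {κ s t : ℝ} (hst : s ≤ t)
    (hk : ∀ τ ∈ Set.Icc s t, κ ≤ k τ) : ψ t ^ 2 * Real.exp (2 * κ * (t - s)) ≤ ψ s ^ 2 := by
  have hanti : AntitoneOn (fun t => ψ t ^ 2 * Real.exp (2 * κ * t)) (Set.Icc s t) := by
    refine antitoneOn_of_hasDerivWithinAt_nonpos (convex_Icc s t)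
      (fun τ _ => (hasDerivAt_sq_mul_exp h (2 * κ) τ).continuousAt.continuousWithinAt)
      (fun τ _ => (hasDerivAt_sq_mul_exp h (2 * κ) τ).hasDerivWithinAt) fun τ hτ => ?_
    have h1 := hk τ (interior_subset hτ)
    have h2 : 0 ≤ ψ τ ^ 2 * Real.exp (2 * κ * τ) := by positivity
    nlinarith
  have := hanti (Set.left_mem_Icc.2 hst) (Set.right_mem_Icc.2 hst) hst
  simp only at this
  rw [mul_sub, Real.exp_sub, ← mul_div_assoc, div_le_iff₀ (Real.exp_pos _)]
  exact this

/-- If the relative rate of decay is at most `1 / 2`, then the solution decays at most like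
`exp (-t / 2)`. -/
theorem sq_le_sq_mul_exp (h : ∀ t, HasDerivAt ψ (-k t * ψ t) t) (hk : ∀ t, k t ≤ 1 / 2) {s t : ℝ}
    (hst : s ≤ t) : ψ s ^ 2 ≤ ψ t ^ 2 * Real.exp (t - s) := by
  have hmono : Monotone (fun t => ψ t ^ 2 * Real.exp (1 * t)) := by
    refine monotone_of_hasDerivAt_nonneg (hasDerivAt_sq_mul_exp h 1) fun τ => ?_
    have h1 := hk τ
    have h2 : 0 ≤ ψ τ ^ 2 * Real.exp (1 * τ) := by positivity
    simp only [Pi.zero_apply]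
    nlinarith
  have := hmono hst
  simp only [one_mul] at this
  rw [Real.exp_sub, ← mul_div_assoc, le_div_iff₀ (Real.exp_pos _)]
  exact this

end RateSolution

/-- The shear component of `field`, in the chart `z₁ ≠ 0`. -/
theorem fubiniStudy_rate (w : Fin 2 → ℂ) :
    fubiniStudy (homog 1 w).1 (weight (homog 1 w).1) (shear (homog 1 w).1) / 4 =
      -rate w * (w 1).re := by
  have h0 : (homog 1 w).1 0 = w 0 := homog_apply_succAbove 1 w 0
  have h1 : (homog 1 w).1 1 = 1 := homog_apply_same 1 w
  have h2 : (homog 1 w).1 2 = w 1 := homog_apply_succAbove 1 w 1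
  rw [fubiniStudy_weight_shear, reInner_self, h0, h1, h2, rate]
  have n0 := Complex.normSq_nonneg (w 0)
  have n1 := Complex.normSq_nonneg (w 1)
  simp only [Complex.one_re, Complex.one_im, map_one]
  have : Complex.normSq (w 0) + 1 + Complex.normSq (w 1) ≠ 0 := by positivity
  have : 1 + Complex.normSq (w 0) + Complex.normSq (w 1) ≠ 0 := by positivity
  field_simp
  ring

theorem tendsto_mk_of_smul {l : Filter ℝ} {Z : ℝ → {v : Fin 3 → ℂ // v ≠ 0}} {c : ℝ → ℂ}
    (hc : ∀ t, c t ≠ 0) {y : {v : Fin 3 → ℂ // v ≠ 0}}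
    (h : Tendsto (fun t => c t • (Z t).1) l (𝓝 y.1)) :
    Tendsto (fun t => mk (Z t)) l (𝓝 (mk y)) := by
  have h1 : Tendsto (fun t => (⟨c t • (Z t).1, smul_ne_zero (hc t) (Z t).2⟩ :
      {v : Fin 3 → ℂ // v ≠ 0})) l (𝓝 y) := tendsto_subtype_rng.2 h
  refine ((continuous_mk.tendsto y).comp h1).congr fun t => ?_
  exact (mk_eq_mk_iff _ _).2 ⟨c t, rfl⟩

theorem hasDerivAt_exp_neg (t : ℝ) : HasDerivAt (fun t => Real.exp (-t)) (-Real.exp (-t)) t := by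
  simpa using (hasDerivAt_neg t).exp

theorem hasDerivAt_ofReal_exp (t : ℝ) :
    HasDerivAt (fun t => ((Real.exp t : ℝ) : ℂ)) ((Real.exp t : ℝ) : ℂ) t :=
  (Real.hasDerivAt_exp t).ofReal_comp

theorem hasDerivAt_ofReal_exp_neg (t : ℝ) :
    HasDerivAt (fun t => ((Real.exp (-t) : ℝ) : ℂ)) (-((Real.exp (-t) : ℝ) : ℂ)) t := by
  simpa using (hasDerivAt_exp_neg t).ofReal_comp

theorem homog_one (w : Fin 2 → ℂ) : (homog 1 w).1 = ![w 0, 1, w 1] := by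
  ext j
  refine Fin.succAboveCases 1 ?_ (fun k => ?_) j
  · simp
  · rw [homog_apply_succAbove]
    fin_cases k <;> rfl

/-- The explicit curves `flowCoord` are flow lines. -/
theorem isFlowLine_homog {u : ℂ} {b : ℝ} {ψ : ℝ → ℝ}
    (h : ∀ t, HasDerivAt ψ (-rate (flowCoord u b t (ψ t)) * ψ t) t) :
    MorseFlow.IsFlowLine metric morse fun t => mk (homog 1 (flowCoord u b t (ψ t))) := by
  refine isFlowLine_mk fun t => ?_
  rw [field_eq, fubiniStudy_rate]
  simp only [homog_one]
  refine hasDerivAt_pi.2 fun j => ?_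
  fin_cases j
  · simpa [flowCoord] using (hasDerivAt_ofReal_exp_neg t).mul_const u
  · simpa using hasDerivAt_const t (1 : ℂ)
  · have h1 : HasDerivAt (fun t => ((Real.exp t * ψ t : ℝ) : ℂ) +
        ((Real.exp t * b : ℝ) : ℂ) * Complex.I) _ t :=
      (((Real.hasDerivAt_exp t).mul (h t)).ofReal_comp).add
        ((((Real.hasDerivAt_exp t).mul_const b).ofReal_comp).mul_const Complex.I)
    have e : ∀ t, flowCoord u b t (ψ t) 1 = ((Real.exp t * ψ t : ℝ) : ℂ) +
        ((Real.exp t * b : ℝ) : ℂ) * Complex.I := fun t => by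
      simp only [flowCoord, Matrix.cons_val_one]
      exact Complex.mk_eq_add_mul_I _ _
    simp only [Fin.reduceFinMk, Matrix.cons_val]
    simp only [e]
    refine h1.congr_deriv ?_
    generalize rate (flowCoord u b t (ψ t)) = k
    simp
    ring

theorem tendsto_exp_mul_zero_of_sq_le {ψ : ℝ → ℝ} {c : ℝ}
    (h : ∀ t ≤ 0, ψ t ^ 2 ≤ c * Real.exp (-t)) :
    Tendsto (fun t => Real.exp t * ψ t) atBot (𝓝 0) := by
  have h1 : Tendsto (fun t => (Real.exp t * ψ t) ^ 2) atBot (𝓝 0) := by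
    have h2 : Tendsto (fun t => c * Real.exp t) atBot (𝓝 0) := by
      simpa using Real.tendsto_exp_atBot.const_mul c
    refine tendsto_of_tendsto_of_tendsto_of_le_of_le' tendsto_const_nhds h2
      (Eventually.of_forall fun t => sq_nonneg _) ?_
    filter_upwards [eventually_le_atBot 0] with t ht
    have e := Real.exp_pos t
    calc (Real.exp t * ψ t) ^ 2 = Real.exp t ^ 2 * ψ t ^ 2 := by ring
      _ ≤ Real.exp t ^ 2 * (c * Real.exp (-t)) := by gcongr; exact h t ht
      _ = c * Real.exp t := by
        rw [Real.exp_neg]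
        field_simp
  have h3 := h1.sqrt
  simp only [Real.sqrt_sq_eq_abs, Real.sqrt_zero] at h3
  exact (tendsto_zero_iff_abs_tendsto_zero _).2 h3

theorem tendsto_ofReal_exp_atBot : Tendsto (fun t => ((Real.exp t : ℝ) : ℂ)) atBot (𝓝 0) := by
  simpa [Function.comp_def] using (Complex.continuous_ofReal.tendsto 0).comp Real.tendsto_exp_atBot

theorem tendsto_ofReal_exp_neg_atTop :
    Tendsto (fun t => ((Real.exp (-t) : ℝ) : ℂ)) atTop (𝓝 0) := by
  simpa [Function.comp_def] using
    (Complex.continuous_ofReal.tendsto 0).comp Real.tendsto_exp_neg_atTop_nhds_zero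

theorem tendsto_vec {l : Filter ℝ} {f g h : ℝ → ℂ} {a b c : ℂ} (hf : Tendsto f l (𝓝 a))
    (hg : Tendsto g l (𝓝 b)) (hh : Tendsto h l (𝓝 c)) :
    Tendsto (fun t => ![f t, g t, h t]) l (𝓝 ![a, b, c]) := by
  refine tendsto_pi_nhds.2 fun j => ?_
  fin_cases j
  · exact hf
  · exact hg
  · exact hh

/-- The asymptotic behaviour of flow lines in each stratum of the coordinate triangle. -/
def HasExpectedLimits (x : CP2) (γ : ℝ → CP2) : Prop :=
  (x ∈ affineSet 0 → Tendsto γ atBot (𝓝 (vertex 0))) ∧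
  (x ∉ affineSet 0 → x ∈ affineSet 1 → Tendsto γ atBot (𝓝 (vertex 1))) ∧
  (x ∈ affineSet 2 → Tendsto γ atTop (𝓝 (vertex 2))) ∧
  (x ∉ affineSet 2 → x ∈ affineSet 1 → Tendsto γ atTop (𝓝 (vertex 1)))

theorem tendsto_vertex {l : Filter ℝ} {Z : ℝ → {v : Fin 3 → ℂ // v ≠ 0}} {c : ℝ → ℂ}
    (hc : ∀ t, c t ≠ 0) {i : Fin 3} {s : ℂ} (hs : s ≠ 0)
    (h : Tendsto (fun t => c t • (Z t).1) l (𝓝 (Pi.single i s))) :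
    Tendsto (fun t => mk (Z t)) l (𝓝 (vertex i)) := by
  have hv : mk ⟨Pi.single i s, by simpa using hs⟩ = vertex i :=
    eq_vertex fun j hj => by simp [hj]
  rw [← hv]
  exact tendsto_mk_of_smul hc h

theorem exists_flowLine_of_mem {w : Fin 2 → ℂ} : ∃ γ : ℝ → CP2,
    MorseFlow.IsFlowLine metric morse γ ∧ γ 0 = mk (homog 1 w) ∧
    HasExpectedLimits (mk (homog 1 w)) γ := by
  obtain ⟨ψ, h0, hψ⟩ := exists_rate_solution (w 0) (w 1).im (w 1).re
  have hk0 := fun t => rate_nonneg (flowCoord (w 0) (w 1).im t (ψ t))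
  have hk := fun t => rate_le (flowCoord (w 0) (w 1).im t (ψ t))
  have hm0 : mk (homog 1 w) ∈ affineSet 0 ↔ w 0 ≠ 0 := by
    rw [mk_mem_affineSet, homog_one]
    rfl
  have hm2 : mk (homog 1 w) ∈ affineSet 2 ↔ w 1 ≠ 0 := by
    rw [mk_mem_affineSet, homog_one]
    rfl
  have hup : ∀ t, 0 ≤ t → (w 1).re ^ 2 ≤ ψ t ^ 2 * Real.exp t := fun t ht => by
    simpa [h0] using sq_le_sq_mul_exp hψ hk ht
  have hdown : ∀ t ≤ 0, ψ t ^ 2 ≤ (w 1).re ^ 2 * Real.exp (-t) := fun t ht => by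
    simpa [h0] using sq_le_sq_mul_exp hψ hk ht
  have e0 : ∀ t, flowCoord (w 0) (w 1).im t (ψ t) 0 = ((Real.exp (-t) : ℝ) : ℂ) * w 0 :=
    fun _ => rfl
  have e1 : ∀ t, flowCoord (w 0) (w 1).im t (ψ t) 1 =
      ⟨Real.exp t * ψ t, Real.exp t * (w 1).im⟩ := fun _ => rfl
  have hlim1 : Tendsto (fun t => flowCoord (w 0) (w 1).im t (ψ t) 1) atBot (𝓝 0) := by
    have h1 := tendsto_exp_mul_zero_of_sq_le hdown
    have h2 := Real.tendsto_exp_atBot.mul_const (w 1).im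
    have h3 := ((Complex.continuous_ofReal.tendsto _).comp h1).add
      (((Complex.continuous_ofReal.tendsto _).comp h2).mul_const Complex.I)
    simp only [Function.comp_def, zero_mul, Complex.ofReal_zero, add_zero] at h3
    refine h3.congr fun t => ?_
    rw [e1]
    exact (Complex.mk_eq_add_mul_I _ _).symm
  have hne1 : ∀ t, ((Real.exp t : ℝ) : ℂ) ≠ 0 := fun t =>
    Complex.ofReal_ne_zero.2 (Real.exp_pos t).ne'
  refine ⟨_, isFlowLine_homog hψ, ?_, ?_, ?_, ?_, ?_⟩
  · congr 2
    ext j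
    fin_cases j
    · simp [flowCoord]
    · apply Complex.ext <;> simp [flowCoord, h0]
  · intro hx
    refine tendsto_vertex hne1 (hm0.1 hx) ?_
    have e : (Pi.single 0 (w 0) : Fin 3 → ℂ) = ![w 0, 0, 0] := by
      ext j
      fin_cases j <;> simp
    rw [e]
    refine (tendsto_vec (tendsto_const_nhds (x := w 0)) tendsto_ofReal_exp_atBot
      (by simpa using tendsto_ofReal_exp_atBot.mul hlim1)).congr fun t => ?_
    rw [homog_one, e0]
    ext j
    fin_cases j
    · simp [← mul_assoc, ← Complex.exp_add]
    · simp
    · simp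
  · intro hx _
    refine tendsto_vertex (c := fun _ => 1) (fun _ => one_ne_zero) (s := 1) one_ne_zero ?_
    have e : (Pi.single 1 1 : Fin 3 → ℂ) = ![0, 1, 0] := by
      ext j
      fin_cases j <;> simp
    rw [e]
    refine (tendsto_vec (tendsto_const_nhds (x := 0)) (tendsto_const_nhds (x := 1)) hlim1).congr
      fun t => ?_
    rw [homog_one, e0, one_smul, not_not.1 (fun h => hx (hm0.2 h)), mul_zero]
  · intro hx
    have hw := hm2.1 hx
    have hlow : ∀ t, 0 ≤ t →
        Complex.normSq (w 1) * Real.exp t ≤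
          Complex.normSq (flowCoord (w 0) (w 1).im t (ψ t) 1) := by
      intro t ht
      rw [e1, Complex.normSq_mk, Complex.normSq_apply]
      have h1 := mul_le_mul_of_nonneg_right (hup t ht) (Real.exp_pos t).le
      have h2 := Real.one_le_exp ht
      nlinarith [mul_nonneg (mul_self_nonneg (w 1).im)
        (mul_nonneg (Real.exp_pos t).le (sub_nonneg.2 h2))]
    have hne : ∀ t, 0 ≤ t → flowCoord (w 0) (w 1).im t (ψ t) 1 ≠ 0 := by
      intro t ht h
      have h1 := hlow t ht
      rw [h, map_zero] at h1
      exact absurd h1 (not_le.2 (mul_pos (Complex.normSq_pos.2 hw) (Real.exp_pos t)))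
    have hinv : Tendsto (fun t => (flowCoord (w 0) (w 1).im t (ψ t) 1)⁻¹) atTop (𝓝 0) := by
      refine tendsto_inv₀_cobounded.comp (tendsto_norm_atTop_iff_cobounded.1 ?_)
      have h1 : Tendsto (fun t => Real.sqrt (Complex.normSq (w 1) * Real.exp t)) atTop atTop :=
        Real.tendsto_sqrt_atTop.comp
          (Real.tendsto_exp_atTop.const_mul_atTop (Complex.normSq_pos.2 hw))
      refine tendsto_atTop_mono' _ ?_ h1
      filter_upwards [eventually_ge_atTop 0] with t ht
      rw [Complex.norm_def]
      exact Real.sqrt_le_sqrt (hlow t ht)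
    have hc : ∀ t, (if 0 ≤ t then (flowCoord (w 0) (w 1).im t (ψ t) 1)⁻¹ else 1) ≠ 0 := by
      intro t
      split_ifs with ht
      · exact inv_ne_zero (hne t ht)
      · exact one_ne_zero
    refine tendsto_vertex hc (s := 1) one_ne_zero ?_
    have e : (Pi.single 2 1 : Fin 3 → ℂ) = ![0, 0, 1] := by
      ext j
      fin_cases j <;> simp
    rw [e]
    refine Tendsto.congr' ?_ (tendsto_vec (f := fun t => (flowCoord (w 0) (w 1).im t (ψ t) 1)⁻¹ *
      (((Real.exp (-t) : ℝ) : ℂ) * w 0)) (a := 0) ?_ hinv (tendsto_const_nhds (x := 1)))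
    · filter_upwards [eventually_ge_atTop 0] with t ht
      rw [homog_one, e0, if_pos ht]
      ext j
      fin_cases j
      · simp
      · simp
      · simp [hne t ht]
    · simpa using hinv.mul (tendsto_ofReal_exp_neg_atTop.mul_const (w 0))
  · intro hx _
    have hw : w 1 = 0 := not_not.1 fun h => hx (hm2.2 h)
    have hψ0 : ∀ t, 0 ≤ t → ψ t = 0 := fun t ht => by
      have := sq_mul_exp_le hψ ht (κ := 0) fun τ _ => hk0 τ
      simp only [h0, hw, Complex.zero_re, mul_zero, zero_mul, Real.exp_zero, mul_one] at this
      exact pow_eq_zero_iff two_ne_zero |>.1 (le_antisymm (by simpa using this) (sq_nonneg _))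
    refine tendsto_vertex (c := fun _ => 1) (fun _ => one_ne_zero) (s := 1) one_ne_zero ?_
    have e : (Pi.single 1 1 : Fin 3 → ℂ) = ![0, 1, 0] := by
      ext j
      fin_cases j <;> simp
    rw [e]
    refine Tendsto.congr' ?_ (tendsto_vec (f := fun t => (((Real.exp (-t) : ℝ) : ℂ) * w 0)) (a := 0)
      (by simpa using tendsto_ofReal_exp_neg_atTop.mul_const (w 0))
      (tendsto_const_nhds (x := 1)) (tendsto_const_nhds (x := 0)))
    filter_upwards [eventually_ge_atTop 0] with t ht
    rw [homog_one, e0, one_smul, e1, hψ0 t ht, hw]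
    simp
    rfl

/-- On the coordinate line `z₁ = 0` the flow is linear. -/
theorem exists_flowLine_of_notMem {z : {v : Fin 3 → ℂ // v ≠ 0}} (hz : z.1 1 = 0) :
    ∃ γ : ℝ → CP2, MorseFlow.IsFlowLine metric morse γ ∧ γ 0 = mk z ∧
    HasExpectedLimits (mk z) γ := by
  have hne : ∀ t : ℝ, ((Real.exp t : ℝ) : ℂ) ≠ 0 := fun t =>
    Complex.ofReal_ne_zero.2 (Real.exp_pos t).ne'
  have hZ : ∀ t : ℝ,
      ![((Real.exp (-t) : ℝ) : ℂ) * z.1 0, 0, ((Real.exp t : ℝ) : ℂ) * z.1 2] ≠ 0 := by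
    intro t h
    apply z.2
    have h0 := congrFun h 0
    have h2 := congrFun h 2
    simp only [Matrix.cons_val, Pi.zero_apply, mul_eq_zero, hne, false_or] at h0 h2
    ext j
    fin_cases j
    · exact h0
    · exact hz
    · exact h2
  refine ⟨fun t => mk ⟨_, hZ t⟩, ?_, ?_, ?_, ?_, ?_, ?_⟩
  · refine isFlowLine_mk fun t => ?_
    rw [field_eq]
    refine hasDerivAt_pi.2 fun j => ?_
    fin_cases j
    · simpa using (hasDerivAt_ofReal_exp_neg t).mul_const (z.1 0)
    · simpa using hasDerivAt_const t (0 : ℂ)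
    · simpa using (hasDerivAt_ofReal_exp t).mul_const (z.1 2)
  · refine congrArg mk (Subtype.ext ?_)
    ext j
    fin_cases j <;> simp [hz]
  · intro hx
    rw [mk_mem_affineSet] at hx
    refine tendsto_vertex hne hx ?_
    have hA := tendsto_ofReal_exp_atBot.mul (tendsto_ofReal_exp_atBot.mul_const (z.1 2))
    have e : (Pi.single 0 (z.1 0) : Fin 3 → ℂ) = ![z.1 0, 0, 0] := by
      ext j
      fin_cases j <;> simp
    rw [e]
    refine (tendsto_vec (tendsto_const_nhds (x := z.1 0)) (tendsto_const_nhds (x := 0))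
      (h := fun t => ((Real.exp t : ℝ) : ℂ) * (((Real.exp t : ℝ) : ℂ) * z.1 2))
      (by simpa using hA)).congr fun t => ?_
    ext j
    fin_cases j
    · simp [← mul_assoc, ← Complex.exp_add]
    · simp
    · simp
  · intro _ hx
    exact absurd hz ((mk_mem_affineSet 1 z).1 hx)
  · intro hx
    rw [mk_mem_affineSet] at hx
    refine tendsto_vertex (fun t => hne (-t)) hx ?_
    have hA := tendsto_ofReal_exp_neg_atTop.mul
      (tendsto_ofReal_exp_neg_atTop.mul_const (z.1 0))
    have e : (Pi.single 2 (z.1 2) : Fin 3 → ℂ) = ![0, 0, z.1 2] := by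
      ext j
      fin_cases j <;> simp
    rw [e]
    refine (tendsto_vec
      (f := fun t => ((Real.exp (-t) : ℝ) : ℂ) * (((Real.exp (-t) : ℝ) : ℂ) * z.1 0))
      (by simpa using hA)
      (tendsto_const_nhds (x := 0)) (tendsto_const_nhds (x := z.1 2))).congr fun t => ?_
    ext j
    fin_cases j
    · simp
    · simp
    · simp [← mul_assoc, ← Complex.exp_add]
  · intro _ hx
    exact absurd hz ((mk_mem_affineSet 1 z).1 hx)

/-- There is a flow line with the expected limits through every point. -/
theorem exists_flowLine (x : CP2) : ∃ γ : ℝ → CP2, MorseFlow.IsFlowLine metric morse γ ∧ γ 0 = x ∧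
    HasExpectedLimits x γ := by
  by_cases hx : x ∈ affineSet 1
  · rw [← mk_homog_affine 1 x hx]
    exact exists_flowLine_of_mem
  · rw [← mk_rep x] at hx ⊢
    exact exists_flowLine_of_notMem (not_not.1 fun h => hx ((mk_mem_affineSet 1 _).2 h))

/-! ### Transversality -/

/-- A flow line that tends to a vertex stays in the affine chart around that vertex. -/
theorem mem_affineSet_of_tendsto {γ : ℝ → CP2} (hγ : MorseFlow.IsFlowLine metric morse γ)
    {l : Filter ℝ} [l.NeBot] {i : Fin 3} (h : Tendsto γ l (𝓝 (vertex i))) (t : ℝ) :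
    γ t ∈ affineSet i := by
  obtain ⟨s, hs⟩ := (h.eventually ((isOpen_affineSet i).mem_nhds
    ((vertex_mem_affineSet_iff i i).2 rfl))).exists
  exact mem_affineSet_of_flowLine hγ hs t

theorem descending_vertex_zero :
    MorseFlow.descending metric morse (vertex 0) = affineSet 0 := by
  ext x
  constructor
  · rintro ⟨γ, hγ, rfl, h⟩
    exact mem_affineSet_of_tendsto hγ h 0
  · intro hx
    obtain ⟨γ, hγ, h0, h⟩ := exists_flowLine x
    exact ⟨γ, hγ, h0, h.1 hx⟩

theorem ascending_vertex_two :
    MorseFlow.ascending metric morse (vertex 2) = affineSet 2 := by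
  ext x
  constructor
  · rintro ⟨γ, hγ, rfl, h⟩
    exact mem_affineSet_of_tendsto hγ h 0
  · intro hx
    obtain ⟨γ, hγ, h0, h⟩ := exists_flowLine x
    exact ⟨γ, hγ, h0, h.2.2.1 hx⟩

theorem totalSpace_eq_of_eq {γ : ℝ → CP2} {x : CP2} {v : Fin 2 → ℂ} (h0 : γ 0 = x)
    (hv : (mfderiv 𝓘(ℝ, ℝ) 𝓘(ℝ, Fin 2 → ℂ) γ 0 (1 : ℝ) : Fin 2 → ℂ) = v) :
    (⟨γ 0, mfderiv 𝓘(ℝ, ℝ) 𝓘(ℝ, Fin 2 → ℂ) γ 0 (1 : ℝ)⟩ :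
      TangentBundle 𝓘(ℝ, Fin 2 → ℂ) CP2) = ⟨x, v⟩ := by
  subst h0
  subst hv
  rfl

/-- A vector is tangent to `S` if `S` contains a segment in its direction in the preferred chart. -/
theorem isTangentTo_of_line {S : Set CP2} {x : CP2} {v : Fin 2 → ℂ}
    (h : ∀ᶠ t : ℝ in 𝓝 0, mk (homog (idx x) (affine (idx x) x + t • v)) ∈ S) :
    MorseFlow.IsTangentTo (Fin 2 → ℂ) S x v := by
  have hl : ∀ t : ℝ, HasDerivAt (fun t : ℝ => affine (idx x) x + t • v) v t := fun t => by
    simpa using ((hasDerivAt_id t).smul_const v).const_add (affine (idx x) x)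
  have h0 : mk (homog (idx x) (affine (idx x) x + (0 : ℝ) • v)) = x := by
    rw [zero_smul, add_zero]
    exact mk_rep x
  refine ⟨fun t => mk (homog (idx x) (affine (idx x) x + t • v)), ?_, h, totalSpace_eq_of_eq
    (γ := fun t : ℝ => mk (homog (idx x) (affine (idx x) x + t • v))) (v := v) h0 ?_⟩
  · refine ((contMDiff_mk_homog (idx x) le_rfl).comp (ContDiff.contMDiff ?_)).contMDiffAt
    exact contDiff_const.add (contDiff_id.smul contDiff_const)
  · have hd :=
      (hasFDerivAt_homog (idx x) (affine (idx x) x + (0 : ℝ) • v)).comp_hasDerivAt 0 (hl 0)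
    have hm := hasMFDerivAt_mk (Z := fun t : ℝ => homog (idx x) (affine (idx x) x + t • v)) hd
    refine (congrArg (fun T : ℝ →L[ℝ] (Fin 2 → ℂ) => T 1) hm.mfderiv).trans ?_
    change (1 : ℝ) • dRatio (idx (mk (homog (idx x) (affine (idx x) x + (0 : ℝ) • v))))
      (homog (idx x) (affine (idx x) x + (0 : ℝ) • v)).1 (lift (idx x) v) = v
    rw [one_smul, h0, dRatio_homog_lift]

theorem isTangentTo_of_mem_nhds {S : Set CP2} {x : CP2} (h : S ∈ 𝓝 x) (v : Fin 2 → ℂ) :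
    MorseFlow.IsTangentTo (Fin 2 → ℂ) S x v := by
  refine isTangentTo_of_line ?_
  have hc : Continuous fun t : ℝ => mk (homog (idx x) (affine (idx x) x + t • v)) :=
    continuous_mk.comp ((continuous_homog _).comp (by fun_prop))
  refine hc.continuousAt.eventually_mem ?_
  convert h
  rw [zero_smul, add_zero]
  exact mk_rep x

theorem isTangentTo_zero {S : Set CP2} {x : CP2} (h : x ∈ S) :
    MorseFlow.IsTangentTo (Fin 2 → ℂ) S x (0 : Fin 2 → ℂ) := by
  refine isTangentTo_of_line (Eventually.of_forall fun t => ?_)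
  rw [smul_zero, add_zero]
  exact (mk_rep x).symm ▸ h

theorem idx_vertex (i : Fin 3) : idx (vertex i) = i :=
  (vertex_mem_affineSet_iff i _).1 (mem_affineSet_idx _)

theorem affine_vertex (i : Fin 3) : affine i (vertex i) = 0 := by
  rw [vertex, affine_mk]
  ext j
  simp

theorem mem_descending_vertex_one {w : ℂ} :
    mk (homog 1 ![0, w]) ∈ MorseFlow.descending metric morse (vertex 1) := by
  obtain ⟨γ, hγ, h0, h⟩ := exists_flowLine (mk (homog 1 ![0, w]))
  refine ⟨γ, hγ, h0, h.2.1 ?_ ?_⟩ <;> rw [mk_mem_affineSet, homog_one] <;> simp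

theorem mem_ascending_vertex_one {w : ℂ} :
    mk (homog 1 ![w, 0]) ∈ MorseFlow.ascending metric morse (vertex 1) := by
  obtain ⟨γ, hγ, h0, h⟩ := exists_flowLine (mk (homog 1 ![w, 0]))
  refine ⟨γ, hγ, h0, h.2.2.2 ?_ ?_⟩ <;> rw [mk_mem_affineSet, homog_one] <;> simp

theorem morse_le_of_mem_descending {p x : CP2} (h : x ∈ MorseFlow.descending metric morse p) :
    morse x ≤ morse p := by
  obtain ⟨γ, hγ, rfl, h⟩ := h
  exact morse_le_of_tendsto_atBot hγ h 0

theorem le_morse_of_mem_ascending {q x : CP2} (h : x ∈ MorseFlow.ascending metric morse q) :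
    morse q ≤ morse x := by
  obtain ⟨γ, hγ, rfl, h⟩ := h
  exact le_morse_of_tendsto_atTop hγ h 0

theorem eq_vertex_of_mem_descending {i : Fin 3} {x : CP2}
    (h : x ∈ MorseFlow.descending metric morse (vertex i)) (hx : morse (vertex i) ≤ morse x) :
    x = vertex i := by
  obtain ⟨γ, hγ, rfl, h⟩ := h
  rcases flowLine_const_or_strictAnti hγ with ⟨j, hj⟩ | ha
  · have h1 := (continuous_morse.tendsto _).comp h
    simp only [Function.comp_def, hj] at h1
    rw [hj]
    exact congrArg vertex (morse_vertex_injective (tendsto_nhds_unique tendsto_const_nhds h1))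
  · have h1 := morse_le_of_tendsto_atBot hγ h (-1)
    have h2 : morse (γ 0) < morse (γ (-1)) := ha (by norm_num)
    linarith

/-- The descending manifold of the maximum and the ascending manifold of the minimum are open. What
remains is the intersection of the two manifolds of the saddle point, at the saddle point itself. -/
theorem satisfiesTransversality : MorseFlow.SatisfiesTransversality metric morse := by
  intro p q hp hq x hx v
  obtain ⟨i, rfl⟩ := (isCritical_iff p).1 hp
  obtain ⟨j, rfl⟩ := (isCritical_iff q).1 hq
  by_cases hi : i = 0
  · subst hi
    refine ⟨v, (0 : Fin 2 → ℂ), isTangentTo_of_mem_nhds ?_ v, isTangentTo_zero hx.2,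
      (add_zero (v : Fin 2 → ℂ)).symm⟩
    rw [descending_vertex_zero] at hx ⊢
    exact (isOpen_affineSet 0).mem_nhds hx.1
  by_cases hj : j = 2
  · subst hj
    refine ⟨(0 : Fin 2 → ℂ), v, isTangentTo_zero hx.1, isTangentTo_of_mem_nhds ?_ v,
      (zero_add (v : Fin 2 → ℂ)).symm⟩
    rw [ascending_vertex_two] at hx ⊢
    exact (isOpen_affineSet 2).mem_nhds hx.2
  have h1 := morse_le_of_mem_descending hx.1
  have h2 := le_morse_of_mem_ascending hx.2
  have hij : i = 1 ∧ j = 1 := by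
    have h3 := h2.trans h1
    rw [morse_vertex, morse_vertex] at h3
    fin_cases i <;> fin_cases j <;> simp at * <;> linarith
  obtain ⟨rfl, rfl⟩ := hij
  obtain rfl := eq_vertex_of_mem_descending hx.1 h2
  have hvec : ∀ v : Fin 2 → ℂ, v = ![v 0, 0] + ![0, v 1] := fun v => by
    ext k
    fin_cases k <;> simp
  refine ⟨![0, (v : Fin 2 → ℂ) 1], ![(v : Fin 2 → ℂ) 0, 0],
    isTangentTo_of_line (Eventually.of_forall fun t => ?_),
    isTangentTo_of_line (Eventually.of_forall fun t => ?_), (hvec v).trans (add_comm _ _)⟩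
  · generalize (v : Fin 2 → ℂ) 1 = b
    rw [idx_vertex, affine_vertex, zero_add]
    have : t • ![(0 : ℂ), b] = ![0, t • b] := by
      ext k
      fin_cases k <;> simp
    rw [this]
    exact mem_descending_vertex_one
  · generalize (v : Fin 2 → ℂ) 0 = a
    rw [idx_vertex, affine_vertex, zero_add]
    have : t • ![a, (0 : ℂ)] = ![t • a, 0] := by
      ext k
      fin_cases k <;> simp
    rw [this]
    exact mem_ascending_vertex_one

/-! ### Critical sequences -/

theorem morse_lt_of_above {p q : CP2} (hp : MorseFlow.IsCritical (Fin 2 → ℂ) morse p)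
    (hq : MorseFlow.IsCritical (Fin 2 → ℂ) morse q) (h : MorseFlow.Above metric morse p q) :
    morse q < morse p := by
  obtain ⟨hne, ⟨γ⟩⟩ := h
  obtain ⟨i, rfl⟩ := (isCritical_iff p).1 hp
  obtain ⟨j, rfl⟩ := (isCritical_iff q).1 hq
  have h1 := strictAnti_morse γ fun h => hne (congrArg vertex (morse_vertex_injective h))
  have h2 := morse_le_of_tendsto_atBot γ.isFlowLine γ.tendsto_atBot 0
  have h3 := le_morse_of_tendsto_atTop γ.isFlowLine γ.tendsto_atTop 1
  have h4 := h1 zero_lt_one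
  exact h3.trans_lt (h4.trans_le h2)

theorem above_zero_one : MorseFlow.Above metric morse (vertex 0) (vertex 1) := by
  obtain ⟨γ, hγ, -, h⟩ := exists_flowLine (mk (homog 1 ![1, 0]))
  have h0 : mk (homog 1 ![1, 0]) ∈ affineSet 0 := by rw [mk_mem_affineSet, homog_one]; simp
  have h1 : mk (homog 1 ![1, 0]) ∈ affineSet 1 := by rw [mk_mem_affineSet, homog_one]; simp
  have h2 : mk (homog 1 ![1, 0]) ∉ affineSet 2 := by rw [mk_mem_affineSet, homog_one]; simp
  exact ⟨vertex_injective.ne (by decide), ⟨γ, hγ, h.1 h0, h.2.2.2 h2 h1⟩⟩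

theorem above_one_two : MorseFlow.Above metric morse (vertex 1) (vertex 2) := by
  obtain ⟨γ, hγ, -, h⟩ := exists_flowLine (mk (homog 1 ![0, 1]))
  have h0 : mk (homog 1 ![0, 1]) ∉ affineSet 0 := by rw [mk_mem_affineSet, homog_one]; simp
  have h1 : mk (homog 1 ![0, 1]) ∈ affineSet 1 := by rw [mk_mem_affineSet, homog_one]; simp
  have h2 : mk (homog 1 ![0, 1]) ∈ affineSet 2 := by rw [mk_mem_affineSet, homog_one]; simp
  exact ⟨vertex_injective.ne (by decide), ⟨γ, hγ, h.2.1 h0 h1, h.2.2.1 h2⟩⟩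

theorem above_zero_two : MorseFlow.Above metric morse (vertex 0) (vertex 2) := by
  obtain ⟨γ, hγ, -, h⟩ := exists_flowLine (mk (homog 1 ![1, 1]))
  have h0 : mk (homog 1 ![1, 1]) ∈ affineSet 0 := by rw [mk_mem_affineSet, homog_one]; simp
  have h2 : mk (homog 1 ![1, 1]) ∈ affineSet 2 := by rw [mk_mem_affineSet, homog_one]; simp
  exact ⟨vertex_injective.ne (by decide), ⟨γ, hγ, h.1 h0, h.2.2.1 h2⟩⟩

theorem isCritical_vertex (i : Fin 3) : MorseFlow.IsCritical (Fin 2 → ℂ) morse (vertex i) :=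
  (isCritical_iff _).2 ⟨i, rfl⟩

/-- The critical sequence `(p, q)`. -/
def directSequence : MorseFlow.CriticalSequence metric morse (vertex 0) (vertex 2) where
  length := 0
  point := ![vertex 0, vertex 2]
  isCritical i := by fin_cases i <;> exact isCritical_vertex _
  above i := by
    fin_cases i
    exact above_zero_two
  head := rfl
  tail := rfl

/-- The critical sequence `(p, r, q)`. -/
def brokenSequence : MorseFlow.CriticalSequence metric morse (vertex 0) (vertex 2) where
  length := 1
  point := ![vertex 0, vertex 1, vertex 2]
  isCritical i := by fin_cases i <;> exact isCritical_vertex _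
  above i := by
    fin_cases i
    · exact above_zero_one
    · exact above_one_two
  head := rfl
  tail := rfl

theorem criticalSequence_eq (I : MorseFlow.CriticalSequence metric morse (vertex 0) (vertex 2)) :
    I = directSequence ∨ I = brokenSequence := by
  obtain ⟨k, pt, hc, ha, hh, ht⟩ := I
  choose ν hν using fun i => (isCritical_iff (pt i)).1 (hc i)
  have hlt : ∀ i : Fin (k + 1), ν i.castSucc < ν i.succ := by
    intro i
    have := morse_lt_of_above (hc _) (hc _) (ha i)
    rw [hν i.castSucc, hν i.succ, morse_vertex, morse_vertex] at this
    generalize ν i.castSucc = a at *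
    generalize ν i.succ = b at *
    fin_cases a <;> fin_cases b <;> simp at * <;> linarith
  have hmono : StrictMono ν := Fin.strictMono_iff_lt_succ.2 hlt
  have h0 : ν 0 = 0 := vertex_injective ((hν 0).symm.trans hh)
  have h2 : ν (Fin.last _) = 2 := vertex_injective ((hν _).symm.trans ht)
  have hk : k + 2 ≤ 3 := by
    simpa using Fintype.card_le_of_injective ν hmono.injective
  obtain rfl | rfl : k = 0 ∨ k = 1 := by omega
  · left
    have : pt = ![vertex 0, vertex 2] := by
      ext i
      fin_cases i
      · exact hh
      · exact ht
    subst this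
    rfl
  · right
    have h1 : ν 1 = 1 := by
      have a1 : ν 0 < ν 1 := hmono (by decide)
      have a2 : ν 1 < ν (Fin.last _) := hmono (by decide)
      rw [h0] at a1
      rw [h2] at a2
      omega
    have : pt = ![vertex 0, vertex 1, vertex 2] := by
      ext i
      fin_cases i
      · exact hh
      · exact (hν 1).trans (congrArg vertex h1)
      · exact ht
    subst this
    rfl

theorem range_criticalSequence : Set.range (fun s : MorseFlow.CriticalSequence metric morse
    (vertex 0) (vertex 2) => List.ofFn s.point) =
      {[vertex 0, vertex 2], [vertex 0, vertex 1, vertex 2]} := by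
  have hd : List.ofFn directSequence.point = [vertex 0, vertex 2] := rfl
  have hb : List.ofFn brokenSequence.point = [vertex 0, vertex 1, vertex 2] := rfl
  ext l
  constructor
  · rintro ⟨I, rfl⟩
    rcases criticalSequence_eq I with rfl | rfl
    · exact Or.inl hd
    · exact Or.inr hb
  · rintro (rfl | rfl)
    · exact ⟨directSequence, hd⟩
    · exact ⟨brokenSequence, hb⟩

/-! ### Hessians and indices -/

/-- If `f = c + B(w, w) h(w)` with `h 0 = 1`, then the second derivative of `f` at `0` is `2 B`. -/
theorem fderiv_fderiv_quadratic {E : Type*} [NormedAddCommGroup E] [NormedSpace ℝ E]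
    (B : E →L[ℝ] E →L[ℝ] ℝ) (hB : ∀ u v, B u v = B v u) {h : E → ℝ} (hh : ContDiff ℝ 2 h)
    (h0 : h 0 = 1) (c : ℝ) (u v : E) :
    fderiv ℝ (fderiv ℝ fun w => c + B w w * h w) 0 u v = 2 * B u v := by
  have hq : ∀ w, HasFDerivAt (fun w => B w w) (2 • B w) w := fun w => by
    refine (B.hasFDerivAt.clm_apply (hasFDerivAt_id w)).congr_fderiv ?_
    ext1 v
    simp [hB v w]
    ring
  have hd : ∀ w, HasFDerivAt h (fderiv ℝ h w) w := fun w =>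
    (hh.differentiable (by norm_num) w).hasFDerivAt
  have h1 : (fderiv ℝ fun w => c + B w w * h w) =
      fun w => B w w • fderiv ℝ h w + h w • (2 • B w) := by
    funext w
    exact (((hq w).mul (hd w)).const_add c).fderiv
  have h2 : HasFDerivAt (fderiv ℝ h) (fderiv ℝ (fderiv ℝ h) 0) 0 :=
    ((hh.fderiv_right (m := 1) (by norm_num)).differentiable (by norm_num) 0).hasFDerivAt
  have h3 : HasFDerivAt (fun w => (2 • B w : E →L[ℝ] ℝ)) (2 • B) (0 : E) := (2 • B).hasFDerivAt
  have h4 := ((hq 0).smul h2).add ((hd 0).smul h3)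
  rw [h1]
  refine (congrArg (fun T : E →L[ℝ] E →L[ℝ] ℝ => T u v) h4.fderiv).trans ?_
  simp [h0]

/-- The weighted sum `∑ dⱼ Re (uⱼ v̄ⱼ)`. -/
def weightedInner (d : Fin 2 → ℝ) : (Fin 2 → ℂ) →L[ℝ] (Fin 2 → ℂ) →L[ℝ] ℝ :=
  ∑ j : Fin 2, d j •
    ((Complex.reCLM.comp (ContinuousLinearMap.proj j)).smulRight
        (Complex.reCLM.comp (ContinuousLinearMap.proj j : (Fin 2 → ℂ) →L[ℝ] ℂ)) +
      (Complex.imCLM.comp (ContinuousLinearMap.proj j)).smulRight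
        (Complex.imCLM.comp (ContinuousLinearMap.proj j : (Fin 2 → ℂ) →L[ℝ] ℂ)))

theorem weightedInner_apply (d : Fin 2 → ℝ) (u v : Fin 2 → ℂ) : weightedInner d u v =
    ∑ j, d j * ((u j).re * (v j).re + (u j).im * (v j).im) := by
  simp [weightedInner]
  ring

theorem weightedInner_comm (d : Fin 2 → ℝ) (u v : Fin 2 → ℂ) :
    weightedInner d u v = weightedInner d v u := by
  simp only [weightedInner_apply, mul_comm]

/-- The differences of the eigenvalues of `weight`, which are half the Hessian eigenvalues at the
vertex `i`. -/
def hessianWeight (i : Fin 3) (j : Fin 2) : ℝ :=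
  (![1, 0, -1] : Fin 3 → ℝ) (i.succAbove j) - (![1, 0, -1] : Fin 3 → ℝ) i

theorem hessianWeight_ne_zero (i : Fin 3) (j : Fin 2) : hessianWeight i j ≠ 0 := by
  fin_cases i <;> fin_cases j <;> simp [hessianWeight, Fin.succAbove]
  norm_num

theorem height_homog (i : Fin 3) (w : Fin 2 → ℂ) : height (homog i w).1 =
    (![1, 0, -1] : Fin 3 → ℝ) i + weightedInner (hessianWeight i) w w *
      (reInner (homog i w).1 (homog i w).1)⁻¹ := by
  have hN := (reInner_self_pos (homog i w).2).ne'
  rw [height, div_eq_iff hN, add_mul, inv_mul_cancel_right₀ hN, reInner_self, reInner_apply,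
    weightedInner_apply, Fin.sum_univ_three, Fin.sum_univ_two]
  have h2 := homog_apply_succAbove i w
  generalize (homog i w).1 = z at *
  simp only [← h2]
  fin_cases i <;> simp [hessianWeight, Fin.succAbove, weight, Complex.normSq_apply] <;> ring

theorem hessian_vertex (i : Fin 3) (u v : Fin 2 → ℂ) :
    MorseFlow.hessian (Fin 2 → ℂ) morse (vertex i) u v =
      2 * weightedInner (hessianWeight i) u v := by
  have e : morse ∘ (extChartAt 𝓘(ℝ, Fin 2 → ℂ) (vertex i)).symm = fun w =>
      (![1, 0, -1] : Fin 3 → ℝ) i + weightedInner (hessianWeight i) w w *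
        (reInner (homog i w).1 (homog i w).1)⁻¹ := by
    funext w
    rw [← height_homog, Function.comp_apply, extChartAt_symm_apply, idx_vertex, morse_mk]
  have hh : ContDiff ℝ 2 fun w => (reInner (homog i w).1 (homog i w).1)⁻¹ :=
    (((reInner.contDiff.comp (contDiff_homog i)).clm_apply (contDiff_homog i)).inv
      fun w => (reInner_self_pos (homog i w).2).ne').of_le (WithTop.coe_le_coe.2 le_top)
  have h0 : (reInner (homog i 0).1 (homog i 0).1)⁻¹ = 1 := by
    have h1 := homog_apply_same i 0
    have h2 := homog_apply_succAbove i 0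
    rw [inv_eq_one, reInner_self]
    generalize (homog i 0).1 = z at *
    fin_cases i <;> simp [Fin.forall_fin_two, Fin.succAbove] at * <;> simp [h1, h2]
  have hc : extChartAt 𝓘(ℝ, Fin 2 → ℂ) (vertex i) (vertex i) = 0 := by
    rw [extChartAt_apply, idx_vertex, affine_vertex]
  have h := fderiv_fderiv_quadratic (weightedInner (hessianWeight i)) (weightedInner_comm _) hh h0
    ((![1, 0, -1] : Fin 3 → ℝ) i) u v
  rw [← h, ← e, ← hc]
  rfl

theorem isMorse_morse : MorseFlow.IsMorse (Fin 2 → ℂ) morse := by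
  refine ⟨contMDiff_morse, fun p hp => ?_⟩
  obtain ⟨i, rfl⟩ := (isCritical_iff p).1 hp
  have key : ∀ u : Fin 2 → ℂ, (∀ v, weightedInner (hessianWeight i) u v = 0) → u = 0 := by
    intro u hu
    ext j
    have h := hu (Pi.single j (u j))
    rw [weightedInner_apply, Finset.sum_eq_single j (by simp +contextual) (by simp)] at h
    have h' := (mul_eq_zero.1 h).resolve_left (hessianWeight_ne_zero i j)
    simp only [Pi.single_eq_same, ← Complex.normSq_apply] at h'
    simpa using h'
  constructor
  · intro u hu
    exact key u fun v => by simpa [hessian_vertex] using hu v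
  · intro u hu
    exact key u fun v => by simpa [hessian_vertex, weightedInner_comm _ u v] using hu v

/-- Real and imaginary parts as real coordinates on `ℂ²`. -/
def realCoords : (Fin 2 → ℂ) ≃ₗ[ℝ] (Fin 2 × Bool → ℝ) where
  toFun v k := if k.2 then (v k.1).re else (v k.1).im
  invFun x j := ⟨x (j, true), x (j, false)⟩
  map_add' u v := by
    ext ⟨j, b⟩
    cases b <;> simp
  map_smul' c v := by
    ext ⟨j, b⟩
    cases b <;> simp
  left_inv v := by
    ext j
    simp
  right_inv x := by
    ext ⟨j, b⟩
    cases b <;> simp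

theorem index_vertex (i : Fin 3) : MorseFlow.index (Fin 2 → ℂ) morse (vertex i) =
    {k : Fin 2 × Bool | 2 * hessianWeight i k.1 < 0}.ncard := by
  refine QuadraticForm.sigNeg_of_equiv_weightedSumSquares
    ⟨{ realCoords with map_app' := fun v => ?_ }⟩
  change QuadraticMap.weightedSumSquares ℝ (fun k : Fin 2 × Bool => 2 * hessianWeight i k.1)
    (realCoords v) = MorseFlow.hessian (Fin 2 → ℂ) morse (vertex i) v v
  rw [hessian_vertex, weightedInner_apply, QuadraticMap.weightedSumSquares_apply,
    Fintype.sum_prod_type]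
  simp [realCoords]
  ring

theorem index_vertex_eq (i : Fin 3) :
    MorseFlow.index (Fin 2 → ℂ) morse (vertex i) = ![4, 2, 0] i := by
  rw [index_vertex, Set.ncard_eq_toFinset_card', Set.toFinset_ofPred]
  have h : ∀ k : Fin 2 × Bool, 2 * hessianWeight i k.1 < 0 ↔
      (![![true, true], ![false, true], ![false, false]] : Fin 3 → Fin 2 → Bool) i k.1 = true := by
    rintro ⟨j, b⟩
    fin_cases i <;> fin_cases j <;> simp [hessianWeight, Fin.succAbove]
    norm_num
  simp only [h]
  clear h
  revert i
  decide

/-! ### The evaluation map -/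

theorem morse_flowLine_mem_Ioo {p q : CP2} (γ : MorseFlow.FlowLine metric morse p q)
    (h : morse p ≠ morse q) (t : ℝ) : morse (γ.toFun t) ∈ Set.Ioo (morse q) (morse p) :=
  ⟨(le_morse_of_tendsto_atTop γ.isFlowLine γ.tendsto_atTop (t + 1)).trans_lt
      (strictAnti_morse γ h (lt_add_one t)),
    (strictAnti_morse γ h (sub_one_lt t)).trans_le
      (morse_le_of_tendsto_atBot γ.isFlowLine γ.tendsto_atBot (t - 1))⟩

theorem exists_morse_flowLine_eq {p q : CP2} (γ : MorseFlow.FlowLine metric morse p q) {a : ℝ}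
    (ha : a ∈ Set.Ioo (morse q) (morse p)) : ∃ t, morse (γ.toFun t) = a := by
  have h0 : Tendsto _ _ _ := (continuous_morse.tendsto _).comp γ.tendsto_atBot
  have h1 : Tendsto _ _ _ := (continuous_morse.tendsto _).comp γ.tendsto_atTop
  obtain ⟨s, hs⟩ := (h0.eventually (lt_mem_nhds ha.2)).exists
  obtain ⟨t, ht⟩ := (h1.eventually (gt_mem_nhds ha.1)).exists
  have hc : Continuous fun t => morse (γ.toFun t) :=
    continuous_iff_continuousAt.2 fun t => (hasDerivAt_morse γ.isFlowLine t).continuousAt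
  exact mem_range_of_exists_le_of_exists_ge hc ⟨t, ht.le⟩ ⟨s, hs.le⟩

/-- A flow line meets each level between those of its end points exactly once. -/
theorem range_inter_preimage {p q : CP2} (γ : MorseFlow.FlowLine metric morse p q)
    (h : morse p ≠ morse q) (t : ℝ) :
    Set.range γ.toFun ∩ morse ⁻¹' {morse (γ.toFun t)} = {γ.toFun t} := by
  ext x
  constructor
  · rintro ⟨⟨s, rfl⟩, hs⟩
    rw [(strictAnti_morse γ h).injective hs]
    rfl
  · rintro rfl
    exact ⟨⟨t, rfl⟩, rfl⟩

theorem range_inter_preimage_eq_empty {p q : CP2} (γ : MorseFlow.FlowLine metric morse p q)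
    (h : morse p ≠ morse q) {a : ℝ} (ha : a ∉ Set.Ioo (morse q) (morse p)) :
    Set.range γ.toFun ∩ morse ⁻¹' {a} = ∅ := by
  rw [Set.eq_empty_iff_forall_notMem]
  rintro x ⟨⟨s, rfl⟩, hs⟩
  exact ha (hs ▸ morse_flowLine_mem_Ioo γ h s)

/-- The pair of intersection points of `α` with two levels, as a relation. -/
def MeetsAt (a₀ a₁ : ℝ) (α : MorseFlow.CompactifiedModuli metric morse (vertex 0) (vertex 2))
    (P : CP2 × CP2) : Prop :=
  α.points ∩ morse ⁻¹' {a₀} = {P.1} ∧ α.points ∩ morse ⁻¹' {a₁} = {P.2}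

/-- The compactified moduli space consists of unbroken and once broken flow lines. -/
theorem points_eq (α : MorseFlow.CompactifiedModuli metric morse (vertex 0) (vertex 2)) :
    (∃ γ : MorseFlow.FlowLine metric morse (vertex 0) (vertex 2),
      α.points = Set.range γ.toFun) ∨
    ∃ (γ : MorseFlow.FlowLine metric morse (vertex 0) (vertex 1))
      (δ : MorseFlow.FlowLine metric morse (vertex 1) (vertex 2)),
      α.points = Set.range γ.toFun ∪ Set.range δ.toFun := by
  obtain ⟨I, m⟩ := α
  rcases criticalSequence_eq I with rfl | rfl
  · left
    obtain ⟨γ, hγ⟩ := Quotient.exists_rep (m (0 : Fin 1))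
    refine ⟨γ, ?_⟩
    have h1 : (m (0 : Fin 1)).points = Set.range γ.toFun := by
      rw [← hγ]
      rfl
    rw [← h1]
    ext x
    exact Set.mem_iUnion.trans (Fin.exists_fin_one (p := fun i => x ∈ (m i).points))
  · right
    obtain ⟨γ, hγ⟩ := Quotient.exists_rep (m (0 : Fin 2))
    obtain ⟨δ, hδ⟩ := Quotient.exists_rep (m (1 : Fin 2))
    refine ⟨γ, δ, ?_⟩
    have h1 : (m (0 : Fin 2)).points = Set.range γ.toFun := by
      rw [← hγ]
      rfl
    have h2 : (m (1 : Fin 2)).points = Set.range δ.toFun := by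
      rw [← hδ]
      rfl
    rw [← h1, ← h2]
    ext x
    exact Set.mem_iUnion.trans (Fin.exists_fin_two (p := fun i => x ∈ (m i).points))

theorem exists_points_eq_range (γ : MorseFlow.FlowLine metric morse (vertex 0) (vertex 2)) :
    ∃ α : MorseFlow.CompactifiedModuli metric morse (vertex 0) (vertex 2),
      α.points = Set.range γ.toFun := by
  let m : ∀ i : Fin 1, MorseFlow.Moduli metric morse (directSequence.point i.castSucc)
    (directSequence.point i.succ) := Fin.cons (Quotient.mk _ γ) finZeroElim
  refine ⟨⟨directSequence, m⟩, ?_⟩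
  ext x
  exact Set.mem_iUnion.trans (Fin.exists_fin_one (p := fun i => x ∈ (m i).points))

theorem exists_points_eq_union (γ : MorseFlow.FlowLine metric morse (vertex 0) (vertex 1))
    (δ : MorseFlow.FlowLine metric morse (vertex 1) (vertex 2)) :
    ∃ α : MorseFlow.CompactifiedModuli metric morse (vertex 0) (vertex 2),
      α.points = Set.range γ.toFun ∪ Set.range δ.toFun := by
  let m : ∀ i : Fin 2, MorseFlow.Moduli metric morse (brokenSequence.point i.castSucc)
    (brokenSequence.point i.succ) :=
      Fin.cons (Quotient.mk _ γ) (Fin.cons (Quotient.mk _ δ) finZeroElim)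
  refine ⟨⟨brokenSequence, m⟩, ?_⟩
  ext x
  exact Set.mem_iUnion.trans (Fin.exists_fin_two (p := fun i => x ∈ (m i).points))

theorem meetsAt_of_points_eq_range {α : MorseFlow.CompactifiedModuli metric morse (vertex 0)
    (vertex 2)} {γ : MorseFlow.FlowLine metric morse (vertex 0) (vertex 2)}
    (h : α.points = Set.range γ.toFun) (s t : ℝ) :
    MeetsAt (morse (γ.toFun s)) (morse (γ.toFun t)) α (γ.toFun s, γ.toFun t) := by
  have h02 : morse (vertex 0) ≠ morse (vertex 2) := morse_vertex_injective.ne (by decide)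
  unfold MeetsAt
  rw [h]
  exact ⟨range_inter_preimage γ h02 s, range_inter_preimage γ h02 t⟩

theorem meetsAt_of_points_eq_union {α : MorseFlow.CompactifiedModuli metric morse (vertex 0)
    (vertex 2)} {γ : MorseFlow.FlowLine metric morse (vertex 0) (vertex 1)}
    {δ : MorseFlow.FlowLine metric morse (vertex 1) (vertex 2)}
    (h : α.points = Set.range γ.toFun ∪ Set.range δ.toFun) (s t : ℝ) :
    MeetsAt (morse (γ.toFun s)) (morse (δ.toFun t)) α (γ.toFun s, δ.toFun t) := by
  have h01 : morse (vertex 0) ≠ morse (vertex 1) := morse_vertex_injective.ne (by decide)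
  have h12 : morse (vertex 1) ≠ morse (vertex 2) := morse_vertex_injective.ne (by decide)
  unfold MeetsAt
  rw [h, Set.union_inter_distrib_right, Set.union_inter_distrib_right,
    range_inter_preimage γ h01, range_inter_preimage δ h12,
    range_inter_preimage_eq_empty δ h12 fun hs =>
      lt_asymm hs.2 (morse_flowLine_mem_Ioo γ h01 s).1,
    range_inter_preimage_eq_empty γ h01 fun ht =>
      lt_asymm ht.1 (morse_flowLine_mem_Ioo δ h12 t).2, Set.union_empty, Set.empty_union]
  exact ⟨rfl, rfl⟩

theorem morse_vertex_zero : morse (vertex 0) = 1 := morse_vertex 0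
theorem morse_vertex_one : morse (vertex 1) = 0 := morse_vertex 1
theorem morse_vertex_two : morse (vertex 2) = -1 := morse_vertex 2

theorem exists_meetsAt {a₀ a₁ : ℝ} (h₀ : a₀ ∈ Set.Ioo (0 : ℝ) 1) (h₁ : a₁ ∈ Set.Ioo (-1 : ℝ) 0)
    (α : MorseFlow.CompactifiedModuli metric morse (vertex 0) (vertex 2)) :
    ∃ P, MeetsAt a₀ a₁ α P ∧ morse P.1 = a₀ ∧ morse P.2 = a₁ := by
  rcases points_eq α with ⟨γ, hα⟩ | ⟨γ, δ, hα⟩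
  · obtain ⟨s, rfl⟩ := exists_morse_flowLine_eq γ (a := a₀)
      (by rw [morse_vertex_zero, morse_vertex_two]; exact ⟨by linarith [h₀.1], h₀.2⟩)
    obtain ⟨t, rfl⟩ := exists_morse_flowLine_eq γ (a := a₁)
      (by rw [morse_vertex_zero, morse_vertex_two]; exact ⟨h₁.1, by linarith [h₁.2]⟩)
    exact ⟨_, meetsAt_of_points_eq_range hα s t, rfl, rfl⟩
  · obtain ⟨s, rfl⟩ := exists_morse_flowLine_eq γ (a := a₀)
      (by rw [morse_vertex_zero, morse_vertex_one]; exact h₀)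
    obtain ⟨t, rfl⟩ := exists_morse_flowLine_eq δ (a := a₁)
      (by rw [morse_vertex_one, morse_vertex_two]; exact h₁)
    exact ⟨_, meetsAt_of_points_eq_union hα s t, rfl, rfl⟩

/-- The image of the evaluation map, as the set of pairs of intersection points; that these are
unique is `exists_meetsAt`. -/
def evalImage (a₀ a₁ : ℝ) : Set (CP2 × CP2) := {P | ∃ α, MeetsAt a₀ a₁ α P}

theorem exists_isEvaluationMap {a₀ a₁ : ℝ} (h₀ : a₀ ∈ Set.Ioo (0 : ℝ) 1)
    (h₁ : a₁ ∈ Set.Ioo (-1 : ℝ) 0) :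
    ∃ ev : MorseFlow.CompactifiedModuli metric morse (vertex 0) (vertex 2) →
      (morse ⁻¹' {a₀}) × (morse ⁻¹' {a₁}),
      MorseFlow.IsEvaluationMap metric morse (vertex 0) (vertex 2) a₀ a₁ ev ∧
      (Set.range fun α => (((ev α).1 : CP2), ((ev α).2 : CP2))) = evalImage a₀ a₁ := by
  choose P hP hP₀ hP₁ using exists_meetsAt h₀ h₁
  refine ⟨fun α => (⟨(P α).1, hP₀ α⟩, ⟨(P α).2, hP₁ α⟩), hP, ?_⟩
  ext Q
  constructor
  · rintro ⟨α, rfl⟩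
    exact ⟨α, hP α⟩
  · rintro ⟨α, hα⟩
    exact ⟨α, Prod.ext (Set.singleton_injective ((hP α).1.symm.trans hα.1))
      (Set.singleton_injective ((hP α).2.symm.trans hα.2))⟩

/-- The points of the image of the evaluation map come from unbroken or once broken flow lines. -/
theorem evalImage_cases {a₀ a₁ : ℝ} (h₀ : a₀ ∈ Set.Ioo (0 : ℝ) 1) (h₁ : a₁ ∈ Set.Ioo (-1 : ℝ) 0)
    {P : CP2 × CP2} (hP : P ∈ evalImage a₀ a₁) : morse P.1 = a₀ ∧ morse P.2 = a₁ ∧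
    ((∃ (γ : MorseFlow.FlowLine metric morse (vertex 0) (vertex 2)) (s t : ℝ),
      P = (γ.toFun s, γ.toFun t)) ∨
    ∃ (γ : MorseFlow.FlowLine metric morse (vertex 0) (vertex 1))
      (δ : MorseFlow.FlowLine metric morse (vertex 1) (vertex 2)) (s t : ℝ),
      P = (γ.toFun s, δ.toFun t)) := by
  obtain ⟨α, hα⟩ := hP
  have e1 : P.1 ∈ α.points ∩ morse ⁻¹' {a₀} := hα.1 ▸ rfl
  have e2 : P.2 ∈ α.points ∩ morse ⁻¹' {a₁} := hα.2 ▸ rfl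
  have h01 : morse (vertex 0) ≠ morse (vertex 1) := morse_vertex_injective.ne (by decide)
  have h12 : morse (vertex 1) ≠ morse (vertex 2) := morse_vertex_injective.ne (by decide)
  refine ⟨e1.2, e2.2, ?_⟩
  rcases points_eq α with ⟨γ, hγ⟩ | ⟨γ, δ, hα⟩
  · rw [hγ] at e1 e2
    obtain ⟨⟨s, hs⟩, -⟩ := e1
    obtain ⟨⟨t, ht⟩, -⟩ := e2
    exact Or.inl ⟨γ, s, t, Prod.ext hs.symm ht.symm⟩
  · rw [hα] at e1 e2
    right
    rcases e1 with ⟨⟨s, hs⟩ | ⟨s, hs⟩, e1⟩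
    · rcases e2 with ⟨⟨t, ht⟩ | ⟨t, ht⟩, e2⟩
      · have := (morse_flowLine_mem_Ioo γ h01 t).1
        rw [ht, morse_vertex_one, e2] at this
        exact absurd this h₁.2.not_gt
      · exact ⟨γ, δ, s, t, Prod.ext hs.symm ht.symm⟩
    · have := (morse_flowLine_mem_Ioo δ h12 s).2
      rw [hs, morse_vertex_one, e1] at this
      exact absurd this h₀.1.not_gt

/-! ### Flow lines in the chart at the saddle point -/

theorem hasDerivAt_affine {γ : ℝ → CP2} (hγ : MorseFlow.IsFlowLine metric morse γ) {t : ℝ}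
    (h : γ t ∈ affineSet 1) : HasDerivAt (fun t => affine 1 (γ t))
      ![-affine 1 (γ t) 0, affine 1 (γ t) 1 -
        ((rate (affine 1 (γ t)) * (affine 1 (γ t) 1).re : ℝ) : ℂ)] t := by
  obtain ⟨c, hc, hr⟩ := exists_smul_eq_rep (homog 1 (affine 1 (γ t)))
  rw [mk_homog_affine 1 _ h] at hr
  have h1 : (rep (γ t)).1 1 ≠ 0 := by
    rw [hr]
    simpa [homog_one] using hc
  have h2 := hasDerivAt_comp_flowLine hγ (affine_mk' 1) (hasFDerivAt_ratio h1)
  rw [hr, dRatio_field hc] at h2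
  refine h2.congr_deriv ?_
  generalize affine 1 (γ t) = w
  rw [field_eq, fubiniStudy_rate]
  ext j
  rw [dRatio_apply, homog_one]
  fin_cases j
  · simp
  · simp
    ring

/-- Every flow line in the chart at the saddle point is one of the explicit curves `flowCoord`. -/
theorem exists_eq_flowCoord {γ : ℝ → CP2} (hγ : MorseFlow.IsFlowLine metric morse γ)
    (h : ∀ t, γ t ∈ affineSet 1) : ∃ (u : ℂ) (b : ℝ) (ψ : ℝ → ℝ),
      (∀ t, HasDerivAt ψ (-rate (flowCoord u b t (ψ t)) * ψ t) t) ∧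
      ∀ t, affine 1 (γ t) = flowCoord u b t (ψ t) := by
  have hW0 := fun t => hasDerivAt_pi.1 (hasDerivAt_affine hγ (h t)) 0
  have hW1 := fun t => hasDerivAt_pi.1 (hasDerivAt_affine hγ (h t)) 1
  have hre := fun t => (Complex.reCLM.hasFDerivAt.comp_hasDerivAt t (hW1 t))
  have him := fun t => (Complex.imCLM.hasFDerivAt.comp_hasDerivAt t (hW1 t))
  simp only [Matrix.cons_val_zero, Matrix.cons_val_one, Complex.reCLM_apply, Complex.imCLM_apply,
    Function.comp_def, Complex.sub_re, Complex.sub_im, Complex.ofReal_re, Complex.ofReal_im,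
    sub_zero] at hW0 hre him
  have hu : ∀ t, ((Real.exp t : ℝ) : ℂ) * affine 1 (γ t) 0 =
      ((Real.exp 0 : ℝ) : ℂ) * affine 1 (γ 0) 0 := fun t => by
    have hd := fun t => (hasDerivAt_ofReal_exp t).mul (hW0 t)
    refine is_const_of_deriv_eq_zero (fun t => (hd t).differentiableAt) (fun t => ?_) t 0
    rw [(hd t).deriv]
    ring
  have hb : ∀ t, Real.exp (-t) * (affine 1 (γ t) 1).im =
      Real.exp (-0) * (affine 1 (γ 0) 1).im := fun t => by
    have hd := fun t => (hasDerivAt_exp_neg t).mul (him t)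
    refine is_const_of_deriv_eq_zero (fun t => (hd t).differentiableAt) (fun t => ?_) t 0
    rw [(hd t).deriv]
    ring
  have hexp : ∀ t, Real.exp t * Real.exp (-t) = 1 := fun t => by
    rw [← Real.exp_add, add_neg_cancel, Real.exp_zero]
  have e : ∀ t, affine 1 (γ t) = flowCoord (affine 1 (γ 0) 0) (affine 1 (γ 0) 1).im t
      (Real.exp (-t) * (affine 1 (γ t) 1).re) := fun t => by
    have h1 := hu t
    have h2 := hb t
    have h3 : ((Real.exp t : ℝ) : ℂ) * ((Real.exp (-t) : ℝ) : ℂ) = 1 := by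
      rw [← Complex.ofReal_mul, hexp, Complex.ofReal_one]
    rw [neg_zero, Real.exp_zero, one_mul] at h2
    rw [Real.exp_zero, Complex.ofReal_one, one_mul] at h1
    rw [← h1, ← h2, flowCoord, mul_left_comm, ← mul_assoc, ← mul_assoc, ← mul_assoc, h3, hexp]
    ext j
    fin_cases j
    · simp
    · simp
  refine ⟨_, _, fun t => Real.exp (-t) * (affine 1 (γ t) 1).re, fun t => ?_, e⟩
  rw [← e]
  refine ((hasDerivAt_exp_neg t).mul (hre t)).congr_deriv ?_
  ring

/-- Along a flow line, the first affine coordinate decays exponentially. -/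
theorem affine_zero_eq {γ : ℝ → CP2} (hγ : MorseFlow.IsFlowLine metric morse γ)
    (h : ∀ t, γ t ∈ affineSet 1) (s t : ℝ) :
    affine 1 (γ t) 0 = ((Real.exp (s - t) : ℝ) : ℂ) * affine 1 (γ s) 0 := by
  obtain ⟨u, b, ψ, -, hψ⟩ := exists_eq_flowCoord hγ h
  rw [hψ, hψ]
  simp only [flowCoord, Matrix.cons_val_zero]
  rw [← mul_assoc, ← Complex.ofReal_mul, ← Real.exp_add]
  ring_nf

/-- The real part of the second affine coordinate grows at least like `exp (t / 2)` along a flow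
line. -/
theorem affine_one_re_sq_le {γ : ℝ → CP2} (hγ : MorseFlow.IsFlowLine metric morse γ)
    (h : ∀ t, γ t ∈ affineSet 1) {s t : ℝ} (hst : s ≤ t) :
    (affine 1 (γ s) 1).re ^ 2 ≤ Real.exp (s - t) * (affine 1 (γ t) 1).re ^ 2 := by
  obtain ⟨u, b, ψ, h1, hψ⟩ := exists_eq_flowCoord hγ h
  have h2 := sq_le_sq_mul_exp h1 (fun t => rate_le _) hst
  rw [hψ, hψ]
  change (Real.exp s * ψ s) ^ 2 ≤ Real.exp (s - t) * (Real.exp t * ψ t) ^ 2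
  have e : Real.exp (s - t) * (Real.exp t) ^ 2 = Real.exp s ^ 2 * Real.exp (t - s) := by
    simp only [← Real.exp_nat_mul, ← Real.exp_add]
    push_cast
    ring_nf
  calc (Real.exp s * ψ s) ^ 2 ≤ Real.exp s ^ 2 * (ψ t ^ 2 * Real.exp (t - s)) := by
        rw [mul_pow]
        gcongr
    _ = Real.exp (s - t) * (Real.exp t) ^ 2 * ψ t ^ 2 := by
        rw [e]
        ring
    _ = _ := by ring

/-- On flow lines into the saddle point the real part of the second affine coordinate vanishes. -/
theorem affine_one_re_eq_zero {γ : ℝ → CP2} (hγ : MorseFlow.IsFlowLine metric morse γ)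
    (h : Tendsto γ atTop (𝓝 (vertex 1))) (s : ℝ) : (affine 1 (γ s) 1).re = 0 := by
  have hmem := mem_affineSet_of_tendsto hγ h
  have h1 : Tendsto (fun t => (affine 1 (γ t) 1).re ^ 2) atTop (𝓝 0) := by
    have h2 := (continuousAt_affine ((vertex_mem_affineSet_iff 1 1).2 rfl)).tendsto.comp h
    rw [affine_vertex] at h2
    have h3 := (Complex.continuous_re.tendsto _).comp (((continuous_apply 1).tendsto _).comp h2)
    simpa [Function.comp_def] using h3.pow 2
  have h2 : (affine 1 (γ s) 1).re ^ 2 ≤ 0 := by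
    refine ge_of_tendsto h1 ?_
    filter_upwards [eventually_ge_atTop s] with t ht
    refine (affine_one_re_sq_le hγ hmem ht).trans (mul_le_of_le_one_left (sq_nonneg _) ?_)
    rw [Real.exp_le_one_iff]
    linarith
  exact pow_eq_zero_iff two_ne_zero |>.1 (le_antisymm h2 (sq_nonneg _))

/-! ### A criterion for not being a submanifold -/

section Criterion

variable {V : Type*} [NormedAddCommGroup V] [NormedSpace ℝ V]
  {F : Type*} [NormedAddCommGroup F] [NormedSpace ℝ F]
  {H : Type*} [TopologicalSpace H] {J : ModelWithCorners ℝ F H}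
  {X : Type*} [TopologicalSpace X] [ChartedSpace H X]
  {G : Type*} [NormedAddCommGroup G] [NormedSpace ℝ G]

/-- A set `S` has a horn at `P` in the coordinates `χ` if it is tangent to first order at `P` to the
kernel of a linear form `ℓ`, while arbitrarily close to `P` there are pairs of points of `S` whose
difference makes an angle with that kernel that is bounded below in terms of `C`. -/
structure IsHorn (S : Set X) (P : X) (χ : X → G) (ℓ : G →L[ℝ] ℝ) (C : ℝ) : Prop where
  eq_zero : ℓ (χ P) = 0
  tangent : ∀ ε > 0, ∀ᶠ Q in 𝓝[S] P, |ℓ (χ Q)| ≤ ε * ‖χ Q - χ P‖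
  transverse : ∀ O ∈ 𝓝 P, ∃ Q ∈ S ∩ O, ∃ Q' ∈ S ∩ O, ℓ (χ Q) ≠ ℓ (χ Q') ∧
    ‖χ Q - χ Q'‖ ≤ C * |ℓ (χ Q) - ℓ (χ Q')|

/-- Points of `S` near `φ u₀` come from parameters near `u₀`. -/
theorem IsC1Patch.eventually_exists {S : Set X} {D A : Set V} {φ : V → X}
    (h : IsC1Patch J S D φ) {u₀ : V} (hu₀ : u₀ ∈ D) (hA : A ∈ 𝓝[D] u₀) :
    ∀ᶠ Q in 𝓝[S] (φ u₀), ∃ u ∈ D ∩ A, φ u = Q := by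
  obtain ⟨-, -, hemb, U, hU, hDU⟩ := h
  have h1 : Subtype.val ⁻¹' A ∈ 𝓝 (⟨u₀, hu₀⟩ : D) := preimage_coe_mem_nhds_subtype.2 hA
  rw [hemb.isInducing.nhds_eq_comap] at h1
  obtain ⟨O, hO, hOA⟩ := h1
  have h2 : φ u₀ ∈ S ∩ U := hDU ▸ ⟨u₀, hu₀, rfl⟩
  filter_upwards [mem_nhdsWithin_of_mem_nhds hO, mem_nhdsWithin_of_mem_nhds (hU.mem_nhds h2.2),
    self_mem_nhdsWithin] with Q hQO hQU hQS
  have h3 : Q ∈ φ '' D := hDU ▸ ⟨hQS, hQU⟩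
  obtain ⟨u, hu, rfl⟩ := h3
  exact ⟨u, ⟨hu, hOA (a := ⟨u, hu⟩) hQO⟩, rfl⟩

/-- There is no horn in normed coordinates on the image of a `C¹` immersion: the coordinate form of
the criterion. -/
theorem false_of_contDiffOn [FiniteDimensional ℝ V] {W K : Set V} (hW : IsOpen W) (hK : Convex ℝ K)
    (hKi : (interior K).Nonempty) {Φ : V → G} {L : V →L[ℝ] G} (hΦ : ContDiffOn ℝ 1 Φ (W ∩ K))
    {u₀ : V} (hu₀ : u₀ ∈ W ∩ K) (hL : HasFDerivWithinAt Φ L (W ∩ K) u₀)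
    (hinj : Function.Injective L) {ℓ : G →L[ℝ] ℝ} (h0 : ℓ (Φ u₀) = 0)
    (h1 : ∀ ε > 0, ∀ᶠ u in 𝓝[W ∩ K] u₀, |ℓ (Φ u)| ≤ ε * ‖Φ u - Φ u₀‖) {C : ℝ}
    (h2 : ∀ A ∈ 𝓝[W ∩ K] u₀, ∃ u ∈ W ∩ K ∩ A, ∃ u' ∈ W ∩ K ∩ A, ℓ (Φ u) ≠ ℓ (Φ u') ∧
      ‖Φ u - Φ u'‖ ≤ C * |ℓ (Φ u) - ℓ (Φ u')|) : False := by
  have hud : UniqueDiffOn ℝ (W ∩ K) := by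
    rw [Set.inter_comm]
    exact (uniqueDiffOn_convex hK hKi).inter hW
  -- Tangency: `ℓ ∘ Φ` is of smaller order than `Φ u - Φ u₀`, so its derivative at `u₀` vanishes.
  have hℓL : ℓ.comp L = 0 := by
    refine (hud u₀ hu₀).eq (ℓ.hasFDerivAt.comp_hasFDerivWithinAt u₀ hL) ?_
    refine .of_isLittleO ?_
    have e1 : (fun u => ℓ (Φ u)) =o[𝓝[W ∩ K] u₀] fun u => Φ u - Φ u₀ := by
      rw [Asymptotics.isLittleO_iff]
      intro ε hε
      exact h1 ε hε
    simpa [h0] using e1.trans_isBigO hL.isBigO_sub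
  obtain ⟨c, hc, hcL⟩ : ∃ c > 0, ∀ v, c * ‖v‖ ≤ ‖L v‖ := by
    obtain ⟨k, hk, hkL⟩ := L.toLinearMap.exists_antilipschitzWith (LinearMap.ker_eq_bot.2 hinj)
    refine ⟨(k : ℝ)⁻¹, by positivity, fun v => ?_⟩
    have := hkL.le_mul_dist v 0
    rw [map_zero, dist_zero_right, dist_zero_right] at this
    rw [inv_mul_le_iff₀ (by positivity)]
    exact this
  -- With this `ε`, a pair of points with `‖Φ u - Φ u' - L (u - u')‖ ≤ ε ‖u - u'‖` cannot be
  -- transverse with constant `C`.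
  obtain ⟨ε, hε, hεc⟩ : ∃ ε > 0, |C| * (‖ℓ‖ * ε) + ε < c := by
    refine ⟨c / (2 * (|C| * ‖ℓ‖ + 1)), by positivity, ?_⟩
    have hm : 0 < |C| * ‖ℓ‖ + 1 := by positivity
    have : |C| * (‖ℓ‖ * (c / (2 * (|C| * ‖ℓ‖ + 1)))) + c / (2 * (|C| * ‖ℓ‖ + 1)) = c / 2 := by
      field_simp
    rw [this]
    linarith
  have hLe : fderivWithin ℝ Φ (W ∩ K) u₀ = L := hL.fderivWithin (hud u₀ hu₀)
  have hcont : ContinuousWithinAt (fderivWithin ℝ Φ (W ∩ K)) (W ∩ K) u₀ :=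
    hΦ.continuousOn_fderivWithin hud le_rfl u₀ hu₀
  have hev : ∀ᶠ u in 𝓝[W ∩ K] u₀, ‖fderivWithin ℝ Φ (W ∩ K) u - L‖ < ε := by
    rw [ContinuousWithinAt, hLe] at hcont
    filter_upwards [hcont.eventually (Metric.ball_mem_nhds L hε)] with u hu
    exact mem_ball_iff_norm.1 hu
  rw [Metric.nhdsWithin_basis_ball.eventually_iff] at hev
  obtain ⟨r, hr, hev⟩ := hev
  obtain ⟨r', hr', hrW⟩ := Metric.isOpen_iff.1 hW u₀ hu₀.1
  have hsub : Metric.ball u₀ (min r r') ∩ K ⊆ W ∩ K := fun u hu =>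
    ⟨hrW (Metric.ball_subset_ball (min_le_right _ _) hu.1), hu.2⟩
  have hconv : Convex ℝ (Metric.ball u₀ (min r r') ∩ K) := (convex_ball _ _).inter hK
  obtain ⟨u, hu, u', hu', hne, hle⟩ := h2 (Metric.ball u₀ (min r r'))
    (mem_nhdsWithin_of_mem_nhds (Metric.ball_mem_nhds _ (lt_min hr hr')))
  -- Strict differentiability at `u₀`, by the mean value inequality on a convex set.
  have hdiff : ‖Φ u - Φ u' - L (u - u')‖ ≤ ε * ‖u - u'‖ := by
    refine hconv.norm_image_sub_le_of_norm_hasFDerivWithin_le' (f' := fderivWithin ℝ Φ (W ∩ K))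
      (fun v hv => ?_) (fun v hv => ?_) ⟨hu'.2, hu'.1.2⟩ ⟨hu.2, hu.1.2⟩
    · exact ((hΦ.differentiableOn one_ne_zero v (hsub hv)).hasFDerivWithinAt).mono hsub
    · exact (hev ⟨Metric.ball_subset_ball (min_le_left _ _) hv.1, hsub hv⟩).le
  have hpos : 0 < ‖u - u'‖ := by
    rw [norm_pos_iff, sub_ne_zero]
    rintro rfl
    exact hne rfl
  have e1 : c * ‖u - u'‖ ≤ ‖Φ u - Φ u'‖ + ε * ‖u - u'‖ := by
    refine (hcL _).trans ?_
    have := norm_sub_norm_le (L (u - u')) (Φ u - Φ u')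
    rw [norm_sub_rev (L (u - u')) (Φ u - Φ u')] at this
    linarith
  have e2 : |ℓ (Φ u) - ℓ (Φ u')| ≤ ‖ℓ‖ * (ε * ‖u - u'‖) := by
    have h3 : ℓ (Φ u) - ℓ (Φ u') = ℓ (Φ u - Φ u' - L (u - u')) := by
      have h4 : ℓ (L (u - u')) = 0 := congrArg (fun T : V →L[ℝ] ℝ => T (u - u')) hℓL
      rw [map_sub, map_sub, h4, sub_zero]
    rw [h3, ← Real.norm_eq_abs]
    exact (ℓ.le_opNorm _).trans (by gcongr)
  have e3 : C * |ℓ (Φ u) - ℓ (Φ u')| ≤ |C| * (‖ℓ‖ * (ε * ‖u - u'‖)) :=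
    mul_le_mul (le_abs_self C) e2 (abs_nonneg _) (abs_nonneg _)
  have e4 : c * ‖u - u'‖ ≤ (|C| * (‖ℓ‖ * ε) + ε) * ‖u - u'‖ := by
    calc _ ≤ |C| * (‖ℓ‖ * (ε * ‖u - u'‖)) + ε * ‖u - u'‖ := by linarith
      _ = _ := by ring
  exact absurd (le_of_mul_le_mul_right e4 hpos) (not_le.2 hεc)

/-- A horn is not parametrized by a `C¹` patch, be it interior or at the boundary. -/
theorem IsHorn.false_of_isC1Patch [FiniteDimensional ℝ V] {W K : Set V} (hW : IsOpen W)
    (hK : Convex ℝ K) (hKi : (interior K).Nonempty) {S : Set X} {φ : V → X}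
    (h : IsC1Patch J S (W ∩ K) φ) {P : X} (hP : P ∈ φ '' (W ∩ K)) {χ : X → G} {χ' : G → X} {Ω : Set X} (hΩ : IsOpen Ω)
    (hPΩ : P ∈ Ω) (hχ : ContMDiffOn J 𝓘(ℝ, G) 1 χ Ω)
    (hχ' : MDifferentiableAt 𝓘(ℝ, G) J χ' (χ P)) (hinv : ∀ Q ∈ Ω, χ' (χ Q) = Q)
    {ℓ : G →L[ℝ] ℝ} {C : ℝ} (hS : IsHorn S P χ ℓ C) : False := by
  obtain ⟨u₀, hu₀, rfl⟩ := hP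
  have hc : ContinuousOn φ (W ∩ K) := h.1.continuousOn
  obtain ⟨W', hW', hWφ⟩ := continuousOn_iff'.1 hc Ω hΩ
  have hsub : (W ∩ W') ∩ K ⊆ φ ⁻¹' Ω := fun u hu =>
    (hWφ.superset ⟨hu.1.2, hu.1.1, hu.2⟩ : u ∈ φ ⁻¹' Ω ∩ (W ∩ K)).1
  have hu₀' : u₀ ∈ (W ∩ W') ∩ K :=
    ⟨⟨hu₀.1, (hWφ.subset ⟨hPΩ, hu₀⟩).1⟩, hu₀.2⟩
  have hD : (W ∩ W') ∩ K ⊆ W ∩ K := Set.inter_subset_inter_left _ Set.inter_subset_left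
  have hnhds : (W ∩ W') ∩ K ∈ 𝓝[W ∩ K] u₀ := by
    filter_upwards [self_mem_nhdsWithin, mem_nhdsWithin_of_mem_nhds (hW'.mem_nhds hu₀'.1.2)]
      with u hu hu'
    exact ⟨⟨hu.1, hu'⟩, hu.2⟩
  have hΦ : ContDiffOn ℝ 1 (χ ∘ φ) ((W ∩ W') ∩ K) :=
    contMDiffOn_iff_contDiffOn.1 (hχ.comp (h.1.mono hD) hsub)
  have hL := (hΦ.differentiableOn one_ne_zero u₀ hu₀').hasFDerivWithinAt
  have hud : UniqueDiffWithinAt ℝ (W ∩ K) u₀ := by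
    rw [Set.inter_comm]
    exact (uniqueDiffOn_convex hK hKi).inter hW u₀ hu₀.symm
  refine false_of_contDiffOn (hW.inter hW') hK hKi hΦ hu₀' hL ?_ hS.eq_zero (fun ε hε => ?_)
    (C := C) (fun A hA => ?_) (ℓ := ℓ)
  · have e1 := hχ'.hasMFDerivAt.comp_hasMFDerivWithinAt u₀ hL.hasMFDerivWithinAt
    have e2 : HasMFDerivWithinAt 𝓘(ℝ, V) J φ (W ∩ K) u₀ _ :=
      (e1.congr_of_eventuallyEq (f₁ := φ) ?_ ?_).mono_of_mem_nhdsWithin hnhds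
    · have e3 := h.2.1 u₀ hu₀
      rw [e2.mfderivWithin hud.uniqueMDiffWithinAt] at e3
      exact Function.Injective.of_comp e3
    · filter_upwards [self_mem_nhdsWithin] with u hu
      exact (hinv _ (hsub hu)).symm
    · exact (hinv _ hPΩ).symm
  · have h3 : Tendsto φ (𝓝[(W ∩ W') ∩ K] u₀) (𝓝[S] (φ u₀)) := by
      refine tendsto_nhdsWithin_iff.2 ⟨((hc u₀ hu₀).mono hD).tendsto, ?_⟩
      filter_upwards [self_mem_nhdsWithin] with u hu
      obtain ⟨U, -, hU⟩ := h.2.2.2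
      exact (hU.subset ⟨u, hD hu, rfl⟩).1
    exact h3.eventually (hS.tangent ε hε)
  · have hA' : A ∩ ((W ∩ W') ∩ K) ∈ 𝓝[W ∩ K] u₀ := by
      refine inter_mem ?_ hnhds
      rw [← nhdsWithin_inter_of_mem' (s := W ∩ K) (t := (W ∩ W') ∩ K) hnhds,
        Set.inter_eq_self_of_subset_right hD]
      exact hA
    obtain ⟨O, hO, hOS⟩ := mem_nhdsWithin_iff_exists_mem_nhds_inter.1
      (IsC1Patch.eventually_exists h hu₀ hA')
    obtain ⟨Q, hQ, Q', hQ', h4⟩ := hS.transverse O hO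
    obtain ⟨u, hu, rfl⟩ := hOS hQ.symm
    obtain ⟨u', hu', rfl⟩ := hOS hQ'.symm
    exact ⟨u, ⟨hu.2.2, hu.2.1⟩, u', ⟨hu'.2.2, hu'.2.1⟩, h4⟩

/-- A set with a horn is not a `C¹` submanifold with boundary, whatever the boundary. -/
theorem IsHorn.not_isC1SubmanifoldWithBoundary {N S B : Set X} {P : X} (hP : P ∈ S) {χ : X → G}
    {χ' : G → X} {Ω : Set X} (hΩ : IsOpen Ω) (hPΩ : P ∈ Ω) (hχ : ContMDiffOn J 𝓘(ℝ, G) 1 χ Ω)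
    (hχ' : MDifferentiableAt 𝓘(ℝ, G) J χ' (χ P)) (hinv : ∀ Q ∈ Ω, χ' (χ Q) = Q)
    {ℓ : G →L[ℝ] ℝ} {C : ℝ} (hS : IsHorn S P χ ℓ C) :
    ¬ IsC1SubmanifoldWithBoundary J N S B := by
  rintro ⟨-, -, hint, hbd⟩
  by_cases hPB : P ∈ B
  · obtain ⟨k, W, φ, hW, hφ, hPφ, -⟩ := hbd P hPB
    refine hS.false_of_isC1Patch hW ?_ ⟨(1, 0), ?_⟩ hφ hPφ hΩ hPΩ hχ hχ' hinv
    · exact (convex_Ici (0 : ℝ)).is_linear_preimage (LinearMap.fst ℝ ℝ (Fin k → ℝ)).isLinear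
    · exact mem_interior.2 ⟨{u | 0 < u.1}, fun u (hu : 0 < u.1) => hu.le,
        isOpen_lt continuous_const continuous_fst, zero_lt_one (α := ℝ)⟩
  · obtain ⟨k, D, φ, hD, hφ, hPφ, -⟩ := hint P ⟨hP, hPB⟩
    rw [← Set.inter_univ D] at hφ hPφ
    exact hS.false_of_isC1Patch hD convex_univ (by simp) hφ hPφ hΩ hPΩ hχ hχ' hinv

end Criterion

/-! ### The horn of the evaluation map -/

theorem morse_eq_iff {x : CP2} (hx : x ∈ affineSet 1) {a : ℝ} : morse x = a ↔
    (1 - a) * Complex.normSq (affine 1 x 0) = a + (1 + a) * Complex.normSq (affine 1 x 1) := by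
  have h := morse_mk (homog 1 (affine 1 x))
  rw [mk_homog_affine 1 x hx, homog_one, height_eq] at h
  simp only [Matrix.cons_val, map_one] at h
  have h0 := Complex.normSq_nonneg (affine 1 x 0)
  have h1 := Complex.normSq_nonneg (affine 1 x 1)
  rw [h, div_eq_iff (by positivity)]
  constructor <;> intro h <;> linarith

theorem mk_homog_mem_evalImage {u v : ℂ} (hu : u ≠ 0) (hv : v ≠ 0) :
    (mk (homog 1 ![u, 0]), mk (homog 1 ![0, v])) ∈
      evalImage (morse (mk (homog 1 ![u, 0]))) (morse (mk (homog 1 ![0, v]))) := by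
  have m0 : mk (homog 1 ![u, 0]) ∈ affineSet 0 := by rw [mk_mem_affineSet, homog_one]; simpa
  have m2 : mk (homog 1 ![u, 0]) ∉ affineSet 2 := by rw [mk_mem_affineSet, homog_one]; simp
  have n0 : mk (homog 1 ![0, v]) ∉ affineSet 0 := by rw [mk_mem_affineSet, homog_one]; simp
  have n2 : mk (homog 1 ![0, v]) ∈ affineSet 2 := by rw [mk_mem_affineSet, homog_one]; simpa
  obtain ⟨γ, hγ, h0, h⟩ := exists_flowLine (mk (homog 1 ![u, 0]))
  obtain ⟨δ, hδ, k0, k⟩ := exists_flowLine (mk (homog 1 ![0, v]))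
  obtain ⟨α, hα⟩ := exists_points_eq_union ⟨γ, hγ, h.1 m0, h.2.2.2 m2 (mk_homog_mem 1 _)⟩
    ⟨δ, hδ, k.2.1 n0 (mk_homog_mem 1 _), k.2.2.1 n2⟩
  rw [← h0, ← k0]
  exact ⟨α, meetsAt_of_points_eq_union hα 0 0⟩

theorem sub_le_of_sq_sub_sq_le {a b d : ℝ} (hb : 0 ≤ b) (hba : b ≤ a) (hd : 0 ≤ d)
    (h : a ^ 2 - b ^ 2 ≤ d ^ 2) : a - b ≤ d := by
  by_contra! hlt
  nlinarith [mul_nonneg hb (sub_nonneg.2 hba)]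

/-- On the level `a₀`, where the first coordinate has modulus `w` and the second one has squared
modulus `v`, the distance of `w` from its value `ρ` on the axis `v = 0` is controlled by `√v`. -/
theorem entry_level_bounds {a₀ ρ R w v : ℝ} (h₀ : 0 < a₀) (h₁ : a₀ < 1) (hρ : 0 < ρ)
    (hρa : (1 - a₀) * ρ ^ 2 = a₀) (hw : 0 < w) (hv : 0 ≤ v) (hvR : v ≤ R)
    (h : (1 - a₀) * w ^ 2 = a₀ + (1 + a₀) * v) :
    w ^ 2 ≤ (1 + 2 * R) / (1 - a₀) ∧ ρ ≤ w ∧ ∀ m, 0 ≤ m → v ≤ m ^ 2 →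
      w - ρ ≤ (1 + (1 + a₀) / (1 - a₀)) * m := by
  have h1a : 0 < 1 - a₀ := by linarith
  have hc : 0 ≤ (1 + a₀) / (1 - a₀) := by positivity
  have hwρ : w ^ 2 - ρ ^ 2 = (1 + a₀) / (1 - a₀) * v := by
    field_simp
    linarith
  generalize (1 + a₀) / (1 - a₀) = c at *
  have hρw : ρ ≤ w := le_of_sq_le_sq (by linarith [mul_nonneg hc hv]) hw.le
  refine ⟨?_, hρw, fun m hm hvm => ?_⟩
  · rw [le_div_iff₀ h1a]
    nlinarith
  · refine sub_le_of_sq_sub_sq_le hρ.le hρw (by positivity) ?_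
    rw [hwρ, mul_pow]
    refine mul_le_mul ?_ hvm hv (by positivity)
    nlinarith

/-- Follow the flow line that passes at time `0` through the point with coordinates `(δ, x + i y)`
back to the level `a₀`. If `δ` is small compared to `x`, then the flow line has spent so much time
near the saddle point that the real part of its second coordinate dominates the first order
variation of all other coordinates. -/
theorem exists_entry_estimate {a₀ ρ : ℝ} (h₀ : a₀ ∈ Set.Ioo (0 : ℝ) 1) (hρ : 0 < ρ)
    (hρa : (1 - a₀) * ρ ^ 2 = a₀) {R : ℝ} (hR : 0 ≤ R) :
    ∃ C : ℝ, 0 ≤ C ∧ ∀ x > 0, ∃ δ₀ > (0 : ℝ), ∀ δ : ℝ, 0 < δ → δ ≤ δ₀ →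
      ∀ y, x ^ 2 + y ^ 2 ≤ R → ∀ γ : ℝ → CP2, MorseFlow.IsFlowLine metric morse γ →
      γ 0 = mk (homog 1 ![(δ : ℂ), ⟨x, y⟩]) → ∀ s < 0, morse (γ s) = a₀ →
      0 < |(affine 1 (γ s) 1).re| ∧ |(affine 1 (γ s) 1).re| ≤ x ∧
      ‖affine 1 (γ s) - ![(ρ : ℂ), 0]‖ ≤ C * |(affine 1 (γ s) 1).re| ∧
      δ ≤ C * |(affine 1 (γ s) 1).re| := by
  obtain ⟨h₀0, h₀1⟩ := h₀
  have h1a : 0 < 1 - a₀ := by linarith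
  obtain ⟨U, hU⟩ : ∃ U, U = (1 + 2 * R) / (1 - a₀) := ⟨_, rfl⟩
  obtain ⟨c, hc⟩ : ∃ c, c = (1 + a₀) / (1 - a₀) := ⟨_, rfl⟩
  obtain ⟨κ, hκ⟩ : ∃ κ, κ = 1 / (2 * (1 + (U + R)) ^ 2) := ⟨_, rfl⟩
  have hU0 : 0 ≤ U := by rw [hU]; positivity
  have hc0 : 0 ≤ c := by rw [hc]; positivity
  have hκ0 : 0 < κ := by rw [hκ]; positivity
  refine ⟨(1 + c) * (2 + R) + (1 + U), by positivity, fun x hx => ?_⟩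
  refine ⟨ρ * Real.exp (-(1 / (2 * κ * x ^ 2))), by positivity,
    fun δ hδ hδ₀ y hy γ hγ h0 s hs ha => ?_⟩
  have hmem := mem_affineSet_of_flowLine hγ (i := 1) (t₀ := 0) (h0 ▸ mk_homog_mem 1 _)
  obtain ⟨u, b, ψ, hψ, hflow⟩ := exists_eq_flowCoord hγ hmem
  have hini : flowCoord u b 0 (ψ 0) = ![(δ : ℂ), ⟨x, y⟩] := by
    rw [← hflow, h0, affine_mk_homog]
  obtain rfl : u = δ := by simpa [flowCoord] using congrFun hini 0
  have hini1 : (⟨Real.exp 0 * ψ 0, Real.exp 0 * b⟩ : ℂ) = ⟨x, y⟩ := congrFun hini 1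
  rw [Complex.mk.injEq, Real.exp_zero, one_mul, one_mul] at hini1
  obtain ⟨hψ0, rfl⟩ := hini1
  have hlevel := (morse_eq_iff (hmem s)).1 ha
  have n0 : ∀ t, Complex.normSq (flowCoord (δ : ℂ) b t (ψ t) 0) =
      (Real.exp (-t) * δ) ^ 2 := fun t => by
    simp only [flowCoord, Matrix.cons_val_zero, ← Complex.ofReal_mul, Complex.normSq_ofReal]
    ring
  have n1 : ∀ t, Complex.normSq (flowCoord (δ : ℂ) b t (ψ t) 1) =
      (Real.exp t * ψ t) ^ 2 + (Real.exp t * b) ^ 2 := by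
    intro t
    simp [flowCoord, Complex.normSq_mk]
    ring
  have hre : ∀ t, (flowCoord (δ : ℂ) b t (ψ t) 1).re = Real.exp t * ψ t := fun _ => rfl
  have him : ∀ t, (flowCoord (δ : ℂ) b t (ψ t) 1).im = Real.exp t * b := fun _ => rfl
  have hexp : ∀ t ≤ 0, (Real.exp t * ψ t) ^ 2 ≤ x ^ 2 := fun t ht => by
    have := affine_one_re_sq_le hγ hmem ht
    rw [hflow, hflow, hre, hre, Real.exp_zero, one_mul, hψ0] at this
    refine this.trans (mul_le_of_le_one_left (sq_nonneg _) ?_)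
    rw [Real.exp_le_one_iff]
    linarith
  have n1R : ∀ t ≤ 0, Complex.normSq (flowCoord (δ : ℂ) b t (ψ t) 1) ≤ R := fun t ht => by
    rw [n1]
    refine le_trans (add_le_add (hexp t ht) ?_) hy
    rw [mul_pow]
    exact mul_le_of_le_one_left (sq_nonneg _) (pow_le_one₀ (Real.exp_pos t).le
      (Real.exp_le_one_iff.2 ht))
  rw [hflow] at hlevel ⊢
  obtain ⟨v, hv⟩ : ∃ v, v = Complex.normSq (flowCoord (δ : ℂ) b s (ψ s) 1) := ⟨_, rfl⟩
  obtain ⟨w, hw⟩ : ∃ w, w = Real.exp (-s) * δ := ⟨_, rfl⟩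
  obtain ⟨m, hm⟩ : ∃ m, m = |Real.exp s * ψ s| := ⟨_, rfl⟩
  have hw0 : 0 < w := by rw [hw]; positivity
  have hv0 : 0 ≤ v := hv ▸ Complex.normSq_nonneg _
  have hvR : v ≤ R := hv ▸ n1R s hs.le
  rw [n0, ← hv, ← hw] at hlevel
  obtain ⟨hwU, hρw, hwρ⟩ := entry_level_bounds h₀0 h₀1 hρ hρa hw0 hv0 hvR hlevel
  rw [← hU] at hwU
  rw [← hc] at hwρ
  -- The time `-s` spent between the two levels is at least `1 / (2 κ x²)`, so that the slowed down
  -- coordinate has `ψ s ^ 2 ≥ x ^ 2 * exp (1 / x ^ 2) ≥ 1`.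
  have hEδ : Real.exp s * w = δ := by
    rw [hw, ← mul_assoc, ← Real.exp_add, add_neg_cancel, Real.exp_zero, one_mul]
  have hs' : s ≤ -(1 / (2 * κ * x ^ 2)) := by
    rw [← Real.exp_le_exp]
    have h1 : Real.exp s * ρ ≤ Real.exp (-(1 / (2 * κ * x ^ 2))) * ρ := by
      calc Real.exp s * ρ ≤ Real.exp s * w := by gcongr
        _ ≤ _ := by rw [hEδ, mul_comm]; exact hδ₀
    exact le_of_mul_le_mul_right h1 hρ
  have hψs : 1 ≤ ψ s ^ 2 := by
    have h1 := sq_mul_exp_le hψ hs.le (κ := κ) fun τ hτ => by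
      rw [hκ]
      refine le_rate (add_le_add ?_ (n1R τ hτ.2))
      rw [n0]
      refine le_trans (pow_le_pow_left₀ (by positivity) ?_ 2) hwU
      rw [hw]
      gcongr
      exact hτ.1
    rw [hψ0] at h1
    refine le_trans ?_ h1
    have h2 : 1 / x ^ 2 ≤ 2 * κ * (0 - s) := by
      have h3 := mul_le_mul_of_nonneg_left (neg_le_neg hs') (by positivity : 0 ≤ 2 * κ)
      have h4 : 2 * κ * - -(1 / (2 * κ * x ^ 2)) = 1 / x ^ 2 := by
        field_simp
      rw [h4] at h3
      linarith
    have h5 := Real.add_one_le_exp (2 * κ * (0 - s))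
    have h6 : 1 = x ^ 2 * (1 / x ^ 2) := by field_simp
    calc 1 = x ^ 2 * (1 / x ^ 2) := h6
      _ ≤ _ := by gcongr; linarith
  have hEm : Real.exp s ≤ m := by
    rw [hm, abs_mul, abs_of_pos (Real.exp_pos s)]
    exact le_mul_of_one_le_right (Real.exp_pos s).le (one_le_sq_iff_one_le_abs _ |>.1 hψs)
  have hm0 : 0 < m := (Real.exp_pos s).trans_le hEm
  have hb : |b| ≤ 1 + R := by
    refine abs_le_of_sq_le_sq ?_ (by linarith)
    nlinarith [sq_nonneg x]
  have him' : |Real.exp s * b| ≤ m * (1 + R) := by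
    rw [abs_mul, abs_of_pos (Real.exp_pos s)]
    gcongr
  have hvm : v ≤ (m * (2 + R)) ^ 2 := by
    rw [hv, n1, ← sq_abs (Real.exp s * ψ s), ← sq_abs (Real.exp s * b), ← hm]
    have := abs_nonneg (Real.exp s * b)
    nlinarith [mul_nonneg hm0.le hR]
  have hwU' : w ≤ 1 + U := by nlinarith
  have hmre : |(flowCoord (δ : ℂ) b s (ψ s) 1).re| = m := hm ▸ rfl
  rw [hmre]
  refine ⟨hm0, hm ▸ abs_le_of_sq_le_sq (hexp s hs.le) hx.le, ?_, ?_⟩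
  · rw [pi_norm_le_iff_of_nonneg (by positivity), Fin.forall_fin_two]
    constructor
    · have e : (flowCoord (δ : ℂ) b s (ψ s) - ![(ρ : ℂ), 0]) 0 = ((w - ρ : ℝ) : ℂ) := by
        simp [flowCoord, hw]
      rw [e, Complex.norm_real, Real.norm_eq_abs, abs_of_nonneg (sub_nonneg.2 hρw)]
      have h1 := hwρ (m * (2 + R)) (by positivity) hvm
      linarith [mul_nonneg (add_nonneg zero_le_one hU0) hm0.le]
    · have e : (flowCoord (δ : ℂ) b s (ψ s) - ![(ρ : ℂ), 0]) 1 =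
          flowCoord (δ : ℂ) b s (ψ s) 1 := by simp
      rw [e]
      refine (Complex.norm_le_abs_re_add_abs_im _).trans ?_
      rw [hmre, him]
      have h1 : 0 ≤ c * (2 + R) * m := by positivity
      linarith [mul_nonneg hU0 hm0.le]
  · have h1 : 0 ≤ (1 + c) * (2 + R) * m := by positivity
    have h2 : δ ≤ m * (1 + U) := by
      rw [← hEδ]
      gcongr
    linarith

/-- The affine coordinates at the saddle point, on each factor. -/
def affinePair (P : CP2 × CP2) : (Fin 2 → ℂ) × (Fin 2 → ℂ) := (affine 1 P.1, affine 1 P.2)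

/-- The inverse of `affinePair`. -/
def mkPair (w : (Fin 2 → ℂ) × (Fin 2 → ℂ)) : CP2 × CP2 := (mk (homog 1 w.1), mk (homog 1 w.2))

/-- The real part of the second coordinate on the first factor, that is, at the entry level. -/
def entryForm : (Fin 2 → ℂ) × (Fin 2 → ℂ) →L[ℝ] ℝ :=
  Complex.reCLM.comp ((ContinuousLinearMap.proj 1).comp (ContinuousLinearMap.fst ℝ _ _))

theorem entryForm_apply (w : (Fin 2 → ℂ) × (Fin 2 → ℂ)) : entryForm w = (w.1 1).re := rfl

theorem affinePair_mkPair (w : (Fin 2 → ℂ) × (Fin 2 → ℂ)) : affinePair (mkPair w) = w :=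
  Prod.ext (affine_mk_homog 1 _) (affine_mk_homog 1 _)

theorem mkPair_affinePair {P : CP2 × CP2} (h : P ∈ affineSet 1 ×ˢ affineSet 1) :
    mkPair (affinePair P) = P :=
  Prod.ext (mk_homog_affine 1 _ h.1) (mk_homog_affine 1 _ h.2)

theorem contMDiffOn_affinePair : ContMDiffOn (𝓘(ℝ, Fin 2 → ℂ).prod 𝓘(ℝ, Fin 2 → ℂ))
    𝓘(ℝ, (Fin 2 → ℂ) × (Fin 2 → ℂ)) 1 affinePair (affineSet 1 ×ˢ affineSet 1) := by
  have h := contMDiffOn_affine 1 (n := 1) (by exact_mod_cast le_top)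
  exact (h.comp contMDiff_fst.contMDiffOn fun P hP => hP.1).prodMk_space
    (h.comp contMDiff_snd.contMDiffOn fun P hP => hP.2)

theorem mdifferentiable_mkPair : MDifferentiable 𝓘(ℝ, (Fin 2 → ℂ) × (Fin 2 → ℂ))
    (𝓘(ℝ, Fin 2 → ℂ).prod 𝓘(ℝ, Fin 2 → ℂ)) mkPair := by
  have h := contMDiff_mk_homog 1 (n := 1) (by exact_mod_cast le_top)
  exact ((h.comp contDiff_fst.contMDiff).prodMk (h.comp contDiff_snd.contMDiff)).mdifferentiable
    one_ne_zero

theorem continuousOn_affinePair : ContinuousOn affinePair (affineSet 1 ×ˢ affineSet 1) :=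
  contMDiffOn_affinePair.continuousOn

theorem continuous_mkPair : Continuous mkPair := mdifferentiable_mkPair.continuous

section Horn

variable {a₀ a₁ ρ σ : ℝ}

/-- At the corner, the image of the evaluation map is tangent to the kernel of `entryForm`. -/
theorem evalImage_tangent (h₀ : a₀ ∈ Set.Ioo (0 : ℝ) 1) (h₁ : a₁ ∈ Set.Ioo (-1 : ℝ) 0) (hρ : 0 < ρ)
    {ε : ℝ} (hε : 0 < ε) :
    ∀ᶠ Q in 𝓝[evalImage a₀ a₁] (mkPair (![(ρ : ℂ), 0], ![0, (⟨0, σ⟩ : ℂ)])),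
      |entryForm (affinePair Q)| ≤
        ε * ‖affinePair Q - (![(ρ : ℂ), 0], ![0, (⟨0, σ⟩ : ℂ)])‖ := by
  obtain ⟨P, hP⟩ : ∃ P, P = mkPair (![(ρ : ℂ), 0], ![0, (⟨0, σ⟩ : ℂ)]) := ⟨_, rfl⟩
  have hPχ : affinePair P = (![(ρ : ℂ), 0], ![0, (⟨0, σ⟩ : ℂ)]) := by rw [hP, affinePair_mkPair]
  have hmem : P ∈ affineSet 1 ×ˢ affineSet 1 := hP ▸ ⟨mk_homog_mem 1 _, mk_homog_mem 1 _⟩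
  have hΩ : affineSet 1 ×ˢ affineSet 1 ∈ 𝓝 P :=
    ((isOpen_affineSet 1).prod (isOpen_affineSet 1)).mem_nhds hmem
  have hχ : Tendsto affinePair (𝓝 P) (𝓝 (affinePair P)) :=
    continuousOn_affinePair.continuousAt hΩ
  rw [hPχ] at hχ
  have c1 : Continuous fun w : (Fin 2 → ℂ) × (Fin 2 → ℂ) => ‖w.1 0‖ := by fun_prop
  have c2 : Continuous fun w : (Fin 2 → ℂ) × (Fin 2 → ℂ) => ‖w.2 0‖ := by fun_prop
  have t1 : ∀ᶠ Q in 𝓝 P, ρ / 2 < ‖(affinePair Q).1 0‖ := by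
    refine ((c1.tendsto _).comp hχ).eventually (lt_mem_nhds ?_)
    simp [abs_of_pos hρ, hρ]
  have t2 : ∀ᶠ Q in 𝓝 P, ‖(affinePair Q).2 0‖ < ε ^ 2 * (ρ / 2) := by
    refine ((c2.tendsto _).comp hχ).eventually (gt_mem_nhds ?_)
    simp
    positivity
  rw [← hP]
  filter_upwards [mem_nhdsWithin_of_mem_nhds hΩ, mem_nhdsWithin_of_mem_nhds t1,
    mem_nhdsWithin_of_mem_nhds t2, self_mem_nhdsWithin] with Q hQΩ hQ1 hQ2 hQ
  have hnorm : |((affinePair Q).2 1).re| ≤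
      ‖affinePair Q - (![(ρ : ℂ), 0], ![0, (⟨0, σ⟩ : ℂ)])‖ := by
    have e : ((affinePair Q).2 1).re =
        ((affinePair Q - (![(ρ : ℂ), 0], ![0, (⟨0, σ⟩ : ℂ)])).2 1).re := by simp
    rw [e]
    exact (Complex.abs_re_le_norm _).trans ((norm_le_pi_norm _ 1).trans (norm_snd_le _))
  obtain ⟨hm₀, hm₁, ⟨γ, s, t, rfl⟩ | ⟨γ, δ, s, t, rfl⟩⟩ := evalImage_cases h₀ h₁ hQ
  · have hst : s ≤ t := by
      have hanti := strictAnti_morse γ (morse_vertex_injective.ne (by decide))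
      refine (hanti.lt_iff_gt.1 ?_).le
      have e0 : morse (γ.toFun s) = a₀ := hm₀
      have e1 : morse (γ.toFun t) = a₁ := hm₁
      rw [e0, e1]
      linarith [h₀.1, h₁.2]
    have hγ := mem_affineSet_of_flowLine γ.isFlowLine hQΩ.1
    have e0 := affine_zero_eq γ.isFlowLine hγ s t
    have e1 := affine_one_re_sq_le γ.isFlowLine hγ hst
    simp only [affinePair] at hQ1 hQ2 hnorm
    rw [e0, norm_mul, Complex.norm_real, Real.norm_eq_abs, Real.abs_exp] at hQ2
    have h3 : Real.exp (s - t) ≤ ε ^ 2 := by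
      refine le_of_mul_le_mul_right ((?_ : _ ≤ _).trans hQ2.le) (half_pos hρ)
      gcongr
    rw [entryForm_apply]
    refine le_trans ?_ (mul_le_mul_of_nonneg_left hnorm hε.le)
    refine abs_le_of_sq_le_sq (e1.trans ?_) (by positivity)
    rw [mul_pow, sq_abs]
    gcongr
  · have e : entryForm (affinePair (γ.toFun s, δ.toFun t)) = 0 :=
      affine_one_re_eq_zero γ.isFlowLine γ.tendsto_atTop s
    rw [e, abs_zero]
    positivity

/-- Arbitrarily close to the corner there are an unbroken and a once broken flow line, with the same
real part `x` of the second coordinate at the exit level, such that the distance of their images is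
at most a constant times the difference in `entryForm`. -/
theorem evalImage_transverse (h₀ : a₀ ∈ Set.Ioo (0 : ℝ) 1) (h₁ : a₁ ∈ Set.Ioo (-1 : ℝ) 0)
    (hρ : 0 < ρ) (hρa : (1 - a₀) * ρ ^ 2 = a₀) (hσ : 0 < σ) (hσa : (1 + a₁) * σ ^ 2 = -a₁) :
    ∃ C, 0 ≤ C ∧ ∀ x, 0 < x → x ≤ σ → ∃ Q ∈ evalImage a₀ a₁, ∃ Q' ∈ evalImage a₀ a₁,
      Q ∈ affineSet 1 ×ˢ affineSet 1 ∧ Q' ∈ affineSet 1 ×ˢ affineSet 1 ∧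
      0 < |entryForm (affinePair Q)| ∧ entryForm (affinePair Q') = 0 ∧
      |entryForm (affinePair Q)| ≤ x ∧
      ‖affinePair Q - affinePair Q'‖ ≤ C * |entryForm (affinePair Q)| ∧
      ‖affinePair Q' - (![(ρ : ℂ), 0], ![0, (⟨0, σ⟩ : ℂ)])‖ ≤ 2 * x := by
  have h1a : 0 < 1 + a₁ := by linarith [h₁.1]
  obtain ⟨c, hc⟩ : ∃ c, c = (1 - a₁) / (1 + a₁) := ⟨_, rfl⟩
  have hc0 : 0 ≤ c := by
    have := h₁.2
    rw [hc]
    exact div_nonneg (by linarith) h1a.le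
  obtain ⟨C, hC0, hC⟩ := exists_entry_estimate h₀ hρ hρa (R := σ ^ 2 + c) (by positivity)
  refine ⟨(1 + c) * C, by positivity, fun x hx hxσ => ?_⟩
  obtain ⟨δ₀, hδ₀, hest⟩ := hC x hx
  obtain ⟨δ, hδ, hδ1, hδδ⟩ : ∃ δ : ℝ, 0 < δ ∧ δ ≤ 1 ∧ δ ≤ δ₀ :=
    ⟨min 1 δ₀, lt_min one_pos hδ₀, min_le_left _ _, min_le_right _ _⟩
  have hxσ2 : 0 ≤ σ ^ 2 - x ^ 2 := by nlinarith
  have hcδ : 0 ≤ c * δ ^ 2 := by positivity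
  -- The unbroken flow line leaves at `(δ, x + i y)`, the broken one at `(0, x + i y')`.
  obtain ⟨y, hy0, hy⟩ : ∃ y : ℝ, 0 ≤ y ∧ y ^ 2 = σ ^ 2 - x ^ 2 + c * δ ^ 2 :=
    ⟨_, Real.sqrt_nonneg _, Real.sq_sqrt (add_nonneg hxσ2 hcδ)⟩
  obtain ⟨y', hy0', hy'⟩ : ∃ y : ℝ, 0 ≤ y ∧ y ^ 2 = σ ^ 2 - x ^ 2 :=
    ⟨_, Real.sqrt_nonneg _, Real.sq_sqrt hxσ2⟩
  have hv : ∀ b : ℝ, (⟨x, b⟩ : ℂ) ≠ 0 := fun b h => hx.ne' (congrArg Complex.re h)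
  have hδ' : (δ : ℂ) ≠ 0 := Complex.ofReal_ne_zero.2 hδ.ne'
  obtain ⟨γ, hγ, hγ0, hlim⟩ := exists_flowLine (mk (homog 1 ![(δ : ℂ), ⟨x, y⟩]))
  have m0 : mk (homog 1 ![(δ : ℂ), ⟨x, y⟩]) ∈ affineSet 0 := by
    rw [mk_mem_affineSet, homog_one]
    exact hδ'
  have m2 : mk (homog 1 ![(δ : ℂ), ⟨x, y⟩]) ∈ affineSet 2 := by
    rw [mk_mem_affineSet, homog_one]
    exact hv y
  let Γ : MorseFlow.FlowLine metric morse (vertex 0) (vertex 2) :=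
    ⟨γ, hγ, hlim.1 m0, hlim.2.2.1 m2⟩
  have hexit : morse (γ 0) = a₁ := by
    rw [hγ0, morse_eq_iff (mk_homog_mem 1 _), affine_mk_homog]
    simp only [Matrix.cons_val_zero, Matrix.cons_val_one, Complex.normSq_ofReal, Complex.normSq_mk]
    have e : x * x + y * y = σ ^ 2 + c * δ ^ 2 := by linarith
    have e' : (1 + a₁) * c = 1 - a₁ := by
      rw [hc]
      field_simp
    rw [e]
    linear_combination -hσa - δ ^ 2 * e'
  obtain ⟨s, hs⟩ := exists_morse_flowLine_eq Γ (a := a₀) (by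
    rw [morse_vertex_zero, morse_vertex_two]
    exact ⟨by linarith [h₀.1], h₀.2⟩)
  have hs0 : s < 0 := by
    refine (strictAnti_morse Γ (morse_vertex_injective.ne (by decide))).lt_iff_gt.1 ?_
    change morse (γ 0) < morse (γ s)
    rw [hexit, show morse (γ s) = a₀ from hs]
    linarith [h₀.1, h₁.2]
  have hxy : x ^ 2 + y ^ 2 ≤ σ ^ 2 + c := by
    have : c * δ ^ 2 ≤ c := mul_le_of_le_one_right hc0 (pow_le_one₀ hδ.le hδ1)
    linarith
  obtain ⟨e1, e2, e3, e4⟩ := hest δ hδ hδδ y hxy γ hγ hγ0 s hs0 hs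
  have hmem := mem_affineSet_of_flowLine hγ (i := 1) (t₀ := 0) (hγ0 ▸ mk_homog_mem 1 _)
  refine ⟨(γ s, γ 0), ?_, mkPair (![(ρ : ℂ), 0], ![0, (⟨x, y'⟩ : ℂ)]), ?_, ⟨hmem s, hmem 0⟩,
    ⟨mk_homog_mem 1 _, mk_homog_mem 1 _⟩, e1, ?_, e2, ?_, ?_⟩
  · obtain ⟨α, hα⟩ := exists_points_eq_range Γ
    rw [← hexit, ← hs]
    exact ⟨α, meetsAt_of_points_eq_range hα s 0⟩
  · have h := mk_homog_mem_evalImage (Complex.ofReal_ne_zero.2 hρ.ne') (hv y')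
    rwa [(morse_eq_iff (mk_homog_mem 1 _)).2, (morse_eq_iff (mk_homog_mem 1 _)).2] at h
    · rw [affine_mk_homog]
      simp only [Matrix.cons_val_zero, Matrix.cons_val_one, Complex.normSq_mk, map_zero, mul_zero]
      rw [show x * x + y' * y' = σ ^ 2 by linarith, hσa]
      ring
    · rw [affine_mk_homog]
      simp only [Matrix.cons_val_zero, Matrix.cons_val_one, Complex.normSq_ofReal, map_zero,
        mul_zero]
      linarith
  · rw [affinePair_mkPair, entryForm_apply]
    simp
  · obtain ⟨m, hm⟩ : ∃ m, m = |entryForm (affinePair (γ s, γ 0))| := ⟨_, rfl⟩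
    change ‖_‖ ≤ C * |entryForm (affinePair (γ s, γ 0))| at e3
    change δ ≤ C * |entryForm (affinePair (γ s, γ 0))| at e4
    rw [← hm] at e3 e4 ⊢
    have hCm : 0 ≤ C * m := hδ.le.trans e4
    have hδC : (1 + c) * δ ≤ (1 + c) * C * m := by
      rw [mul_assoc]
      gcongr
    rw [affinePair_mkPair, affinePair, Prod.mk_sub_mk, norm_prod_le_iff]
    constructor
    · refine e3.trans ?_
      rw [mul_assoc]
      exact le_mul_of_one_le_left hCm (by linarith)
    · refine le_trans ?_ hδC
      rw [hγ0, affine_mk_homog, pi_norm_le_iff_of_nonneg (by positivity), Fin.forall_fin_two]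
      constructor
      · simp [abs_of_pos hδ]
        nlinarith
      · have hyy : y' ≤ y := le_of_sq_le_sq (by linarith) hy0
        have h5 : (⟨x, y⟩ - ⟨x, y'⟩ : ℂ) = ((y - y' : ℝ) : ℂ) * Complex.I := by
          apply Complex.ext <;> simp
        simp only [Pi.sub_apply, Matrix.cons_val_one, Matrix.cons_val_zero]
        rw [h5, norm_mul, Complex.norm_I, mul_one, Complex.norm_real, Real.norm_eq_abs,
          abs_of_nonneg (sub_nonneg.2 hyy)]
        refine sub_le_of_sq_sub_sq_le hy0' hyy (by positivity) ?_
        rw [hy, hy', mul_pow]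
        nlinarith [sq_nonneg δ, mul_nonneg hc0 (sq_nonneg δ), mul_nonneg hc0 hcδ]
  · rw [affinePair_mkPair, Prod.mk_sub_mk, norm_prod_le_iff]
    constructor
    · simpa using hx.le
    · rw [pi_norm_le_iff_of_nonneg (by positivity), Fin.forall_fin_two]
      constructor
      · simpa using hx.le
      · have hyσ : y' ≤ σ := le_of_sq_le_sq (by nlinarith) hσ.le
        have h6 := sub_le_of_sq_sub_sq_le hy0' hyσ hx.le (by linarith)
        refine (Complex.norm_le_abs_re_add_abs_im _).trans ?_
        simp [abs_of_pos hx, abs_of_nonpos (sub_nonpos.2 hyσ)]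
        linarith

theorem isHorn_evalImage (h₀ : a₀ ∈ Set.Ioo (0 : ℝ) 1) (h₁ : a₁ ∈ Set.Ioo (-1 : ℝ) 0)
    (hρ : 0 < ρ) (hρa : (1 - a₀) * ρ ^ 2 = a₀) (hσ : 0 < σ) (hσa : (1 + a₁) * σ ^ 2 = -a₁) :
    ∃ C, IsHorn (evalImage a₀ a₁) (mkPair (![(ρ : ℂ), 0], ![0, (⟨0, σ⟩ : ℂ)])) affinePair
      entryForm C := by
  obtain ⟨C, hC0, hC⟩ := evalImage_transverse h₀ h₁ hρ hρa hσ hσa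
  refine ⟨C, ?_, fun ε hε => ?_, fun O hO => ?_⟩
  · rw [affinePair_mkPair, entryForm_apply]
    simp
  · rw [affinePair_mkPair]
    exact evalImage_tangent h₀ h₁ hρ hε
  · obtain ⟨r, hr, hrO⟩ :=
      Metric.mem_nhds_iff.1 (continuous_mkPair.continuousAt.preimage_mem_nhds hO)
    obtain ⟨x, hx, hxσ, hxr⟩ : ∃ x, 0 < x ∧ x ≤ σ ∧ (C + 2) * x < r := by
      refine ⟨min σ (r / (2 * (C + 2))), by positivity, min_le_left _ _, ?_⟩
      calc (C + 2) * min σ (r / (2 * (C + 2))) ≤ (C + 2) * (r / (2 * (C + 2))) := by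
            gcongr
            exact min_le_right _ _
        _ = r / 2 := by field_simp
        _ < r := half_lt_self hr
    obtain ⟨Q, hQ, Q', hQ', hΩ, hΩ', e1, e2, e3, e4, e5⟩ := hC x hx hxσ
    have e6 := e4.trans (mul_le_mul_of_nonneg_left e3 hC0)
    refine ⟨Q, ⟨hQ, ?_⟩, Q', ⟨hQ', ?_⟩, ?_, ?_⟩
    · rw [← mkPair_affinePair hΩ]
      refine hrO (mem_ball_iff_norm.2 (lt_of_le_of_lt ?_ hxr))
      refine (norm_sub_le_norm_sub_add_norm_sub _ (affinePair Q') _).trans ?_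
      linarith
    · rw [← mkPair_affinePair hΩ']
      refine hrO (mem_ball_iff_norm.2 (lt_of_le_of_lt (e5.trans ?_) hxr))
      linarith [mul_nonneg hC0 hx.le]
    · rw [e2]
      exact abs_pos.1 e1
    · rwa [e2, sub_zero]

theorem not_isC1SubmanifoldWithBoundary_evalImage (h₀ : a₀ ∈ Set.Ioo (0 : ℝ) 1)
    (h₁ : a₁ ∈ Set.Ioo (-1 : ℝ) 0) (N B : Set (CP2 × CP2)) :
    ¬ IsC1SubmanifoldWithBoundary (𝓘(ℝ, Fin 2 → ℂ).prod 𝓘(ℝ, Fin 2 → ℂ)) N (evalImage a₀ a₁) B := by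
  have h0a : 0 < 1 - a₀ := by linarith [h₀.2]
  have h1a : 0 < 1 + a₁ := by linarith [h₁.1]
  obtain ⟨ρ, hρ, hρa⟩ : ∃ ρ : ℝ, 0 < ρ ∧ (1 - a₀) * ρ ^ 2 = a₀ := by
    have h := div_pos h₀.1 h0a
    refine ⟨_, Real.sqrt_pos.2 h, ?_⟩
    rw [Real.sq_sqrt h.le, mul_div_cancel₀ _ h0a.ne']
  obtain ⟨σ, hσ, hσa⟩ : ∃ σ : ℝ, 0 < σ ∧ (1 + a₁) * σ ^ 2 = -a₁ := by
    have h := div_pos (neg_pos.2 h₁.2) h1a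
    refine ⟨_, Real.sqrt_pos.2 h, ?_⟩
    rw [Real.sq_sqrt h.le, mul_div_cancel₀ _ h1a.ne']
  obtain ⟨C, hC⟩ := isHorn_evalImage h₀ h₁ hρ hρa hσ hσa
  refine hC.not_isC1SubmanifoldWithBoundary ?_ ((isOpen_affineSet 1).prod (isOpen_affineSet 1))
    ⟨mk_homog_mem 1 _, mk_homog_mem 1 _⟩ contMDiffOn_affinePair (mdifferentiable_mkPair _)
    fun Q hQ => mkPair_affinePair hQ
  have hσ' : (⟨0, σ⟩ : ℂ) ≠ 0 := fun h => hσ.ne' (congrArg Complex.im h)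
  have h := mk_homog_mem_evalImage (Complex.ofReal_ne_zero.2 hρ.ne') hσ'
  rwa [(morse_eq_iff (mk_homog_mem 1 _)).2, (morse_eq_iff (mk_homog_mem 1 _)).2] at h
  · rw [affine_mk_homog]
    simp only [Matrix.cons_val_zero, Matrix.cons_val_one, Complex.normSq_mk, map_zero, mul_zero,
      zero_add]
    rw [← sq, hσa]
    ring
  · rw [affine_mk_homog]
    simp only [Matrix.cons_val_zero, Matrix.cons_val_one, Complex.normSq_ofReal, map_zero, mul_zero]
    linarith

end Horn

end

end CP2

theorem mainTheorem10 :
    ∃ (g : MorseFlow.Metric (Fin 2 → ℂ) CP2) (f : CP2 → ℝ) (p q r : CP2),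
      MorseFlow.IsMorse (Fin 2 → ℂ) f ∧
      {x | MorseFlow.IsCritical (Fin 2 → ℂ) f x} = {p, q, r} ∧
      MorseFlow.index (Fin 2 → ℂ) f p = 4 ∧
      MorseFlow.index (Fin 2 → ℂ) f q = 0 ∧
      MorseFlow.index (Fin 2 → ℂ) f r = 2 ∧
      MorseFlow.SatisfiesTransversality g f ∧
      f q < f r ∧ f r < f p ∧
      Set.range (fun s : MorseFlow.CriticalSequence g f p q => List.ofFn s.point) =
        {[p, q], [p, r, q]} ∧
      ∀ a₀ ∈ Set.Ioo (f r) (f p), ∀ a₁ ∈ Set.Ioo (f q) (f r),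
        ∃ ev : MorseFlow.CompactifiedModuli g f p q → (f ⁻¹' {a₀}) × (f ⁻¹' {a₁}),
          MorseFlow.IsEvaluationMap g f p q a₀ a₁ ev ∧
          ∀ B : Set (CP2 × CP2),
            ¬ IsC1SubmanifoldWithBoundary (𝓘(ℝ, Fin 2 → ℂ).prod 𝓘(ℝ, Fin 2 → ℂ))
              ((f ⁻¹' {a₀}) ×ˢ (f ⁻¹' {a₁}))
              (Set.range fun α => (((ev α).1 : CP2), ((ev α).2 : CP2))) B := by
  refine ⟨CP2.metric, CP2.morse, CP2.vertex 0, CP2.vertex 2, CP2.vertex 1, CP2.isMorse_morse, ?_,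
    CP2.index_vertex_eq 0, CP2.index_vertex_eq 2, CP2.index_vertex_eq 1,
    CP2.satisfiesTransversality, ?_, ?_, CP2.range_criticalSequence, ?_⟩
  · ext x
    rw [Set.mem_ofPred_eq, CP2.isCritical_iff]
    constructor
    · rintro ⟨i, rfl⟩
      fin_cases i <;> simp
    · rintro (rfl | rfl | rfl) <;> exact ⟨_, rfl⟩
  · rw [CP2.morse_vertex_one, CP2.morse_vertex_two]
    norm_num
  · rw [CP2.morse_vertex_zero, CP2.morse_vertex_one]
    norm_num
  · rw [CP2.morse_vertex_zero, CP2.morse_vertex_one, CP2.morse_vertex_two]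
    intro a₀ h₀ a₁ h₁
    obtain ⟨ev, hev, hS⟩ := CP2.exists_isEvaluationMap h₀ h₁
    refine ⟨ev, hev, fun B => ?_⟩
    rw [hS]
    exact CP2.not_isC1SubmanifoldWithBoundary_evalImage h₀ h₁ _ B
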